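/- Let $k$ be a field of characteristic zero and let $n$ be a natural number. Let $k_{-1}[x_1,\dots,x_n]$ be the $k$-algebra generated by $x_1,\dots,x_n$ subject to $x_ix_j=-x_jx_i$ for $i\neq j$, graded by $\deg x_i=1$; the symmetric group $\mathfrak S_n$ acts on it by permuting the $x_i$. For $m\ge 1$ put $P_m=\sum_{i=1}^n x_i^m$, and for $1\le i\le n$ let $\rho_i=\sigma_i(x_1^2,\dots,x_n^2)$, where $\sigma_i$ is the $i$-th elementary symmetric polynomial. Let $f_{2m}\in k[p_1,\dots,p_n]$ be the polynomial that expresses power sums through elementary symmetric polynomials, $\sum_{i=1}^n z_i^m=f_{2m}(\sigma_1(z),\dots,\sigma_n(z))$ for commuting variables $z_1,\dots,z_n$ (so that $P_{2m}=f_{2m}(\rho_1,\dots,\rho_n)$), and put $a_{2m}=f_{2m}(p_1,\dots,p_n)$. Let $B$ be the algebra generated over the polynomial ring $k[p_1,\dots,p_n]$, whose elements are central in $B$, by $y_1,\dots,y_n$ subject to $y_jy_i=-y_iy_j+2a_{2i+2j-2}$ for $i<j$; grade it by $\deg p_i=2i$ and $\deg y_i=2i-1$. Put $r_i=y_i^2-a_{4i-2}$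 for $1\le i\le n$. Then: 1. $B$ is the iterated Ore extension $k[p_1,\dots,p_n][y_1;\tau_1,\delta_1]\cdots[y_n;\tau_n,\delta_n]$, where $\tau_j$ is the automorphism, and $\delta_j$ the $\tau_j$-derivation ($\delta_j(ab)=\tau_j(a)\delta_j(b)+\delta_j(a)b$), of the subalgebra generated by $p_1,\dots,p_n,y_1,\dots,y_{j-1}$ such that $\tau_j(r)=r$ and $\delta_j(r)=0$ for $r\in k[p_1,\dots,p_n]$, and $\tau_j(y_i)=-y_i$ and $\delta_j(y_i)=2a_{2i+2j-2}$ for $i<j$. Moreover $B$ is a connected graded, (left and right) noetherian, Artin–Schelter regular algebra of dimension $2n$. 2. Each $r_i$ is homogeneous of degree $4i-2$ and central in $B$, and for each $i$ the image of $r_i$ in $B/(r_1,\dots,r_{i-1})$ is regular (not a left or right zero divisor). 3. There is an isomorphism of graded $k$-algebras $B/(r_1,\dots,r_n)\cong k_{-1}[x_1,\dots,x_n]^{\mathfrak S_n}$ that sends the class of $p_i$ to $\rho_i$ and the class of $y_i$ to $P_{2i-1}$ for $1\le i\le n$. 4. Consequently $k_{-1}[x_1,\dots,x_n]^{\mathfrak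 S_n}$ is a classical complete intersection (cci): it is a connected graded noetherian algebra that is isomorphic, as a graded algebra, to $R/(\Omega_1,\dots,\Omega_m)$ for some connected graded noetherian Artin–Schelter regular algebra $R$ and some homogeneous elements $\Omega_1,\dots,\Omega_m$ of positive degree such that the image of $\Omega_i$ in $R/(\Omega_1,\dots,\Omega_{i-1})$ is normal and regular for each $i$. Here a connected graded algebra $A$ is Artin–Schelter regular of dimension $d$ if $A$ has injective dimension $d$ as a left and as a right module over itself, $\operatorname{Ext}^i_A({}_Ak,{}_AA)=\operatorname{Ext}^i_A(k_A,A_A)=0$ for $i\ne d$, $\operatorname{Ext}^d_A({}_Ak,{}_AA)\cong\operatorname{Ext}^d_A(k_A,A_A)\cong k(\ell)$ for some integer $\ell$, and $A$ has finite global dimension and finite Gelfand–Kirillov dimension. -/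

import Mathlib

universe u v

open CategoryTheory

/-! ### Graded algebras, Gelfand-Kirillov dimension -/

/-- The span, in the `k`-algebra `A`, of all words in the elements `gen a` of total weight `d`,
where the letter `gen a` has weight `w a`.  If the `gen a` generate `A`, subject to relations that
are homogeneous for these weights, this is the degree `d` part of the resulting grading of `A`. -/
def wordGrading (k : Type u) [Field k] {A : Type v} [Ring A] [Algebra k A] {ι : Type}
    (gen : ι → A) (w : ι → ℕ) (d : ℕ) : Submodule k A :=
  Submodule.span k {a | ∃ l : List ι, (l.map w).sum = d ∧ a = (l.map gen).prod}

/-- `A = k ⊕ A₁ ⊕ A₂ ⊕ ⋯` with `A_i A_j ⊆ A_{i+j}`. -/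
structure IsConnectedGraded (k : Type u) [Field k] {A : Type v} [Ring A] [Algebra k A]
    (𝒜 : ℕ → Submodule k A) : Prop where
  nontrivial : Nontrivial A
  graded : Nonempty (GradedAlgebra 𝒜)
  zero_eq : 𝒜 0 = (1 : Submodule k A)

/-- Left and right noetherian. -/
def IsTwoSidedNoetherian (A : Type v) [Ring A] : Prop :=
  IsNoetherianRing A ∧ IsNoetherianRing Aᵐᵒᵖ

/-- The Gelfand-Kirillov dimension: the supremum, over the finite-dimensional subspaces `V`, of
`limsup_m log (dim (k + V)^m) / log m`, where `(k + V)^m = k + V + V^2 + ⋯ + V^m`. -/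
noncomputable def gkDimension (k : Type u) [Field k] (A : Type v) [Ring A] [Algebra k A] : EReal :=
  ⨆ (V : Submodule k A) (_ : V.FG),
    Filter.limsup (fun m : ℕ =>
      ((Real.log (Module.finrank k ↥((1 ⊔ V) ^ m)) / Real.log m : ℝ) : EReal)) Filter.atTop

/-- The (left) global dimension: the supremum of the projective dimensions of left modules. -/
noncomputable def globalDimension (A : Type u) [Ring A] : WithBot ℕ∞ :=
  ⨆ M : ModuleCat.{u} A, projectiveDimension M

/-! ### Graded modules and the grading of `Ext` -/

/-- `ℳ` is a `ℤ`-grading of the left `A`-module `M` over the graded algebra `(A, 𝒜)`. -/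
structure IsGradedModule {k : Type u} [Field k] {A : Type u} [Ring A] [Algebra k A]
    (𝒜 : ℕ → Submodule k A) {M : Type u} [AddCommGroup M] [Module A M]
    (ℳ : ℤ → AddSubgroup M) : Prop where
  decomposition : DirectSum.IsInternal ℳ
  smul_mem : ∀ (i : ℕ) (j : ℤ) (a : A) (m : M), a ∈ 𝒜 i → m ∈ ℳ j → a • m ∈ ℳ ((i : ℤ) + j)

/-- `IsHomogeneousExt 𝒜 ℳ 𝒩 s e` says that `e ∈ Ext^m_A(M, N)` is homogeneous of degree `s` with
respect to the gradings `ℳ` of `M` and `𝒩` of `N`.  Homogeneous elements are the Yoneda products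
of homogeneous module homomorphisms (elements of `Ext⁰`) and of classes (in `Ext¹`) of short exact
sequences of graded modules; a short exact sequence whose maps have degrees `a` and `b` has a
class of degree `-(a + b)`. -/
inductive IsHomogeneousExt {k : Type u} [Field k] {A : Type u} [Ring A] [Algebra k A]
    (𝒜 : ℕ → Submodule k A) :
    ∀ {M N : ModuleCat.{u} A} (_ : ℤ → AddSubgroup M) (_ : ℤ → AddSubgroup N)
      {m : ℕ} (_ : ℤ) (_ : Abelian.Ext M N m), Prop
  | hom {M N : ModuleCat.{u} A} (ℳ : ℤ → AddSubgroup M) (𝒩 : ℤ → AddSubgroup N)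
      (hℳ : IsGradedModule 𝒜 ℳ) (h𝒩 : IsGradedModule 𝒜 𝒩) (f : M ⟶ N) (s : ℤ)
      (hf : ∀ (j : ℤ) (x : M), x ∈ ℳ j → f.hom x ∈ 𝒩 (j + s)) :
      IsHomogeneousExt 𝒜 ℳ 𝒩 s (Abelian.Ext.mk₀ f)
  | extClass (S : ShortComplex (ModuleCat.{u} A)) (hS : S.ShortExact)
      (𝒢₁ : ℤ → AddSubgroup S.X₁) (𝒢₂ : ℤ → AddSubgroup S.X₂) (𝒢₃ : ℤ → AddSubgroup S.X₃)
      (h₁ : IsGradedModule 𝒜 𝒢₁) (h₂ : IsGradedModule 𝒜 𝒢₂) (h₃ : IsGradedModule 𝒜 𝒢₃)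
      (a b : ℤ) (hf : ∀ (j : ℤ) (x : S.X₁), x ∈ 𝒢₁ j → S.f.hom x ∈ 𝒢₂ (j + a))
      (hg : ∀ (j : ℤ) (x : S.X₂), x ∈ 𝒢₂ j → S.g.hom x ∈ 𝒢₃ (j + b)) :
      IsHomogeneousExt 𝒜 𝒢₃ 𝒢₁ (-(a + b)) hS.extClass
  | comp {L M N : ModuleCat.{u} A} {ℒ : ℤ → AddSubgroup L} {ℳ : ℤ → AddSubgroup M}
      {𝒩 : ℤ → AddSubgroup N} {m₁ m₂ m₃ : ℕ} {s₁ s₂ : ℤ}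
      {e₁ : Abelian.Ext L M m₁} {e₂ : Abelian.Ext M N m₂} (h : m₁ + m₂ = m₃)
      (he₁ : IsHomogeneousExt 𝒜 ℒ ℳ s₁ e₁) (he₂ : IsHomogeneousExt 𝒜 ℳ 𝒩 s₂ e₂) :
      IsHomogeneousExt 𝒜 ℒ 𝒩 (s₁ + s₂) (e₁.comp e₂ h)

/-- The grading of the left module `A`, seen as a `ℤ`-grading. -/
def selfGrading {k : Type u} [Field k] {A : Type u} [Ring A] [Algebra k A]
    (𝒜 : ℕ → Submodule k A) (j : ℤ) : AddSubgroup (ModuleCat.of A A) :=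
  if 0 ≤ j then (𝒜 j.toNat).toAddSubgroup else ⊥

/-- The left ideal `A₁ ⊕ A₂ ⊕ ⋯`. -/
def augmentationIdeal {k : Type u} [Field k] {A : Type u} [Ring A] [Algebra k A]
    (𝒜 : ℕ → Submodule k A) : Submodule A A :=
  Submodule.span A {a | ∃ i : ℕ, 0 < i ∧ a ∈ 𝒜 i}

/-- The trivial left module `k = A / (A₁ ⊕ A₂ ⊕ ⋯)`. -/
noncomputable def trivialModule {k : Type u} [Field k] {A : Type u} [Ring A] [Algebra k A]
    (𝒜 : ℕ → Submodule k A) : ModuleCat.{u} A :=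
  ModuleCat.of A (A ⧸ augmentationIdeal 𝒜)

/-- The trivial module is concentrated in degree `0`. -/
noncomputable def trivialModuleGrading {k : Type u} [Field k] {A : Type u} [Ring A] [Algebra k A]
    (𝒜 : ℕ → Submodule k A) (j : ℤ) : AddSubgroup (trivialModule 𝒜) :=
  if j = 0 then ⊤ else ⊥

/-! ### Artin-Schelter regular algebras and classical complete intersections -/

/-- The conditions on left modules in the definition of an AS regular algebra of dimension `d`
and AS index `ℓ`; the last field says that `A` has finite global dimension. -/
structure IsLeftASRegular (k : Type u) [Field k] {A : Type u} [Ring A] [Algebra k A]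
    (𝒜 : ℕ → Submodule k A) (d : ℕ) (ℓ : ℤ) : Prop where
  injectiveDimension_eq : injectiveDimension (ModuleCat.of A A) = d
  ext_eq_zero : ∀ i : ℕ, i ≠ d →
    Subsingleton (Abelian.Ext (trivialModule 𝒜) (ModuleCat.of A A) i)
  /-- `Ext^d_A(k, A) ≅ k(ℓ)`: it is one-dimensional, and concentrated in degree `-ℓ`. -/
  ext_dim : Module.finrank k (Abelian.Ext (trivialModule 𝒜) (ModuleCat.of A A) d) = 1
  ext_degree : ∀ e : Abelian.Ext (trivialModule 𝒜) (ModuleCat.of A A) d,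
    IsHomogeneousExt 𝒜 (trivialModuleGrading 𝒜) (selfGrading 𝒜) (-ℓ) e
  globalDimension_lt : globalDimension A < ⊤

/-- The grading of the opposite algebra. -/
def opGrading {k : Type u} [Field k] {A : Type u} [Ring A] [Algebra k A]
    (𝒜 : ℕ → Submodule k A) (i : ℕ) : Submodule k Aᵐᵒᵖ :=
  (𝒜 i).map (MulOpposite.opLinearEquiv k : A ≃ₗ[k] Aᵐᵒᵖ).toLinearMap

/-- Artin-Schelter regular of dimension `d`, for a connected graded algebra; right modules over
`A` are left modules over `Aᵐᵒᵖ`. -/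
structure IsASRegular (k : Type u) [Field k] {A : Type u} [Ring A] [Algebra k A]
    (𝒜 : ℕ → Submodule k A) (d : ℕ) : Prop where
  connected : IsConnectedGraded k 𝒜
  regular : ∃ ℓ : ℤ, IsLeftASRegular k 𝒜 d ℓ ∧ IsLeftASRegular k (opGrading 𝒜) d ℓ
  gkDimension_lt : gkDimension k A < ⊤

/-- The quotient of `A` by the two-sided ideal generated by `s`. -/
abbrev QuotientBy {A : Type v} [Ring A] (s : Set A) : Type v :=
  (TwoSidedIdeal.span s).ringCon.Quotient

/-- The quotient map onto the quotient of `A` by the two-sided ideal generated by `s`. -/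
abbrev quotientMap (k : Type u) [Field k] {A : Type v} [Ring A] [Algebra k A] (s : Set A) :
    A →ₐ[k] QuotientBy s :=
  RingCon.mkₐ k (TwoSidedIdeal.span s).ringCon

/-- `xA = Ax`. -/
def IsNormalElement {A : Type v} [Ring A] (x : A) : Prop :=
  (∀ a : A, ∃ b : A, x * a = b * x) ∧ (∀ a : A, ∃ b : A, a * x = x * b)

/-- For each `i`, the image of `Ω i` in the quotient by the two-sided ideal generated by the
earlier members of the sequence is regular (a left and right non-zero-divisor). -/
def IsRegularSequence (k : Type u) [Field k] {A : Type v} [Ring A] [Algebra k A] {m : ℕ}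
    (Ω : Fin m → A) : Prop :=
  ∀ i : Fin m, IsRegular (quotientMap k (Ω '' {j | j < i}) (Ω i))

/-- For each `i`, the image of `Ω i` in the quotient by the two-sided ideal generated by the
earlier members of the sequence is normal. -/
def IsNormalSequence (k : Type u) [Field k] {A : Type v} [Ring A] [Algebra k A] {m : ℕ}
    (Ω : Fin m → A) : Prop :=
  ∀ i : Fin m, IsNormalElement (quotientMap k (Ω '' {j | j < i}) (Ω i))

/-- `(A, 𝒜)` is a classical complete intersection: a connected graded noetherian algebra that is
isomorphic, as a graded algebra, to a connected graded noetherian AS regular algebra modulo a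
regular normal sequence of homogeneous elements of positive degree. -/
def IsCCI (k : Type u) [Field k] {A : Type u} [Ring A] [Algebra k A]
    (𝒜 : ℕ → Submodule k A) : Prop :=
  IsConnectedGraded k 𝒜 ∧ IsTwoSidedNoetherian A ∧
  ∃ (R : Type u) (_ : Ring R) (_ : Algebra k R) (ℛ : ℕ → Submodule k R) (d m : ℕ) (Ω : Fin m → R)
    (e : QuotientBy (Set.range Ω) ≃ₐ[k] A),
    IsTwoSidedNoetherian R ∧ IsASRegular k ℛ d ∧
    (∀ i, ∃ j : ℕ, 0 < j ∧ Ω i ∈ ℛ j) ∧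
    IsRegularSequence k Ω ∧ IsNormalSequence k Ω ∧
    ∀ j : ℕ, (ℛ j).map (e.toAlgHom.comp (quotientMap k (Set.range Ω))).toLinearMap = 𝒜 j

/-! ### Ore extensions -/

/-- `T = S[y; τ, δ]` inside the ambient ring `B`, where `τ` is an automorphism of `S` and `δ` is a
`τ`-derivation: `T` is a free left `S`-module on the powers of `y`, and `y a = τ(a) y + δ(a)`. -/
structure IsOreExtension {K : Type u} [CommRing K] {B : Type v} [Ring B] [Algebra K B]
    (S T : Subalgebra K B) (y : B) (τ : S ≃ₐ[K] S) (δ : S →ₗ[K] S) : Prop where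
  le : S ≤ T
  mem : y ∈ T
  leibniz : ∀ a b : S, δ (a * b) = τ a * δ b + δ a * b
  mul_eq : ∀ a : S, y * (a : B) = (τ a : B) * y + (δ a : B)
  existsUnique : ∀ t ∈ T, ∃! c : ℕ →₀ S, t = c.sum fun m a => (a : B) * y ^ m

/-! ### The skew polynomial ring `k_{-1}[x₁, …, xₙ]` and its invariants; the variables are
indexed by `0, …, n-1` -/

/-- The relations `x_i x_j = - x_j x_i` for `i ≠ j`. -/
inductive SkewPoly.Rel (k : Type u) [Field k] (n : ℕ) :
    FreeAlgebra k (Fin n) → FreeAlgebra k (Fin n) → Prop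
  | anticomm (i j : Fin n) (h : i ≠ j) :
      SkewPoly.Rel k n (FreeAlgebra.ι k i * FreeAlgebra.ι k j)
        (-(FreeAlgebra.ι k j * FreeAlgebra.ι k i))

/-- The algebra `k_{-1}[x₁, …, xₙ]`. -/
def SkewPoly (k : Type u) [Field k] (n : ℕ) : Type u := RingQuot (SkewPoly.Rel k n)

namespace SkewPoly

noncomputable instance instRing (k : Type u) [Field k] (n : ℕ) : Ring (SkewPoly k n) :=
  inferInstanceAs (Ring (RingQuot (SkewPoly.Rel k n)))

noncomputable instance instAlgebra (k : Type u) [Field k] (n : ℕ) : Algebra k (SkewPoly k n) :=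
  inferInstanceAs (Algebra k (RingQuot (SkewPoly.Rel k n)))

/-- The quotient map from the free algebra. -/
noncomputable def mk (k : Type u) [Field k] (n : ℕ) :
    FreeAlgebra k (Fin n) →ₐ[k] SkewPoly k n :=
  RingQuot.mkAlgHom k (Rel k n)

/-- The generators `x_i`. -/
noncomputable def x (k : Type u) [Field k] (n : ℕ) (i : Fin n) : SkewPoly k n :=
  mk k n (FreeAlgebra.ι k i)

theorem x_anticomm (k : Type u) [Field k] (n : ℕ) (i j : Fin n) (h : i ≠ j) :
    x k n i * x k n j = -(x k n j * x k n i) := by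
  have h' : mk k n _ = mk k n _ := RingQuot.mkAlgHom_rel k (Rel.anticomm (k := k) i j h)
  simpa only [x, map_mul, map_neg] using h'

/-- The algebra endomorphism `x_i ↦ x_{σ(i)}`. -/
noncomputable def permute (k : Type u) [Field k] (n : ℕ) (σ : Equiv.Perm (Fin n)) :
    SkewPoly k n →ₐ[k] SkewPoly k n :=
  RingQuot.liftAlgHom k ⟨FreeAlgebra.lift k fun i => x k n (σ i), by
    rintro _ _ ⟨i, j, h⟩
    simpa only [map_mul, map_neg, FreeAlgebra.lift_ι_apply] using x_anticomm k n (σ i) (σ j) (fun e => h (σ.injective e))⟩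

/-- The subalgebra of invariants of the full symmetric group. -/
noncomputable def invariants (k : Type u) [Field k] (n : ℕ) : Subalgebra k (SkewPoly k n) :=
  ⨅ σ : Equiv.Perm (Fin n), AlgHom.equalizer (permute k n σ) (AlgHom.id k (SkewPoly k n))

/-- The grading of the ring of invariants induced by `deg x_i = 1`. -/
noncomputable def invariantsGrading (k : Type u) [Field k] (n : ℕ) (d : ℕ) :
    Submodule k (invariants k n) :=
  (wordGrading k (x k n) (fun _ => 1) d).comap (invariants k n).val.toLinearMap

/-- The power sum `P_m = ∑ x_i^m`. -/
noncomputable def powerSum (k : Type u) [Field k] (n m : ℕ) : SkewPoly k n :=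
  ∑ i : Fin n, x k n i ^ m

/-- `ρ_m`, the `m`-th elementary symmetric function of the `x_i²`: the sum over
`i₁ < ⋯ < i_m` of `x_{i₁}² ⋯ x_{i_m}²`. -/
noncomputable def elemSquares (k : Type u) [Field k] (n m : ℕ) : SkewPoly k n :=
  ∑ s ∈ (Finset.univ : Finset (Fin n)).powersetCard m,
    ((s.sort (· ≤ ·)).map fun i => x k n i ^ 2).prod

end SkewPoly

/-! ### The algebra `B` -/

namespace CoverAlgebra

/-- `a_{2m}`: the polynomial `f` in `p₁, …, pₙ` such that the power sum `∑ z_i^m` of commuting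
variables `z₁, …, zₙ` is `f(σ₁(z), …, σₙ(z))`, with `σ_i` the elementary symmetric polynomials.
(The variable `p_{i+1}` is `X i`.) -/
noncomputable def a (k : Type u) [Field k] (n m : ℕ) : MvPolynomial (Fin n) k :=
  (MvPolynomial.esymmAlgEquiv (Fin n) k (Fintype.card_fin n)).symm
    ⟨MvPolynomial.psum (Fin n) k m, MvPolynomial.psum_isSymmetric (Fin n) k m⟩

/-- The relations `y_j y_i = - y_i y_j + 2 a_{2i+2j-2}` for `i < j`; with indices that start at
`0`, the right-hand side involves the `(i+j+1)`-st power sum. -/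
inductive Rel (k : Type u) [Field k] (n : ℕ) :
    FreeAlgebra (MvPolynomial (Fin n) k) (Fin n) →
    FreeAlgebra (MvPolynomial (Fin n) k) (Fin n) → Prop
  | skew (i j : Fin n) (h : i < j) :
      Rel k n
        (FreeAlgebra.ι (MvPolynomial (Fin n) k) j * FreeAlgebra.ι (MvPolynomial (Fin n) k) i)
        (-(FreeAlgebra.ι (MvPolynomial (Fin n) k) i * FreeAlgebra.ι (MvPolynomial (Fin n) k) j)
          + algebraMap (MvPolynomial (Fin n) k) _ (2 * a k n (i + j + 1)))

end CoverAlgebra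

/-- The algebra `B` over `k[p₁, …, pₙ]` (whose elements are central in `B`) generated by
`y₁, …, yₙ` with the relations `y_j y_i = - y_i y_j + 2 a_{2i+2j-2}` for `i < j`. -/
def CoverAlgebra (k : Type u) [Field k] (n : ℕ) : Type u :=
  RingQuot (CoverAlgebra.Rel k n)

namespace CoverAlgebra

noncomputable instance instRing (k : Type u) [Field k] (n : ℕ) : Ring (CoverAlgebra k n) :=
  inferInstanceAs (Ring (RingQuot (CoverAlgebra.Rel k n)))

noncomputable instance instAlgebraBase (k : Type u) [Field k] (n : ℕ) :
    Algebra (MvPolynomial (Fin n) k) (CoverAlgebra k n) :=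
  inferInstanceAs (Algebra (MvPolynomial (Fin n) k) (RingQuot (CoverAlgebra.Rel k n)))

/-- `B` as an algebra over the ground field, through `k ⊆ k[p₁, …, pₙ]`. -/
noncomputable instance instAlgebra (k : Type u) [Field k] (n : ℕ) :
    Algebra k (CoverAlgebra k n) :=
  inferInstanceAs (Algebra k (RingQuot (CoverAlgebra.Rel k n)))

/-- The quotient map from the free algebra over `k[p₁, …, pₙ]`. -/
noncomputable def mk (k : Type u) [Field k] (n : ℕ) :
    FreeAlgebra (MvPolynomial (Fin n) k) (Fin n) →ₐ[MvPolynomial (Fin n) k] CoverAlgebra k n :=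
  RingQuot.mkAlgHom (MvPolynomial (Fin n) k) (Rel k n)

/-- The generators `p_i`. -/
noncomputable def p (k : Type u) [Field k] (n : ℕ) (i : Fin n) : CoverAlgebra k n :=
  algebraMap (MvPolynomial (Fin n) k) (CoverAlgebra k n) (MvPolynomial.X i)

/-- The generators `y_i`. -/
noncomputable def y (k : Type u) [Field k] (n : ℕ) (i : Fin n) : CoverAlgebra k n :=
  mk k n (FreeAlgebra.ι (MvPolynomial (Fin n) k) i)

/-- The grading with `deg p_i = 2i` and `deg y_i = 2i - 1` (for `i = 1, …, n`). -/
noncomputable def grading (k : Type u) [Field k] (n : ℕ) (d : ℕ) :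
    Submodule k (CoverAlgebra k n) :=
  wordGrading k (Sum.elim (p k n) (y k n))
    (Sum.elim (fun i : Fin n => 2 * ((i : ℕ) + 1)) (fun i : Fin n => 2 * (i : ℕ) + 1)) d

/-- The elements `r_i = y_i² - a_{4i-2}`. -/
noncomputable def r (k : Type u) [Field k] (n : ℕ) (i : Fin n) : CoverAlgebra k n :=
  y k n i ^ 2 - algebraMap (MvPolynomial (Fin n) k) (CoverAlgebra k n) (a k n (2 * i + 1))

/-- The subalgebra generated by `p₁, …, pₙ, y₁, …, y_j`. -/
noncomputable def stage (k : Type u) [Field k] (n j : ℕ) :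
    Subalgebra (MvPolynomial (Fin n) k) (CoverAlgebra k n) :=
  Algebra.adjoin (MvPolynomial (Fin n) k) (y k n '' {i | (i : ℕ) < j})

/-- `B = k[p₁, …, pₙ][y₁; τ₁, δ₁] ⋯ [yₙ; τₙ, δₙ]`, where `τ_j` and `δ_j` are linear over
`k[p₁, …, pₙ]` (so that `τ_j(r) = r` and `δ_j(r) = 0` for `r` in this ring), `τ_j(y_i) = - y_i`
and `δ_j(y_i) = 2 a_{2i+2j-2}` for `i < j`. -/
structure IsIteratedOreExtension (k : Type u) [Field k] (n : ℕ) : Prop where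
  base : Function.Injective (algebraMap (MvPolynomial (Fin n) k) (CoverAlgebra k n))
  top : stage k n n = ⊤
  step : ∀ j : Fin n, ∃ (τ : stage k n j ≃ₐ[MvPolynomial (Fin n) k] stage k n j)
    (δ : stage k n j →ₗ[MvPolynomial (Fin n) k] stage k n j),
    IsOreExtension (stage k n j) (stage k n (j + 1)) (y k n j) τ δ ∧
    δ 1 = 0 ∧
    ∀ (i : Fin n) (s : stage k n j), i < j → (s : CoverAlgebra k n) = y k n i →
      τ s = -s ∧ δ s = algebraMap (MvPolynomial (Fin n) k) (stage k n j) (2 * a k n (i + j + 1))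

end CoverAlgebra

/-!
The algebra `B` has relations `y_j y_i = - y_i y_j + c_ij` with central `c_ij`, like a Clifford
algebra, but without relations for the squares of the generators.  It acts on a Fock space with
basis indexed by `ℕ^n`, by creation operators corrected by annihilation operators (`Fock.op_rel`).
Applied to the vacuum, the ordered monomials in the `y_i` give the standard basis, so they are a
basis of `B` over `k[p₁, …, pₙ]` (`exists_monomialBasis`).  Consequences are the structure of an
iterated Ore extension, with `τ_j` the restriction of the parity automorphism `y_i ↦ - y_i` and
`δ_j(a) = y_j a - τ_j(a) y_j`; finite Gelfand-Kirillov dimension; and, as the squares of the `y_i`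
are central, that `B` is free on the square-free monomials over the central polynomial ring
`k[p₁, …, pₙ][r₁, …, rₙ]` (`CoverAlgebra.exists_centralBasis`).  The last fact shows that `B` is
noetherian and that the `r_i` form a central regular sequence.

For Artin-Schelter regularity, an Ore extension raises the global dimension by at most one: every
module `N` over `T = S[y; τ, δ]` sits in an exact sequence
`0 ⟶ N ⟶ Hom_S(T, N) ⟶ Hom_S(T, N^τ) ⟶ 0`, and coextension of scalars does not raise the injective
dimension (`hasInjectiveDimensionLT_of_skew_extension`).  So the global dimension of `B` is at most
`2n`.  The elements `p₁, …, pₙ, y₁, …, yₙ` form a regular sequence, in which each element commutes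
with the later ones up to sign modulo its predecessors, because `B` modulo the `p_i` is
`k_{-1}[x₁, …, xₙ]`.  The `2n` connecting homomorphisms attached to the sequence identify `Ext(k, B)`
with `k`, placed in cohomological degree `2n`, and each of them shifts the internal degree by the
degree of the corresponding element (`IsSkewRegularSequence.exists_ext_param`).  The
anti-automorphism of `B` that fixes the generators takes care of right modules.

The odd power sums satisfy `P_s P_t + P_t P_s = 2 P_{s+t}`, so `p_i ↦ ρ_i`, `y_i ↦ P_{2i-1}` defines a
homomorphism from `B` to the invariants that kills the `r_i`.

* It is surjective.  The orbit sums of monomials span the invariants and, by induction on the number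
  of variables that occur, lie in the algebra generated by all power sums
  (`SkewPoly.orbitSum_basis_mem`).  Even power sums are polynomials in the `ρ_i`; an odd power sum
  `P_{2m+1}` with `m ≥ n` reduces to smaller ones because each `x_l²` is a root of
  `∏ (t - x_j²)` (`SkewPoly.powerSum_odd_add`).
* Its kernel is generated by the `r_i`.  Modulo the `r_i`, the algebra `B` is free over
  `k[p₁, …, pₙ]` on the square-free monomials in the `y_i`, so it is enough that the square-free
  products of `P₁, P₃, …, P_{2n-1}` are linearly independent over `k[x₁², …, xₙ²]`.  There are `2^n`
  of them, as many as the rank of `k_{-1}[x₁, …, xₙ]`, and their span over `k[x₁², …, xₙ²]` is a ring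
  that contains a nonzero multiple of each `x_l`, as the matrix from the `x_l` to the odd power sums
  is a Vandermonde matrix in the `x_l²` (`CoverAlgebra.linearIndependent_powerSumMonomial`).
-/

/-! ### Injective dimension over Ore extensions -/

section Coextension

variable {S T : Type u} [Ring S] [Ring T] (f : S →+* T)

theorem injective_coextendScalars (I : ModuleCat.{u} S) [Injective I] :
    Injective ((ModuleCat.coextendScalars f).obj I) :=
  have : (ModuleCat.restrictScalars.{u} f).PreservesMonomorphisms := inferInstance
  Injective.injective_of_adjoint (ModuleCat.restrictCoextendScalarsAdj.{u} f) I

/-- `Hom_S(T, -)` is exact when `T` is projective as a left `S`-module. -/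
theorem shortExact_map_coextendScalars
    [Module.Projective S ((ModuleCat.restrictScalars f).obj (ModuleCat.of T T))]
    {X : ShortComplex (ModuleCat.{u} S)} (hX : X.ShortExact) :
    (X.map (ModuleCat.coextendScalars f)).ShortExact := by
  have hinj := hX.moduleCat_injective_f
  have hsur := hX.moduleCat_surjective_g
  have hex := (ShortComplex.ShortExact.moduleCat_exact_iff_function_exact _).1 hX.exact
  refine ModuleCat.shortComplex_shortExact _ ?_ ?_ ?_
  · intro (φ : (ModuleCat.coextendScalars f).obj _)
    constructor
    · intro hφ
      have h1 : ∀ t : T, ∃ x : X.X₁, X.f.hom x = φ t := fun t =>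
        (hex _).1 (by
          have := congrArg (fun z => ModuleCat.CoextendScalars.equiv f X.X₃ z t) hφ
          exact this)
      choose ψ hψ using h1
      refine ⟨(ModuleCat.CoextendScalars.equiv f X.X₁).symm
        { toFun := ψ
          map_add' := fun a b => hinj (by
            erw [map_add, hψ, hψ, hψ]
            exact map_add (ModuleCat.CoextendScalars.equiv f X.X₂ φ) a b)
          map_smul' := fun s a => hinj (by
            erw [map_smul, hψ, hψ]
            exact map_smul (ModuleCat.CoextendScalars.equiv f X.X₂ φ) s a) }, ?_⟩
      refine ModuleCat.CoextendScalars.ext (LinearMap.ext fun t => ?_)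
      exact hψ t
    · rintro ⟨ψ, rfl⟩
      refine ModuleCat.CoextendScalars.ext (LinearMap.ext fun t => ?_)
      exact hex.apply_apply_eq_zero _
  · intro (φ : (ModuleCat.coextendScalars f).obj _) (ψ : (ModuleCat.coextendScalars f).obj _) h
    refine ModuleCat.CoextendScalars.ext (LinearMap.ext fun t => hinj ?_)
    exact congrArg (fun z => ModuleCat.CoextendScalars.equiv f X.X₂ z t) h
  · intro (φ : (ModuleCat.coextendScalars f).obj _)
    obtain ⟨ψ, hψ⟩ := Module.projective_lifting_property X.g.hom
      (ModuleCat.CoextendScalars.equiv f X.X₃ φ) hsur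
    refine ⟨(ModuleCat.CoextendScalars.equiv f X.X₂).symm ψ, ?_⟩
    refine ModuleCat.CoextendScalars.ext (LinearMap.ext fun t => ?_)
    exact LinearMap.congr_fun hψ t

/-- Coextension of scalars along a projective ring extension does not raise the injective
dimension: it is exact, and preserves injectives because its left adjoint is exact. -/
theorem hasInjectiveDimensionLT_coextendScalars
    [Module.Projective S ((ModuleCat.restrictScalars f).obj (ModuleCat.of T T))]
    (d : ℕ) (M : ModuleCat.{u} S) [HasInjectiveDimensionLT M d] :
    HasInjectiveDimensionLT ((ModuleCat.coextendScalars f).obj M) d := by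
  induction d generalizing M with
  | zero =>
    have hM : Limits.IsZero M := isZero_of_hasInjectiveDimensionLT_zero M
    have : Limits.IsZero ((ModuleCat.coextendScalars f).obj M) := by
      rw [ModuleCat.isZero_iff_subsingleton] at hM ⊢
      exact ⟨fun a b => ModuleCat.CoextendScalars.ext
        (LinearMap.ext fun t => Subsingleton.elim (α := M) _ _)⟩
    exact this.hasInjectiveDimensionLT_zero
  | succ d ih =>
    rcases Nat.eq_zero_or_pos d with rfl | hd
    · have : Injective M := injective_iff_hasInjectiveDimensionLT_one.2 ‹_›
      have := injective_coextendScalars f M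
      infer_instance
    · obtain ⟨e, rfl⟩ : ∃ e, d = e + 1 := ⟨d - 1, by omega⟩
      let X : ShortComplex (ModuleCat.{u} S) :=
        ShortComplex.mk (Injective.ι M) (Limits.cokernel.π (Injective.ι M)) (by simp)
      have hX : X.ShortExact :=
        { exact := ShortComplex.exact_of_g_is_cokernel _ (Limits.cokernelIsCokernel _) }
      have hI : Injective X.X₂ := inferInstanceAs (Injective (Injective.under M))
      have h3 : HasInjectiveDimensionLT X.X₃ (e + 1) :=
        (hX.hasInjectiveDimensionLT_X₃_iff e hI).2 ‹_›
      have hc := shortExact_map_coextendScalars f hX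
      exact (hc.hasInjectiveDimensionLT_X₃_iff e (injective_coextendScalars f X.X₂)).1 (ih X.X₃)

end Coextension

/-- Let `T` be an extension of `S` that is free as a left `S`-module on the powers of `y`, where
`y a = τ(a) y + δ(a)`.  If all `S`-modules have injective dimension `< d`, then all `T`-modules
have injective dimension `< d + 1`.  Indeed, every `T`-module `N` sits in an exact sequence
`0 ⟶ N ⟶ Hom_S(T, N) ⟶ Hom_S(T, N^τ) ⟶ 0`, where `N^τ` is `N` with the action of `S` twisted
by `τ`, and the second map sends `φ` to `t ↦ y φ(t) - φ(y t)`. -/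
theorem hasInjectiveDimensionLT_of_skew_extension {S T : Type u} [Ring S] [Ring T] (f : S →+* T)
    (y : T) (τ : S →+* S) (δ : S → S) (hmul : ∀ a, y * f a = f (τ a) * y + f (δ a))
    (hfree : ∀ t : T, ∃! c : ℕ →₀ S, t = c.sum fun m a => f a * y ^ m) (d : ℕ)
    (h : ∀ M : ModuleCat.{u} S, HasInjectiveDimensionLT M d) (N : ModuleCat.{u} T) :
    HasInjectiveDimensionLT N (d + 1) := by
  -- `TS` is `T` as an `S`-module; `toT` and `ofT` only change the type.
  let TS : ModuleCat.{u} S := (ModuleCat.restrictScalars f).obj (ModuleCat.of T T)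
  let toT : TS → T := fun x => x
  let ofT : T → TS := fun x => x
  let L : (ℕ →₀ S) →ₗ[S] TS := Finsupp.linearCombination S (fun m => ofT (y ^ m))
  have hL : ∀ c : ℕ →₀ S, toT (L c) = c.sum fun m a => f a * y ^ m := fun c => rfl
  have hbij : Function.Bijective L := by
    constructor
    · intro c c' hc
      exact (hfree (toT (L c))).unique (hL c) (by rw [hc]; exact hL c')
    · intro t
      obtain ⟨c, hc, -⟩ := hfree t
      exact ⟨c, hc.symm⟩
  let B : Module.Basis ℕ S TS := Module.Basis.ofRepr (LinearEquiv.ofBijective L hbij).symm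
  have hB : ∀ m, B m = ofT (y ^ m) := fun m =>
    (Finsupp.linearCombination_single S (1 : S) m).trans (one_smul S (ofT (y ^ m)))
  have : Module.Projective S TS := Module.Projective.of_basis B
  let N₀ : ModuleCat.{u} S := (ModuleCat.restrictScalars f).obj N
  let N₁ : ModuleCat.{u} S := (ModuleCat.restrictScalars (f.comp τ)).obj N
  let C₀ := (ModuleCat.coextendScalars f).obj N₀
  let C₁ := (ModuleCat.coextendScalars f).obj N₁
  let act : T → N → N := fun t n => t • n
  let ι : N →ₗ[T] C₀ :=
    { toFun := fun n => (ModuleCat.CoextendScalars.equiv f N₀).symm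
        { toFun := fun t => act t n
          map_add' := fun a b => add_smul (toT a) (toT b) n
          map_smul' := fun s a => mul_smul (f s) (toT a) n }
      map_add' := fun n n' => ModuleCat.CoextendScalars.ext (LinearMap.ext fun t =>
        smul_add (toT t) n n')
      map_smul' := fun t n => ModuleCat.CoextendScalars.ext (LinearMap.ext fun t' =>
        (mul_smul (toT t') t n).symm) }
  let ev : C₀ → T → N := fun φ t => ModuleCat.CoextendScalars.equiv f N₀ φ t
  have ev_smul : ∀ φ s t, ev φ (f s * t) = act (f s) (ev φ t) := fun φ s t =>
    map_smul (ModuleCat.CoextendScalars.equiv f N₀ φ) s (ofT t)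
  have ev_add : ∀ φ t t', ev φ (t + t') = ev φ t + ev φ t' := fun φ t t' =>
    map_add (ModuleCat.CoextendScalars.equiv f N₀ φ) (ofT t) (ofT t')
  let π : C₀ →ₗ[T] C₁ :=
    { toFun := fun φ => (ModuleCat.CoextendScalars.equiv f N₁).symm
        { toFun := fun t => act y (ev φ t) - ev φ (y * toT t)
          map_add' := fun a b => by
            change act y (ev φ (toT a + toT b)) - ev φ (y * (toT a + toT b)) =
              (act y (ev φ (toT a)) - ev φ (y * toT a)) + (act y (ev φ (toT b)) - ev φ (y * toT b))
            rw [mul_add, ev_add, ev_add]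
            simp only [act, smul_add]
            abel
          map_smul' := fun s a => by
            change act y (ev φ (f s * toT a)) - ev φ (y * (f s * toT a)) =
              act (f (τ s)) (act y (ev φ (toT a)) - ev φ (y * toT a))
            rw [← mul_assoc, hmul, add_mul, ev_add, mul_assoc, ev_smul, ev_smul, ev_smul]
            simp only [act, smul_sub, ← mul_smul]
            rw [hmul, add_smul]
            abel }
      map_add' := fun φ ψ => ModuleCat.CoextendScalars.ext (LinearMap.ext fun t => by
        change act y (ev φ t + ev ψ t) - (ev φ (y * toT t) + ev ψ (y * toT t)) =
          (act y (ev φ t) - ev φ (y * toT t)) + (act y (ev ψ t) - ev ψ (y * toT t))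
        simp only [act, smul_add]
        abel)
      map_smul' := fun t φ => ModuleCat.CoextendScalars.ext (LinearMap.ext fun t' => by
        change act y (ev φ (toT t' * t)) - ev φ ((y * toT t') * t) =
          act y (ev φ (toT t' * t)) - ev φ (y * (toT t' * t))
        rw [mul_assoc]) }
  have zero : π.comp ι = 0 := by
    refine LinearMap.ext fun n => ?_
    refine ModuleCat.CoextendScalars.ext (LinearMap.ext fun t => ?_)
    change act y (act t n) - act (y * toT t) n = 0
    rw [sub_eq_zero]
    exact (mul_smul _ _ _).symm
  let X := ModuleCat.shortComplexOfCompEqZero ι π zero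
  have hX : X.ShortExact := by
    refine ModuleCat.shortComplex_shortExact _ ?_ ?_ ?_
    · intro (φ : C₀)
      constructor
      · intro hφ
        have h1 : ∀ t, ev φ (y * t) = act y (ev φ t) := fun t => by
          have := congrArg (fun z => ModuleCat.CoextendScalars.equiv f N₁ z t) hφ
          exact (sub_eq_zero.1 this).symm
        -- If `φ(y t) = y φ(t)` for all `t`, then `φ` is determined by `φ(1)`.
        have h2 : ∀ m, ev φ (y ^ m) = act (y ^ m) (ev φ 1) := fun m => by
          induction m with
          | zero => simp [act]
          | succ m ih => rw [pow_succ', h1, ih]; exact (mul_smul _ _ _).symm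
        refine ⟨ev φ 1, ModuleCat.CoextendScalars.ext ?_⟩
        refine B.ext fun m => ?_
        rw [hB]
        exact (h2 m).symm
      · rintro ⟨n, rfl⟩
        exact LinearMap.congr_fun zero n
    · intro n n' hn
      have := congrArg (fun z => ModuleCat.CoextendScalars.equiv f N₀ z (1 : T)) hn
      change act 1 n = act 1 n' at this
      simpa [act] using this
    · intro (ψ : C₁)
      let evψ : T → N := fun t => ModuleCat.CoextendScalars.equiv f N₁ ψ t
      -- A preimage `φ` of `ψ` is given by `φ(1) = 0` and `φ(y^(m+1)) = y φ(y^m) - ψ(y^m)`.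
      let v : ℕ → N := fun m => Nat.rec 0 (fun m x => act y x - evψ (y ^ m)) m
      let w : ℕ → N₀ := v
      let φ₀ : TS →ₗ[S] N₀ := B.constr ℕ w
      let φ : C₀ := (ModuleCat.CoextendScalars.equiv f N₀).symm φ₀
      have hφ : ∀ m, ev φ (y ^ m) = v m := fun m =>
        (congrArg φ₀ (hB m)).symm.trans (B.constr_basis ℕ w m)
      refine ⟨φ, ModuleCat.CoextendScalars.ext (B.ext fun m => ?_)⟩
      rw [hB]
      change act y (ev φ (y ^ m)) - ev φ (y * y ^ m) = evψ (y ^ m)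
      rw [← pow_succ', hφ, hφ]
      change act y (v m) - (act y (v m) - evψ (y ^ m)) = _
      abel
  have h₀ := h N₀
  have h₁ := h N₁
  refine hX.hasInjectiveDimensionLT_X₁ d ?_ ?_
  · exact hasInjectiveDimensionLT_coextendScalars f d N₁
  · have := hasInjectiveDimensionLT_coextendScalars f d N₀
    exact hasInjectiveDimensionLT_of_ge (X := C₀) d (d + 1) (by omega)

theorem hasInjectiveDimensionLT_of_isOreExtension {K : Type u} [CommRing K] {B : Type u} [Ring B]
    [Algebra K B] {S T : Subalgebra K B} {y : B} {τ : S ≃ₐ[K] S} {δ : S →ₗ[K] S}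
    (hore : IsOreExtension S T y τ δ) (d : ℕ)
    (h : ∀ M : ModuleCat.{u} S, HasInjectiveDimensionLT M d) (N : ModuleCat.{u} T) :
    HasInjectiveDimensionLT N (d + 1) := by
  refine hasInjectiveDimensionLT_of_skew_extension (Subalgebra.inclusion hore.le).toRingHom
    ⟨y, hore.mem⟩ (τ : S →+* S) δ (fun a => Subtype.ext (hore.mul_eq a)) (fun t => ?_) d h N
  have key : ∀ c : ℕ →₀ S, (t = c.sum fun m a => (Subalgebra.inclusion hore.le).toRingHom a *
      (⟨y, hore.mem⟩ : T) ^ m) ↔ (t : B) = c.sum fun m a => (a : B) * y ^ m := fun c => by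
    rw [Subtype.ext_iff, Finsupp.sum, Finsupp.sum, AddSubmonoidClass.coe_finsetSum]
    rfl
  simpa only [key] using hore.existsUnique t t.2

/-- Injective dimension bounds for all modules are invariant under ring isomorphisms. -/
theorem hasInjectiveDimensionLT_of_ringEquiv {S T : Type u} [Ring S] [Ring T] (e : S ≃+* T) (d : ℕ)
    (h : ∀ M : ModuleCat.{u} S, HasInjectiveDimensionLT M (d + 1)) (N : ModuleCat.{u} T) :
    HasInjectiveDimensionLT N (d + 1) := by
  let M : ModuleCat.{u} S := (ModuleCat.restrictScalars e.toRingHom).obj N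
  have := RingHomInvPair.of_ringEquiv e
  have := RingHomInvPair.of_ringEquiv e.symm
  let φ : M ≃ₛₗ[RingHomClass.toRingHom e] N :=
    { toFun := fun x => x, invFun := fun x => x, map_add' := fun _ _ => rfl,
      map_smul' := fun _ _ => rfl, left_inv := fun _ => rfl, right_inv := fun _ => rfl }
  exact (ModuleCat.hasInjectiveDimensionLE_iff_of_semiLinearEquiv (M := M) e φ d).1 (h M)

theorem hasInjectiveDimensionLT_field {k : Type u} [Field k] (M : ModuleCat.{u} k) :
    HasInjectiveDimensionLT M (0 + 1) := by
  have : Injective M := ⟨fun {X Y} g f hf => by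
    obtain ⟨r, hr⟩ := LinearMap.exists_leftInverse_of_injective f.hom
      (LinearMap.ker_eq_bot.2 ((ModuleCat.mono_iff_injective f).1 hf))
    exact ⟨ModuleCat.ofHom (g.hom.comp r), ModuleCat.hom_ext <| LinearMap.ext fun x => by
      have := LinearMap.congr_fun hr x
      simp only [LinearMap.comp_apply, LinearMap.id_apply] at this
      simp [this]⟩⟩
  infer_instance

theorem hasInjectiveDimensionLT_polynomial {R : Type u} [CommRing R] (d : ℕ)
    (h : ∀ M : ModuleCat.{u} R, HasInjectiveDimensionLT M d)
    (M : ModuleCat.{u} (Polynomial R)) : HasInjectiveDimensionLT M (d + 1) := by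
  refine hasInjectiveDimensionLT_of_skew_extension Polynomial.C Polynomial.X (RingHom.id R)
    (fun _ => 0) (fun a => by simp [Polynomial.X_mul_C]) (fun t => ?_) d h M
  have hsum : ∀ (c : ℕ →₀ R) (m : ℕ),
      (c.sum fun m a => Polynomial.C a * Polynomial.X ^ m).coeff m = c m := fun c m => by
    simp [Finsupp.sum, Polynomial.coeff_C_mul,
      Polynomial.coeff_X_pow]
  refine ⟨Finsupp.onFinset t.support t.coeff fun m hm => Polynomial.mem_support_iff.2 hm,
    Polynomial.ext fun m => (hsum (Finsupp.onFinset _ t.coeff _) m).symm, ?_⟩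
  rintro c rfl
  exact Finsupp.ext fun m => (hsum c m).symm

/-- Over a polynomial ring in `n` variables over a field, all modules have injective dimension
at most `n`. -/
theorem hasInjectiveDimensionLT_mvPolynomial {k : Type u} [Field k] (n : ℕ)
    (M : ModuleCat.{u} (MvPolynomial (Fin n) k)) : HasInjectiveDimensionLT M (n + 1) := by
  induction n with
  | zero =>
    exact hasInjectiveDimensionLT_of_ringEquiv
      (MvPolynomial.isEmptyAlgEquiv k (Fin 0)).symm.toRingEquiv 0 hasInjectiveDimensionLT_field M
  | succ n ih =>
    exact hasInjectiveDimensionLT_of_ringEquiv (MvPolynomial.finSuccEquiv k n).symm.toRingEquiv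
      (n + 1) (hasInjectiveDimensionLT_polynomial (n + 1) ih) M

theorem globalDimension_lt_top {A : Type u} [Ring A] (d : ℕ)
    (h : ∀ M : ModuleCat.{u} A, HasInjectiveDimensionLT M (d + 1)) : globalDimension A < ⊤ := by
  have : globalDimension A ≤ (d : WithBot ℕ∞) := by
    refine iSup_le fun M => (projectiveDimension_le_iff M d).2 ?_
    rw [HasProjectiveDimensionLE, hasProjectiveDimensionLT_iff]
    intro i hi Y e
    have := h Y
    exact e.eq_zero_of_hasInjectiveDimensionLT (d + 1) hi
  refine this.trans_lt ?_
  exact WithBot.coe_lt_coe.2 (ENat.natCast_lt_top d)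

/-! ### Gradings defined by projections -/

/-- Subgroups `ℳ i` that generate `M` form a direct sum decomposition if there are additive maps
`π i` with `π i = 1` on `ℳ i` and `π i = 0` on the other `ℳ j`. -/
theorem isInternal_of_projections {M ι σ : Type*} [AddCommGroup M] [DecidableEq ι] [SetLike σ M]
    [AddSubgroupClass σ M] (ℳ : ι → σ) (π : ι → M →+ M) (h₁ : ∀ i, ∀ x ∈ ℳ i, π i x = x)
    (h₂ : ∀ i j, i ≠ j → ∀ x ∈ ℳ j, π i x = 0)
    (hsup : ∀ P : AddSubgroup M, (∀ i, ∀ x ∈ ℳ i, x ∈ P) → ∀ x, x ∈ P) :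
    DirectSum.IsInternal ℳ := by
  constructor
  · rw [← AddMonoidHom.coe_coe, injective_iff_map_eq_zero]
    intro v hv
    have key : ∀ (i : ι) (w : DirectSum ι fun i => ℳ i),
        π i (DirectSum.coeAddMonoidHom ℳ w) = w i := by
      intro i w
      induction w using DirectSum.induction_on with
      | zero => simp
      | of j x =>
        rw [DirectSum.coeAddMonoidHom_of]
        by_cases hij : i = j
        · subst hij
          rw [h₁ i _ x.2, DirectSum.of_eq_same]
        · rw [h₂ i j hij _ x.2, DirectSum.of_eq_of_ne _ _ _ (by simpa using hij)]
          rfl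
      | add a b ha hb => simp [ha, hb]
    ext i
    rw [← key i v]
    erw [hv]
    simp
  · refine hsup (DirectSum.coeAddMonoidHom ℳ).range fun i x hx => ?_
    exact ⟨DirectSum.of (fun i => ℳ i) i ⟨x, hx⟩, DirectSum.coeAddMonoidHom_of _ _ _⟩

section GradedModules

variable {k : Type u} [Field k] {A : Type u} [Ring A] [Algebra k A] (𝒜 : ℕ → Submodule k A)

theorem selfGrading_natCast (d : ℕ) (x : A) : x ∈ selfGrading 𝒜 (d : ℤ) ↔ x ∈ 𝒜 d := by
  simp [selfGrading]

theorem exists_nat_of_mem_selfGrading {j : ℤ} {x : A} (hx : x ∈ selfGrading 𝒜 j) :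
    x = 0 ∨ ∃ d : ℕ, j = d ∧ x ∈ 𝒜 d := by
  unfold selfGrading at hx
  split_ifs at hx with h
  · exact Or.inr ⟨j.toNat, (Int.toNat_of_nonneg h).symm, hx⟩
  · exact Or.inl hx

variable [GradedAlgebra 𝒜]

theorem mul_mem_selfGrading {i : ℕ} {j : ℤ} {a x : A} (ha : a ∈ 𝒜 i)
    (hx : x ∈ selfGrading 𝒜 j) : a * x ∈ selfGrading 𝒜 (i + j) := by
  obtain rfl | ⟨d, rfl, hd⟩ := exists_nat_of_mem_selfGrading 𝒜 hx
  · rw [mul_zero]; exact zero_mem _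
  · exact (selfGrading_natCast 𝒜 (i + d) _).2 (SetLike.mul_mem_graded ha hd)

theorem mem_selfGrading_mul {i : ℕ} {j : ℤ} {a x : A} (ha : a ∈ 𝒜 i)
    (hx : x ∈ selfGrading 𝒜 j) : x * a ∈ selfGrading 𝒜 (j + i) := by
  obtain rfl | ⟨d, rfl, hd⟩ := exists_nat_of_mem_selfGrading 𝒜 hx
  · rw [zero_mul]; exact zero_mem _
  · exact (selfGrading_natCast 𝒜 (d + i) _).2 (SetLike.mul_mem_graded hd ha)

/-- The grading of a module induced by a homomorphism `q` from the regular module. -/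
def inducedGrading {M : Type u} [AddCommGroup M] [Module A M] (q : A →ₗ[A] M) (j : ℤ) :
    AddSubgroup M :=
  (selfGrading 𝒜 j).map q.toAddMonoidHom

/-- A cyclic module `A / ker q` inherits the grading of `A` if the left ideal `ker q` is
homogeneous. -/
theorem isGradedModule_inducedGrading {M : Type u} [AddCommGroup M] [Module A M] (q : A →ₗ[A] M)
    (hq : Function.Surjective q)
    (hker : ∀ x, q x = 0 → ∀ d : ℕ, q (GradedRing.proj 𝒜 d x) = 0) :
    IsGradedModule 𝒜 (inducedGrading 𝒜 q) := by
  constructor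
  · let π₀ : ℤ → A →+ A := fun j => if 0 ≤ j then GradedRing.proj 𝒜 j.toNat else 0
    have hπ₀ : ∀ j x, q x = 0 → q (π₀ j x) = 0 := fun j x hx => by
      dsimp only [π₀]
      split_ifs
      · exact hker x hx _
      · simp
    let s : M → A := Function.surjInv hq
    have hs : ∀ m, q (s m) = m := Function.surjInv_eq hq
    have hwd : ∀ j x y, q x = q y → q (π₀ j x) = q (π₀ j y) := fun j x y h => by
      rw [← sub_eq_zero, ← map_sub, ← map_sub]
      exact hπ₀ _ _ (by rw [map_sub, h, sub_self])
    let π : ℤ → M →+ M := fun j =>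
      { toFun := fun m => q (π₀ j (s m))
        map_zero' := hπ₀ _ _ (hs 0)
        map_add' := fun a b => by
          rw [← map_add, ← map_add]
          exact hwd _ _ _ (by rw [map_add, hs, hs, hs]) }
    refine isInternal_of_projections _ π ?_ ?_ ?_
    · rintro j _ ⟨x, hx, rfl⟩
      refine (hwd j _ x (hs _)).trans (congrArg q ?_)
      obtain rfl | ⟨d, rfl, hd⟩ := exists_nat_of_mem_selfGrading 𝒜 hx
      · simp
      · simp [π₀, GradedRing.proj_apply, DirectSum.decompose_of_mem_same 𝒜 hd]
    · rintro i j hij _ ⟨x, hx, rfl⟩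
      refine (hwd i _ x (hs _)).trans ((congrArg q ?_).trans (map_zero q))
      obtain rfl | ⟨d, rfl, hd⟩ := exists_nat_of_mem_selfGrading 𝒜 hx
      · simp
      · dsimp only [π₀]
        split_ifs with h
        · rw [GradedRing.proj_apply, DirectSum.decompose_of_mem_ne 𝒜 hd]
          omega
        · rfl
    · classical
      intro P hP m
      obtain ⟨x, rfl⟩ := hq m
      rw [← DirectSum.sum_support_decompose 𝒜 x, map_sum]
      refine sum_mem fun d _ => ?_
      refine hP (d : ℤ) _ ⟨_, ?_, rfl⟩
      exact (selfGrading_natCast 𝒜 d _).2 (SetLike.coe_mem _)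
  · rintro i j a _ ha ⟨x, hx, rfl⟩
    exact ⟨a * x, mul_mem_selfGrading 𝒜 ha hx, q.map_smul a x⟩

theorem isGradedModule_selfGrading :
    IsGradedModule 𝒜 (M := ModuleCat.of A A) (selfGrading 𝒜) := by
  have := isGradedModule_inducedGrading 𝒜 (LinearMap.id : A →ₗ[A] A) Function.surjective_id
    (fun x hx d => by
      have : x = 0 := hx
      simp [this])
  convert this using 1
  funext j
  exact (AddSubgroup.map_id _).symm

end GradedModules

/-! ### `Ext` groups along a normalizing regular sequence -/

section Koszul

variable {k : Type u} [Field k] {A : Type u} [Ring A] [Algebra k A]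

/-- `z₀, …, z_{N-1}` is a regular sequence in `A` whose successive members normalize each other up
to sign, and `I i` is the two-sided ideal generated by `z₀, …, z_{i-1}`.  The elements `z i` and
the left ideals `I i` matter only for `i < N` and `i ≤ N`. -/
structure IsSkewRegularSequence (z : ℕ → A) (I : ℕ → Submodule A A) (N : ℕ) : Prop where
  bot : I 0 = ⊥
  mul_mem : ∀ i ≤ N, ∀ x ∈ I i, ∀ a, x * a ∈ I i
  right_regular : ∀ i < N, ∀ a, a * z i ∈ I i → a ∈ I i
  left_regular : ∀ i < N, ∀ a, z i * a ∈ I i → a ∈ I i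
  mem_succ_iff : ∀ i < N, ∀ x, x ∈ I (i + 1) ↔ ∃ a, x - a * z i ∈ I i
  mem_succ_iff' : ∀ i < N, ∀ x, x ∈ I (i + 1) ↔ ∃ a, x - z i * a ∈ I i
  comm : ∀ i l, i < l → l < N → z i * z l - z l * z i ∈ I i ∨ z i * z l + z l * z i ∈ I i

/-- Right multiplication by `a`, as a homomorphism of left modules `A / I → A / J`. -/
def rightMul (I J : Submodule A A) (a : A) (h : ∀ x ∈ I, x * a ∈ J) : (A ⧸ I) →ₗ[A] (A ⧸ J) :=
  I.mapQ J (LinearMap.toSpanSingleton A A a) h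

namespace IsSkewRegularSequence

variable {z : ℕ → A} {I : ℕ → Submodule A A} {N : ℕ} (hz : IsSkewRegularSequence z I N)
include hz

theorem le_succ {i : ℕ} (hi : i < N) : I i ≤ I (i + 1) := fun x hx =>
  (hz.mem_succ_iff i hi x).2 ⟨0, by simpa using hx⟩

theorem mul_mem_succ {i : ℕ} (hi : i < N) (x : A) : x * z i ∈ I (i + 1) :=
  (hz.mem_succ_iff i hi _).2 ⟨x, by simp⟩

/-- Right multiplication by `a` on `A / I i`. -/
abbrev rmul {i : ℕ} (hi : i ≤ N) (a : A) : (A ⧸ I i) →ₗ[A] (A ⧸ I i) :=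
  rightMul (I i) (I i) a fun x hx => hz.mul_mem i hi x hx a

/-- The complex `0 ⟶ A / I i ⟶ A / I i ⟶ A / I (i + 1) ⟶ 0` whose first map is right
multiplication by `z i`. -/
abbrev shortComplex {i : ℕ} (hi : i < N) : ShortComplex (ModuleCat.{u} A) :=
  ModuleCat.shortComplexOfCompEqZero (hz.rmul hi.le (z i)) (Submodule.factor (hz.le_succ hi)) (by
    refine Submodule.linearMap_qext _ (LinearMap.ext fun x => ?_)
    exact (Submodule.Quotient.mk_eq_zero _).2 (hz.mul_mem_succ hi x))

theorem shortExact {i : ℕ} (hi : i < N) : (hz.shortComplex hi).ShortExact := by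
  refine ModuleCat.shortComplex_shortExact _ ?_ ?_ ?_
  · intro (m : A ⧸ I i)
    obtain ⟨x, rfl⟩ := (I i).mkQ_surjective m
    constructor
    · intro hx
      obtain ⟨a, ha⟩ := (hz.mem_succ_iff i hi x).1 ((Submodule.Quotient.mk_eq_zero _).1 hx)
      refine ⟨(I i).mkQ a, ?_⟩
      exact ((Submodule.Quotient.eq _).2 ha).symm
    · rintro ⟨m, hm⟩
      obtain ⟨a, rfl⟩ := (I i).mkQ_surjective m
      refine (Submodule.Quotient.mk_eq_zero (I (i + 1))).2 ?_
      refine (hz.mem_succ_iff i hi x).2 ⟨a, ?_⟩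
      exact (Submodule.Quotient.eq _).1 hm.symm
  · rw [injective_iff_map_eq_zero]
    intro (m : A ⧸ I i) hm
    obtain ⟨x, rfl⟩ := (I i).mkQ_surjective m
    refine (Submodule.Quotient.mk_eq_zero (I i)).2 ?_
    exact hz.right_regular i hi x ((Submodule.Quotient.mk_eq_zero (I i)).1 hm)
  · intro m
    obtain ⟨x, rfl⟩ := (I (i + 1)).mkQ_surjective m
    exact ⟨(I i).mkQ x, rfl⟩

end IsSkewRegularSequence

open Abelian Abelian.Ext

namespace IsSkewRegularSequence

variable {z : ℕ → A} {I : ℕ → Submodule A A} {N : ℕ} (hz : IsSkewRegularSequence z I N)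

/-- The homomorphism `A ⧸ I 0 = A → A` that sends `1` to `a`. -/
def homOfBot (h : I 0 = ⊥) (a : A) : (A ⧸ I 0) →ₗ[A] A :=
  (I 0).liftQ (LinearMap.toSpanSingleton A A a) (h ▸ bot_le)

include hz in
/-- The ideals generated by homogeneous elements `z j` are homogeneous. -/
theorem proj_mem (𝒜 : ℕ → Submodule k A) [GradedAlgebra 𝒜] (w : ℕ → ℕ)
    (hw : ∀ j < N, z j ∈ 𝒜 (w j)) (i : ℕ) (hi : i ≤ N) (x : A) (hx : x ∈ I i) (d : ℕ) :
    GradedRing.proj 𝒜 d x ∈ I i := by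
  induction i generalizing x d with
  | zero =>
    rw [hz.bot, Submodule.mem_bot] at hx ⊢
    rw [hx, map_zero]
  | succ i ih =>
    obtain ⟨a, ha⟩ := (hz.mem_succ_iff i hi x).1 hx
    have hx' : x = a * z i + (x - a * z i) := by abel
    rw [hx', map_add]
    refine add_mem ?_ (hz.le_succ hi (ih (Nat.le_of_succ_le hi) _ ha d))
    rw [GradedRing.proj_apply]
    by_cases h : w i ≤ d
    · rw [DirectSum.coe_decompose_mul_of_right_mem_of_le 𝒜 (hw i hi) h]
      exact hz.mul_mem_succ hi _
    · rw [DirectSum.coe_decompose_mul_of_right_mem_of_not_le 𝒜 (hw i hi) h]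
      exact zero_mem _

include hz in
theorem isGradedModule (𝒜 : ℕ → Submodule k A) [GradedAlgebra 𝒜] (w : ℕ → ℕ)
    (hw : ∀ j < N, z j ∈ 𝒜 (w j)) (i : ℕ) (hi : i ≤ N) :
    IsGradedModule 𝒜 (M := ModuleCat.of A (A ⧸ I i)) (inducedGrading 𝒜 (I i).mkQ) :=
  isGradedModule_inducedGrading 𝒜 (I i).mkQ (I i).mkQ_surjective fun x hx d =>
    (Submodule.Quotient.mk_eq_zero _).2
      (hz.proj_mem 𝒜 w hw i hi x ((Submodule.Quotient.mk_eq_zero _).1 hx) d)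

include hz in
/-- Naturality of the class in `Ext^1` of the exact sequence attached to `z i`: if
`z i * a ≡ b * z i` modulo `I i`, then right multiplication by `a` on `A / I (i + 1)` corresponds
to right multiplication by `b` on `A / I i`. -/
theorem comp_extClass {i : ℕ} (hi : i < N) (a b : A) (hab : z i * a - b * z i ∈ I i) :
    (mk₀ (ModuleCat.ofHom (hz.rmul (Nat.succ_le_of_lt hi) a))).comp (hz.shortExact hi).extClass
        (zero_add 1) =
      (hz.shortExact hi).extClass.comp (mk₀ (ModuleCat.ofHom (hz.rmul hi.le b))) (add_zero 1) := by
  let φ : hz.shortComplex hi ⟶ hz.shortComplex hi :=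
    { τ₁ := ModuleCat.ofHom (hz.rmul hi.le b)
      τ₂ := ModuleCat.ofHom (hz.rmul hi.le a)
      τ₃ := ModuleCat.ofHom (hz.rmul (Nat.succ_le_of_lt hi) a)
      comm₁₂ := by
        refine ModuleCat.hom_ext (Submodule.linearMap_qext _ (LinearMap.ext fun x => ?_))
        change (I i).mkQ (x * b * z i) = (I i).mkQ (x * z i * a)
        refine ((Submodule.Quotient.eq _).2 ?_).symm
        have := (I i).smul_mem x hab
        rwa [smul_eq_mul, mul_sub, ← mul_assoc, ← mul_assoc] at this
      comm₂₃ := by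
        refine ModuleCat.hom_ext (Submodule.linearMap_qext _ (LinearMap.ext fun x => ?_))
        rfl }
  exact (ShortComplex.ShortExact.extClass_naturality (hz.shortExact hi) (hz.shortExact hi) φ).symm

include hz in
/-- `Ext^i(A / I i, A)` is `A / I i` up to a twist, and the other groups `Ext^j(A / I i, A)`
vanish.  The isomorphism is the iterated connecting homomorphism `θ`; precomposition with right
multiplication by a later `z l` corresponds to left multiplication by `± z l`. -/
theorem exists_ext_param (i : ℕ) (hi : i ≤ N) :
    (∀ j, j ≠ i → Subsingleton (Ext (ModuleCat.of A (A ⧸ I i)) (ModuleCat.of A A) j)) ∧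
    ∃ θ : A →ₗ[k] Ext (ModuleCat.of A (A ⧸ I i)) (ModuleCat.of A A) i,
      Function.Surjective θ ∧ (∀ a, θ a = 0 ↔ a ∈ I i) ∧
      (∀ l (_ : i ≤ l) (_ : l < N),
        (∀ a, (mk₀ (ModuleCat.ofHom (hz.rmul hi (z l)))).comp (θ a) (zero_add i) = θ (z l * a)) ∨
        (∀ a, (mk₀ (ModuleCat.ofHom (hz.rmul hi (z l)))).comp (θ a) (zero_add i) =
          θ (-(z l * a)))) ∧
      ∀ (𝒜 : ℕ → Submodule k A) [GradedAlgebra 𝒜] (w : ℕ → ℕ), (∀ j < N, z j ∈ 𝒜 (w j)) →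
        IsGradedModule 𝒜 (inducedGrading 𝒜 (I i).mkQ) ∧
        ∀ c : k, IsHomogeneousExt 𝒜 (M := ModuleCat.of A (A ⧸ I i)) (N := ModuleCat.of A A)
          (inducedGrading 𝒜 (I i).mkQ) (selfGrading 𝒜)
          (-(∑ j ∈ Finset.range i, (w j : ℤ))) (θ (algebraMap k A c)) := by
  induction i with
  | zero =>
    have hproj : Projective (ModuleCat.of A (A ⧸ I 0)) := by
      have : Module.Projective A (A ⧸ I 0) :=
        Module.Projective.of_equiv (Submodule.quotEquivOfEqBot (I 0) hz.bot).symm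
      exact (IsProjective.iff_projective _).1 this
    refine ⟨fun j hj => ?_, ?_⟩
    · exact HasProjectiveDimensionLT.subsingleton (ModuleCat.of A (A ⧸ I 0)) 1 j (by omega) _
    let θ : A →ₗ[k] Ext (ModuleCat.of A (A ⧸ I 0)) (ModuleCat.of A A) 0 :=
      { toFun := fun a => mk₀ (ModuleCat.ofHom (homOfBot hz.bot a))
        map_add' := fun a b => by
          rw [← mk₀_add]
          congr 1
          refine ModuleCat.hom_ext (Submodule.linearMap_qext _ (LinearMap.ext fun x => ?_))
          exact mul_add x a b
        map_smul' := fun c a => by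
          rw [RingHom.id_apply, ← mk₀_smul]
          congr 1
          refine ModuleCat.hom_ext (Submodule.linearMap_qext _ (LinearMap.ext fun x => ?_))
          change x * (c • a) = algebraMap k A c * (x * a)
          rw [mul_smul_comm, Algebra.smul_def] }
    refine ⟨θ, ?_, ?_, ?_, ?_⟩
    · intro e
      obtain ⟨f, rfl⟩ := (mk₀_bijective _ _).2 e
      refine ⟨f.hom ((I 0).mkQ 1), ?_⟩
      change mk₀ _ = mk₀ _
      congr 1
      refine ModuleCat.hom_ext (Submodule.linearMap_qext _ (LinearMap.ext fun x => ?_))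
      change x * f.hom ((I 0).mkQ 1) = f.hom ((I 0).mkQ x)
      rw [← smul_eq_mul, ← map_smul, ← map_smul, smul_eq_mul, mul_one]
    · intro a
      have hbot : a ∈ I 0 ↔ a = 0 := by rw [hz.bot, Submodule.mem_bot]
      rw [hbot]
      constructor
      · intro h
        have h' : ModuleCat.ofHom (homOfBot hz.bot a) = 0 :=
          (mk₀_bijective _ _).1 (h.trans (mk₀_zero _ _).symm)
        have := congrArg (fun f => f.hom ((I 0).mkQ 1)) h'
        change 1 * a = 0 at this
        rwa [one_mul] at this
      · rintro rfl
        exact map_zero θ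
    · intro l _ _
      left
      intro a
      change (mk₀ _).comp (mk₀ _) _ = mk₀ _
      rw [mk₀_comp_mk₀]
      congr 1
      refine ModuleCat.hom_ext (Submodule.linearMap_qext _ (LinearMap.ext fun x => ?_))
      exact mul_assoc x (z l) a
    · intro 𝒜 _ w hw
      refine ⟨hz.isGradedModule 𝒜 w hw 0 hi, fun c => ?_⟩
      refine IsHomogeneousExt.hom _ _ (hz.isGradedModule 𝒜 w hw 0 hi)
        (isGradedModule_selfGrading 𝒜) _ _ ?_
      rintro j _ ⟨x, hx, rfl⟩
      change x * algebraMap k A c ∈ _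
      have := mem_selfGrading_mul 𝒜 (SetLike.algebraMap_mem_graded 𝒜 c) hx
      simpa using this
  | succ i ih =>
    have hi' : i < N := hi
    obtain ⟨hvan, θ, hsur, hker, hcomm, hhom⟩ := ih hi'.le
    have hS := hz.shortExact hi'
    -- Precomposition with `z i` on `Ext^i(A / I i, A)` is, up to sign, left multiplication by `z i`
    -- on `A / I i`, which is injective.
    have hinj : ∀ e : Ext (ModuleCat.of A (A ⧸ I i)) (ModuleCat.of A A) i,
        (mk₀ (hz.shortComplex hi').f).comp e (zero_add i) = 0 → e = 0 := by
      intro e he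
      obtain ⟨a, rfl⟩ := hsur e
      rw [hker]
      refine hz.left_regular i hi' a ?_
      rcases hcomm i le_rfl hi' with h | h
      · exact (hker _).1 ((h a).symm.trans he)
      · exact (neg_mem_iff).1 ((hker _).1 ((h a).symm.trans he))
    refine ⟨?_, ?_⟩
    · intro j hj
      suffices h : ∀ e : Ext (ModuleCat.of A (A ⧸ I (i + 1))) (ModuleCat.of A A) j, e = 0 from
        ⟨fun e e' => (h e).trans (h e').symm⟩
      intro e
      have h0 : (mk₀ (hz.shortComplex hi').g).comp e (zero_add j) = 0 := by
        by_cases hji : j = i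
        · subst hji
          refine hinj _ ?_
          rw [mk₀_comp_mk₀_assoc, ShortComplex.zero, mk₀_zero, zero_comp]
        · have := hvan j hji
          exact Subsingleton.elim (α := Ext (ModuleCat.of A (A ⧸ I i)) (ModuleCat.of A A) j) _ _
      rcases j with _ | j
      · have := hS.epi_g
        exact precomp_mk₀_injective_of_epi _ (hz.shortComplex hi').g
          (h0.trans (comp_zero (mk₀ (hz.shortComplex hi').g) _ 0 0 (zero_add 0)).symm)
      · obtain ⟨e₁, rfl⟩ := contravariant_sequence_exact₃ hS _ e h0 (Nat.add_comm 1 j)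
        have := hvan j (by omega)
        have he₁ : e₁ = 0 :=
          Subsingleton.elim (α := Ext (ModuleCat.of A (A ⧸ I i)) (ModuleCat.of A A) j) _ _
        rw [he₁, comp_zero]
    · let δ : Ext (ModuleCat.of A (A ⧸ I i)) (ModuleCat.of A A) i →ₗ[k]
          Ext (ModuleCat.of A (A ⧸ I (i + 1))) (ModuleCat.of A A) (i + 1) :=
        hS.extClass.precompOfLinear k (ModuleCat.of A A) (Nat.add_comm 1 i)
      have hδ : ∀ e, δ e = hS.extClass.comp e (Nat.add_comm 1 i) := fun e => rfl
      refine ⟨δ.comp θ, ?_, ?_, ?_, ?_⟩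
      · intro e
        have h0 : (mk₀ (hz.shortComplex hi').g).comp e (zero_add (i + 1)) = 0 := by
          have := hvan (i + 1) (by omega)
          exact Subsingleton.elim
            (α := Ext (ModuleCat.of A (A ⧸ I i)) (ModuleCat.of A A) (i + 1)) _ _
        obtain ⟨e₁, rfl⟩ := contravariant_sequence_exact₃ hS _ e h0 (Nat.add_comm 1 i)
        obtain ⟨a, rfl⟩ := hsur e₁
        exact ⟨a, rfl⟩
      · intro a
        rw [LinearMap.comp_apply, hδ, hz.mem_succ_iff' i hi']
        constructor
        · intro h
          obtain ⟨e, he⟩ := contravariant_sequence_exact₁ hS _ (θ a) (Nat.add_comm 1 i) h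
          obtain ⟨b, rfl⟩ := hsur e
          rcases hcomm i le_rfl hi' with h' | h'
          · refine ⟨b, (hker _).1 ?_⟩
            rw [map_sub, ← h' b, sub_eq_zero]
            exact he.symm
          · refine ⟨-b, (hker _).1 ?_⟩
            rw [map_sub, mul_neg, ← h' b, sub_eq_zero]
            exact he.symm
        · rintro ⟨b, hb⟩
          have h1 : θ a = θ (z i * b) := by
            rw [← sub_eq_zero, ← map_sub]
            exact (hker _).2 hb
          rw [h1]
          rcases hcomm i le_rfl hi' with h' | h'
          · rw [← h']
            exact hS.extClass_comp_assoc _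
          · rw [← neg_neg (z i * b), ← mul_neg, ← h']
            exact hS.extClass_comp_assoc _
      · intro l hl hlN
        have key : ∀ b : A, z i * z l - b * z i ∈ I i → ∀ a,
            (mk₀ (ModuleCat.ofHom (hz.rmul hi (z l)))).comp (δ (θ a)) (zero_add (i + 1)) =
              δ ((mk₀ (ModuleCat.ofHom (hz.rmul hi'.le b))).comp (θ a) (zero_add i)) := by
          intro b hb a
          rw [hδ, hδ, ← comp_assoc (a₁₂ := 1) _ _ _ (by omega) (by omega) (by omega),
            hz.comp_extClass hi' _ _ hb,
            comp_assoc (a₁₂ := 1) (a₂₃ := i) _ _ _ (by omega) (by omega) (by omega)]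
        have hneg : ∀ e, (mk₀ (ModuleCat.ofHom (hz.rmul hi'.le (-z l)))).comp e (zero_add i) =
            -((mk₀ (ModuleCat.ofHom (hz.rmul hi'.le (z l)))).comp e (zero_add i) :
              Ext (ModuleCat.of A (A ⧸ I i)) (ModuleCat.of A A) i) := by
          intro e
          rw [← neg_comp, ← mk₀_neg]
          congr 2
          refine ModuleCat.hom_ext (Submodule.linearMap_qext _ (LinearMap.ext fun x => ?_))
          change (I i).mkQ (x * -z l) = -(I i).mkQ (x * z l)
          rw [mul_neg, map_neg]
        rcases hz.comm i l hl hlN with h | h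
        · have hk := key (z l) h
          rcases hcomm l (Nat.le_of_succ_le hl) hlN with h' | h'
          · left; intro a; rw [LinearMap.comp_apply, hk, h']; rfl
          · right; intro a; rw [LinearMap.comp_apply, hk, h']; rfl
        · have hk := key (-z l) (by rwa [neg_mul, sub_neg_eq_add])
          rcases hcomm l (Nat.le_of_succ_le hl) hlN with h' | h'
          · right; intro a; rw [LinearMap.comp_apply, hk, hneg, h', ← map_neg]; rfl
          · left; intro a; rw [LinearMap.comp_apply, hk, hneg, h', ← map_neg, neg_neg]; rfl
      · intro 𝒜 _ w hw
        refine ⟨hz.isGradedModule 𝒜 w hw (i + 1) hi, fun c => ?_⟩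
        obtain ⟨hgr, hc⟩ := hhom 𝒜 w hw
        have hext : IsHomogeneousExt 𝒜 (M := ModuleCat.of A (A ⧸ I (i + 1)))
            (N := ModuleCat.of A (A ⧸ I i)) (inducedGrading 𝒜 (I (i + 1)).mkQ)
            (inducedGrading 𝒜 (I i).mkQ) (-((w i : ℤ) + 0)) hS.extClass := by
          refine IsHomogeneousExt.extClass (hz.shortComplex hi') hS _
            (inducedGrading 𝒜 (I i).mkQ) _ hgr hgr
            (hz.isGradedModule 𝒜 w hw (i + 1) hi) _ _ ?_ ?_
          · rintro j _ ⟨x, hx, rfl⟩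
            exact ⟨x * z i, mem_selfGrading_mul 𝒜 (hw i hi') hx, rfl⟩
          · rintro j _ ⟨x, hx, rfl⟩
            exact ⟨x, by simpa using hx, rfl⟩
        have := IsHomogeneousExt.comp (Nat.add_comm 1 i) hext (hc c)
        rw [Finset.sum_range_succ, neg_add_rev]
        simpa only [add_zero, LinearMap.comp_apply, hδ] using this

include hz in
/-- A connected graded algebra whose augmentation ideal is generated by a skew regular sequence of
`N` homogeneous elements satisfies the left-hand Artin-Schelter conditions in dimension `N`, as
soon as `N` bounds the injective dimension of all modules; the AS index is the sum of the degrees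
of the sequence. -/
theorem isLeftASRegular (𝒜 : ℕ → Submodule k A) (hA : IsConnectedGraded k 𝒜) (w : ℕ → ℕ)
    (hw : ∀ j < N, z j ∈ 𝒜 (w j)) (hI : I N = augmentationIdeal 𝒜)
    (hd : ∀ M : ModuleCat.{u} A, HasInjectiveDimensionLT M (N + 1)) :
    IsLeftASRegular k 𝒜 N (∑ j ∈ Finset.range N, (w j : ℤ)) := by
  obtain ⟨_⟩ := hA.graded
  have hA0 := hA.zero_eq
  have hnt := hA.nontrivial
  obtain ⟨hvan, θ, hsur, hker, -, hhom⟩ := hz.exists_ext_param (k := k) N le_rfl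
  obtain ⟨-, hhom⟩ := hhom 𝒜 w hw
  -- The projection to degree `0` is a ring homomorphism that kills the augmentation ideal.
  have hproj : ∀ a ∈ augmentationIdeal 𝒜, GradedRing.proj 𝒜 0 a = 0 := by
    intro a ha
    refine Submodule.span_induction ?_ (map_zero _) ?_ ?_ ha
    · rintro x ⟨i, hi, hx⟩
      rw [GradedRing.proj_apply, DirectSum.decompose_of_mem_ne 𝒜 hx hi.ne']
    · intro x y _ _ hx hy
      rw [map_add, hx, hy, add_zero]
    · intro b x _ hx
      have h0 := GradedRing.projZeroRingHom_apply 𝒜 (b * x)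
      have h1 := GradedRing.projZeroRingHom_apply 𝒜 x
      rw [GradedRing.proj_apply] at hx ⊢
      rw [smul_eq_mul, ← h0, map_mul, h1, hx, mul_zero]
  -- By connectedness, `A` is the sum of the scalars and the augmentation ideal.
  have hrep : ∀ a : A, ∃ c : k, a - algebraMap k A c ∈ augmentationIdeal 𝒜 := by
    classical
    intro a
    have h0 : (DirectSum.decompose 𝒜 a 0 : A) ∈ (1 : Submodule k A) := by
      rw [← hA0]
      exact SetLike.coe_mem _
    obtain ⟨c, hc⟩ := Submodule.mem_one.1 h0
    refine ⟨c, ?_⟩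
    rw [hc]
    nth_rewrite 1 [← DirectSum.sum_support_decompose 𝒜 a]
    have hpos : ∀ d : ℕ, d ≠ 0 → (DirectSum.decompose 𝒜 a d : A) ∈ augmentationIdeal 𝒜 :=
      fun d hd => Submodule.subset_span ⟨d, Nat.pos_of_ne_zero hd, SetLike.coe_mem _⟩
    by_cases h : 0 ∈ (DirectSum.decompose 𝒜 a).support
    · rw [← Finset.add_sum_erase _ _ h, add_sub_cancel_left]
      exact sum_mem fun d hd => hpos d (Finset.ne_of_mem_erase hd)
    · have hz0 : (DirectSum.decompose 𝒜 a 0 : A) = 0 := by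
        simpa using h
      rw [hz0, sub_zero]
      exact sum_mem fun d hd => hpos d (by rintro rfl; exact h hd)
  have hθ : ∀ e, ∃ c : k, e = θ (algebraMap k A c) := by
    intro e
    obtain ⟨a, rfl⟩ := hsur e
    obtain ⟨c, hc⟩ := hrep a
    refine ⟨c, ?_⟩
    rw [← sub_eq_zero, ← map_sub, hker, hI]
    exact hc
  have hθ1 : θ 1 ≠ 0 := by
    rw [Ne, hker, hI]
    intro h
    have h1 := hproj 1 h
    rw [GradedRing.proj_apply, DirectSum.decompose_of_mem_same 𝒜 SetLike.GradedOne.one_mem] at h1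
    exact one_ne_zero h1
  -- The grading of `A / I N` as a quotient of `A` is the grading of the trivial module.
  have hgr : ∀ j, inducedGrading 𝒜 (I N).mkQ j = if j = 0 then ⊤ else ⊥ := by
    intro j
    by_cases hj : j = 0
    · subst hj
      rw [if_pos rfl, eq_top_iff]
      intro m _
      obtain ⟨a, rfl⟩ := (I N).mkQ_surjective m
      obtain ⟨c, hc⟩ := hrep a
      refine ⟨algebraMap k A c, ?_, ?_⟩
      · exact (selfGrading_natCast 𝒜 0 _).2 (SetLike.algebraMap_mem_graded 𝒜 c)
      · rw [← hI] at hc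
        exact ((Submodule.Quotient.eq _).2 hc).symm
    · rw [if_neg hj, eq_bot_iff]
      rintro _ ⟨x, hx, rfl⟩
      refine (Submodule.Quotient.mk_eq_zero _).2 ?_
      obtain rfl | ⟨d, rfl, hd⟩ := exists_nat_of_mem_selfGrading 𝒜 hx
      · exact zero_mem _
      · rw [hI]
        exact Submodule.subset_span ⟨d, by omega, hd⟩
  have hgr' : inducedGrading 𝒜 (I N).mkQ = fun j => if j = 0 then ⊤ else ⊥ := funext hgr
  rw [hgr'] at hhom
  have hinj : injectiveDimension (ModuleCat.of A A) = N := by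
    refine le_antisymm ((injectiveDimension_le_iff _ N).2 (hd _)) ?_
    rw [injectiveDimension_ge_iff]
    intro h
    exact hθ1 ((θ 1).eq_zero_of_hasInjectiveDimensionLT N le_rfl)
  have hdim : Module.finrank k (Ext (ModuleCat.of A (A ⧸ I N)) (ModuleCat.of A A) N) = 1 := by
    refine finrank_eq_one (θ 1) hθ1 fun e => ?_
    obtain ⟨c, rfl⟩ := hθ e
    exact ⟨c, by rw [← map_smul, Algebra.algebraMap_eq_smul_one]⟩
  have hdeg : ∀ e : Ext (ModuleCat.of A (A ⧸ I N)) (ModuleCat.of A A) N,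
      IsHomogeneousExt 𝒜 (M := ModuleCat.of A (A ⧸ I N)) (N := ModuleCat.of A A)
        (fun j => if j = 0 then ⊤ else ⊥) (selfGrading 𝒜)
        (-(∑ j ∈ Finset.range N, (w j : ℤ))) e := by
    intro e
    obtain ⟨c, rfl⟩ := hθ e
    exact hhom c
  rw [hI] at hvan hdim hdeg
  exact
    { injectiveDimension_eq := hinj
      ext_eq_zero := hvan
      ext_dim := hdim
      ext_degree := hdeg
      globalDimension_lt := globalDimension_lt_top N hd }

end IsSkewRegularSequence

end Koszul

/-! ### Ordered monomials -/

section OrderedMonomials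

variable {n : ℕ} {A : Type*} [Monoid A]

/-- The ordered monomial `y₀^α₀ ⋯ y_{n-1}^α_{n-1}`. -/
def orderedMonomial (y : Fin n → A) (α : Fin n → ℕ) : A :=
  ((List.finRange n).map fun i => y i ^ α i).prod

theorem orderedMonomial_zero (y : Fin n → A) : orderedMonomial y 0 = 1 := by
  simp [orderedMonomial]

theorem orderedMonomial_add_single (y : Fin n → A) (α : Fin n → ℕ) (j : Fin n)
    (hα : ∀ l < j, α l = 0) :
    orderedMonomial y (α + Pi.single j 1) = y j * orderedMonomial y α := by
  have key : ∀ L : List (Fin n), L.Pairwise (· < ·) →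
      (j ∉ L → (L.map fun i => y i ^ (α + Pi.single j 1 : Fin n → ℕ) i).prod =
        (L.map fun i => y i ^ α i).prod) ∧
      (j ∈ L → (L.map fun i => y i ^ (α + Pi.single j 1 : Fin n → ℕ) i).prod =
        y j * (L.map fun i => y i ^ α i).prod) := by
    intro L hL
    induction L with
    | nil => simp
    | cons a L ih =>
      rw [List.pairwise_cons] at hL
      obtain ⟨ih₁, ih₂⟩ := ih hL.2
      constructor
      · intro h
        rw [List.mem_cons, not_or] at h
        simp only [List.map_cons, List.prod_cons]
        rw [ih₁ h.2, Pi.add_apply, Pi.single_eq_of_ne (Ne.symm h.1), add_zero]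
      · intro h
        simp only [List.map_cons, List.prod_cons]
        by_cases haj : a = j
        · subst haj
          rw [ih₁ fun h' => lt_irrefl _ (hL.1 _ h'), Pi.add_apply, Pi.single_eq_same, pow_succ',
            mul_assoc]
        · have hj : j ∈ L := (List.mem_cons.1 h).resolve_left (Ne.symm haj)
          rw [ih₂ hj, Pi.add_apply, Pi.single_eq_of_ne haj, add_zero, hα a (hL.1 _ hj), pow_zero,
            one_mul, one_mul]
  exact (key _ (List.pairwise_lt_finRange n)).2 (List.mem_finRange j)

/-- Exponent vectors are built by adding units at, or below, the first nonzero position. -/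
theorem exponent_induction {P : (Fin n → ℕ) → Prop} (zero : P 0)
    (step : ∀ (β : Fin n → ℕ) (j : Fin n), (∀ l < j, β l = 0) → P β → P (β + Pi.single j 1))
    (α : Fin n → ℕ) : P α := by
  induction h : ∑ i, α i using Nat.strong_induction_on generalizing α with
  | _ m ih =>
    by_cases hα : α = 0
    · rwa [hα]
    · obtain ⟨j, hj, hmin⟩ : ∃ j, α j ≠ 0 ∧ ∀ l < j, α l = 0 := by
        have hne : (Finset.univ.filter fun i => α i ≠ 0).Nonempty := by
          by_contra hne
          rw [Finset.not_nonempty_iff_eq_empty, Finset.filter_eq_empty_iff] at hne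
          exact hα (funext fun i => by simpa using hne (Finset.mem_univ i))
        refine ⟨_, (Finset.mem_filter.1 (Finset.min'_mem _ hne)).2, fun l hl => ?_⟩
        by_contra hl0
        exact absurd (Finset.min'_le _ l (Finset.mem_filter.2 ⟨Finset.mem_univ _, hl0⟩))
          (not_le.2 hl)
      have hα' : α = (α - Pi.single j 1) + Pi.single j 1 := by
        funext i
        by_cases hij : i = j
        · subst hij; simp; omega
        · simp [Pi.single_eq_of_ne hij]
      have hβ : ∀ l < j, (α - Pi.single j 1 : Fin n → ℕ) l = 0 := fun l hl => by
        simp [hmin l hl]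
      rw [hα']
      refine step _ j hβ (ih _ ?_ _ rfl)
      rw [← h]
      nth_rewrite 2 [hα']
      simp only [Pi.add_apply, Finset.sum_add_distrib]
      simp

end OrderedMonomials

/-! ### The Fock representation of the relations `y_j y_i = - y_i y_j + c_ij` -/

namespace Fock

variable {n : ℕ} {K : Type*} [CommRing K]

/-- The sign `(-1)^(α₀ + ⋯ + α_{i-1})`. -/
def sign (K : Type*) [CommRing K] (i : Fin n) (α : Fin n → ℕ) : K :=
  (-1) ^ ∑ l ∈ Finset.Iio i, α l

theorem sign_add_of_lt {i j : Fin n} (h : j < i) (α : Fin n → ℕ) :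
    sign K i (α + Pi.single j 1) = -sign K i α := by
  simp only [sign, Pi.add_apply, Finset.sum_add_distrib]
  rw [Finset.sum_pi_single', if_pos (Finset.mem_Iio.2 h), pow_succ]
  ring

theorem sign_add_of_le {i j : Fin n} (h : i ≤ j) (α : Fin n → ℕ) :
    sign K i (α + Pi.single j 1) = sign K i α := by
  simp only [sign, Pi.add_apply, Finset.sum_add_distrib]
  rw [Finset.sum_pi_single', if_neg (by simpa using h), add_zero]

theorem sign_mul_self (i : Fin n) (α : Fin n → ℕ) : sign K i α * sign K i α = 1 := by
  rw [sign, ← mul_pow]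
  simp

theorem sign_eq_one {i : Fin n} {α : Fin n → ℕ} (h : ∀ l < i, α l = 0) : sign K i α = 1 := by
  rw [sign, Finset.sum_eq_zero fun l hl => h l (Finset.mem_Iio.1 hl), pow_zero]

/-- The creation operators, `e_α ↦ ± e_{α + δ_j}`. -/
noncomputable def create (j : Fin n) : Module.End K ((Fin n → ℕ) →₀ K) :=
  Finsupp.linearCombination K fun α => sign K j α • Finsupp.single (α + Pi.single j 1) 1

/-- The annihilation operators, `e_α ↦ ± e_{α - δ_i}` for `α_i` odd and `e_α ↦ 0` for `α_i`
even. -/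
noncomputable def annihilate (i : Fin n) : Module.End K ((Fin n → ℕ) →₀ K) :=
  Finsupp.linearCombination K fun α =>
    if Even (α i) then 0 else sign K i α • Finsupp.single (α - Pi.single i 1) 1

theorem create_single (j : Fin n) (α : Fin n → ℕ) :
    create j (Finsupp.single α (1 : K)) =
      sign K j α • Finsupp.single (α + Pi.single j 1) 1 := by
  rw [create, Finsupp.linearCombination_single, one_smul]

theorem annihilate_single_of_even {i : Fin n} {α : Fin n → ℕ} (h : Even (α i)) :
    annihilate i (Finsupp.single α (1 : K)) = 0 := by
  rw [annihilate, Finsupp.linearCombination_single, if_pos h, smul_zero]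

theorem annihilate_single_add {i : Fin n} {β : Fin n → ℕ} (h : Even (β i)) :
    annihilate i (Finsupp.single (β + Pi.single i 1) (1 : K)) =
      sign K i β • Finsupp.single β 1 := by
  rw [annihilate, Finsupp.linearCombination_single, one_smul, if_neg, sign_add_of_le le_rfl,
    add_tsub_cancel_right]
  simpa [Nat.even_add_one] using h

theorem even_or_eq_add (i : Fin n) (α : Fin n → ℕ) :
    Even (α i) ∨ ∃ β : Fin n → ℕ, Even (β i) ∧ α = β + Pi.single i 1 := by
  rcases Nat.even_or_odd (α i) with h | h
  · exact Or.inl h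
  · refine Or.inr ⟨α - Pi.single i 1, ?_, ?_⟩
    · simpa using h.tsub_odd odd_one
    · funext l
      by_cases hl : l = i
      · subst hl
        have := h.pos
        simp; omega
      · simp [Pi.single_eq_of_ne hl]

theorem end_ext {f g : Module.End K ((Fin n → ℕ) →₀ K)}
    (h : ∀ α, f (Finsupp.single α 1) = g (Finsupp.single α 1)) : f = g :=
  Finsupp.lhom_ext' fun α => LinearMap.ext_ring (h α)

theorem add_single_apply_of_ne {i j : Fin n} (h : i ≠ j) (α : Fin n → ℕ) :
    (α + Pi.single j 1 : Fin n → ℕ) i = α i := by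
  simp [Pi.single_eq_of_ne h]

theorem sign_mul_sign_swap {i j : Fin n} (h : i ≠ j) (α : Fin n → ℕ) :
    sign K i α * sign K j (α + Pi.single i 1) + sign K j α * sign K i (α + Pi.single j 1) = 0 := by
  rcases lt_or_gt_of_ne h with h | h
  · rw [sign_add_of_lt h, sign_add_of_le h.le]; ring
  · rw [sign_add_of_lt h, sign_add_of_le h.le]; ring

theorem create_anticomm {i j : Fin n} (h : i ≠ j) :
    create i * create j + create j * create i = (0 : Module.End K ((Fin n → ℕ) →₀ K)) := by
  refine end_ext fun α => ?_
  simp only [LinearMap.add_apply, Module.End.mul_apply, create_single, map_smul, smul_smul]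
  rw [add_right_comm α, ← add_smul, add_comm, sign_mul_sign_swap h, zero_smul,
    LinearMap.zero_apply]

theorem annihilate_create_anticomm {i j : Fin n} (h : i ≠ j) :
    annihilate i * create j + create j * annihilate i =
      (0 : Module.End K ((Fin n → ℕ) →₀ K)) := by
  refine end_ext fun α => ?_
  simp only [LinearMap.add_apply, Module.End.mul_apply, create_single, map_smul]
  obtain hα | ⟨β, hβ, rfl⟩ := even_or_eq_add i α
  · rw [annihilate_single_of_even hα, annihilate_single_of_even, smul_zero, map_zero]
    · simp
    · rwa [add_single_apply_of_ne h]
  · rw [annihilate_single_add hβ, add_right_comm, annihilate_single_add]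
    · rw [map_smul, create_single, smul_smul, smul_smul, ← add_smul, LinearMap.zero_apply]
      rcases lt_or_gt_of_ne h with h | h
      · rw [sign_add_of_lt h, sign_add_of_le h.le]
        convert zero_smul K _ using 2
        ring
      · rw [sign_add_of_lt h, sign_add_of_le h.le]
        convert zero_smul K _ using 2
        ring
    · rwa [add_single_apply_of_ne h]

theorem annihilate_create_self (i : Fin n) :
    annihilate i * create i + create i * annihilate i =
      (1 : Module.End K ((Fin n → ℕ) →₀ K)) := by
  refine end_ext fun α => ?_
  simp only [LinearMap.add_apply, Module.End.mul_apply, create_single, map_smul,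
    Module.End.one_apply]
  obtain hα | ⟨β, hβ, rfl⟩ := even_or_eq_add i α
  · rw [annihilate_single_of_even hα, annihilate_single_add hα, map_zero, smul_smul,
      sign_mul_self, one_smul, add_zero]
  · rw [annihilate_single_add hβ, annihilate_single_of_even, map_smul, create_single, smul_smul,
      sign_mul_self, one_smul, smul_zero, zero_add]
    simp only [Pi.add_apply, Pi.single_eq_same]
    rw [add_assoc]
    exact hβ.add even_two

theorem annihilate_anticomm (i j : Fin n) :
    annihilate i * annihilate j + annihilate j * annihilate i =
      (0 : Module.End K ((Fin n → ℕ) →₀ K)) := by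
  refine end_ext fun α => ?_
  simp only [LinearMap.add_apply, Module.End.mul_apply, LinearMap.zero_apply]
  by_cases hij : i = j
  · subst hij
    obtain hα | ⟨β, hβ, rfl⟩ := even_or_eq_add i α
    · rw [annihilate_single_of_even hα, map_zero, add_zero]
    · rw [annihilate_single_add hβ, map_smul, annihilate_single_of_even hβ, smul_zero, add_zero]
  · obtain hα | ⟨β, hβ, rfl⟩ := even_or_eq_add i α
    · obtain hj | ⟨γ, hγ, rfl⟩ := even_or_eq_add j α
      · rw [annihilate_single_of_even hα, annihilate_single_of_even hj, map_zero, map_zero,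
          add_zero]
      · rw [annihilate_single_of_even hα, annihilate_single_add hγ, map_zero, map_smul,
          annihilate_single_of_even, smul_zero, add_zero]
        rwa [add_single_apply_of_ne hij] at hα
    · obtain hj | ⟨γ, hγ, rfl⟩ := even_or_eq_add j β
      · rw [annihilate_single_add hβ, map_smul, annihilate_single_of_even hj,
          annihilate_single_of_even (i := j), map_zero, smul_zero, add_zero]
        rwa [add_single_apply_of_ne (Ne.symm hij)]
      · rw [add_single_apply_of_ne hij] at hβ
        rw [annihilate_single_add (by rwa [add_single_apply_of_ne hij]), add_right_comm,
          annihilate_single_add (by rwa [add_single_apply_of_ne (Ne.symm hij)]), map_smul,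
          map_smul, annihilate_single_add hγ, annihilate_single_add hβ, smul_smul, smul_smul,
          ← add_smul]
        rcases lt_or_gt_of_ne hij with h | h
        · rw [sign_add_of_lt h, sign_add_of_le h.le]
          convert zero_smul K _ using 2
          ring
        · rw [sign_add_of_lt h, sign_add_of_le h.le]
          convert zero_smul K _ using 2
          ring

theorem skew_rel_of_sum {R : Type*} [Ring R] {a b s t z : R} (h₁ : b * s + s * b = 0)
    (h₂ : a * t + t * a = z) (h₃ : a * b + b * a = 0) (h₄ : s * t + t * s = 0) :
    (b + t) * (a + s) = -((a + s) * (b + t)) + z := by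
  have h : (b + t) * (a + s) + (a + s) * (b + t) =
      (b * s + s * b) + (a * t + t * a) + (a * b + b * a) + (s * t + t * s) := by
    noncomm_ring
  rw [h₁, h₂, h₃, h₄] at h
  rw [eq_sub_of_add_eq h]
  abel

/-- The operators `Y_j = a_j⁺ + ∑_{l < j} c_lj a_l⁻`, with creation operators `a_j⁺` and annihilation
operators `a_l⁻`; they satisfy `Y_j Y_i = - Y_i Y_j + c_ij` for `i < j`. -/
noncomputable def op (c : Fin n → Fin n → K) (j : Fin n) : Module.End K ((Fin n → ℕ) →₀ K) :=
  create j + ∑ l ∈ Finset.Iio j, c l j • annihilate l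

theorem op_rel (c : Fin n → Fin n → K) {i j : Fin n} (h : i < j) :
    op c j * op c i = -(op c i * op c j) + algebraMap K _ (c i j) := by
  have hsum : ∀ (s t : Finset (Fin n)) (f g : Fin n → K),
      (∑ l ∈ s, f l • annihilate l) * (∑ m ∈ t, g m • annihilate m) +
      (∑ m ∈ t, g m • annihilate m) * (∑ l ∈ s, f l • annihilate l) =
        (0 : Module.End K ((Fin n → ℕ) →₀ K)) := by
    intro s t f g
    simp only [Finset.sum_mul, Finset.mul_sum]
    rw [Finset.sum_comm, ← Finset.sum_add_distrib]
    refine Finset.sum_eq_zero fun m _ => ?_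
    rw [← Finset.sum_add_distrib]
    refine Finset.sum_eq_zero fun l _ => ?_
    rw [smul_mul_smul_comm, smul_mul_smul_comm, mul_comm (f m), ← smul_add, annihilate_anticomm,
      smul_zero]
  have h₁ : create j * (∑ l ∈ Finset.Iio i, c l i • annihilate l) +
      (∑ l ∈ Finset.Iio i, c l i • annihilate l) * create j =
        (0 : Module.End K ((Fin n → ℕ) →₀ K)) := by
    rw [Finset.sum_mul, Finset.mul_sum, ← Finset.sum_add_distrib]
    refine Finset.sum_eq_zero fun l hl => ?_
    have hlj : l ≠ j := ((Finset.mem_Iio.1 hl).trans h).ne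
    rw [mul_smul_comm, smul_mul_assoc, ← smul_add, add_comm, annihilate_create_anticomm hlj,
      smul_zero]
  have h₂ : create i * (∑ l ∈ Finset.Iio j, c l j • annihilate l) +
      (∑ l ∈ Finset.Iio j, c l j • annihilate l) * create i =
        algebraMap K (Module.End K ((Fin n → ℕ) →₀ K)) (c i j) := by
    rw [Finset.sum_mul, Finset.mul_sum, ← Finset.sum_add_distrib,
      Finset.sum_eq_single_of_mem i (Finset.mem_Iio.2 h)]
    · rw [mul_smul_comm, smul_mul_assoc, ← smul_add, add_comm, annihilate_create_self,
        Algebra.algebraMap_eq_smul_one]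
    · intro l _ hl
      rw [mul_smul_comm, smul_mul_assoc, ← smul_add, add_comm, annihilate_create_anticomm hl,
        smul_zero]
  have h₃ := create_anticomm (K := K) h.ne
  have h₄ := hsum (Finset.Iio i) (Finset.Iio j) (fun l => c l i) (fun l => c l j)
  exact skew_rel_of_sum (R := Module.End K ((Fin n → ℕ) →₀ K)) h₁ h₂ h₃ h₄

theorem op_single (c : Fin n → Fin n → K) (j : Fin n) {α : Fin n → ℕ} (h : ∀ l < j, α l = 0) :
    op c j (Finsupp.single α 1) = Finsupp.single (α + Pi.single j 1) 1 := by
  rw [op, LinearMap.add_apply, create_single, sign_eq_one h, one_smul, LinearMap.sum_apply,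
    Finset.sum_eq_zero, add_zero]
  intro l hl
  rw [LinearMap.smul_apply, annihilate_single_of_even, smul_zero]
  rw [h l (Finset.mem_Iio.1 hl)]
  exact Even.zero

/-- Ordered monomials in the operators `Y_j`, applied to the vacuum vector `e_0`, give the standard
basis. -/
theorem orderedMonomial_op (c : Fin n → Fin n → K) (α : Fin n → ℕ) :
    orderedMonomial (op c) α (Finsupp.single 0 1) = Finsupp.single α 1 := by
  induction α using exponent_induction with
  | zero => rw [orderedMonomial_zero, Module.End.one_apply]
  | step β j hβ ih =>
    rw [orderedMonomial_add_single _ _ _ hβ, Module.End.mul_apply, ih, op_single c j hβ]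

theorem op_zero (j : Fin n) : op (0 : Fin n → Fin n → K) j = create j := by
  simp [op]

end Fock

/-! ### The monomial basis of an algebra with relations `y_j y_i = - y_i y_j + c_ij` -/

section MonomialBasis

variable {n : ℕ} {K A : Type*} [CommRing K] [Ring A] [Algebra K A]

/-- Ordered monomials span: multiplication by `y j` maps the span of the monomials of degree at
most `m` to the span of those of degree at most `m + 1`, by induction on `m`, then on `j`. -/
theorem mul_orderedMonomial_mem (y : Fin n → A) (c : Fin n → Fin n → K)
    (hrel : ∀ i j, i < j → y j * y i = -(y i * y j) + algebraMap K A (c i j)) (m : ℕ)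
    (j : Fin n) (α : Fin n → ℕ) (hα : ∑ i, α i ≤ m) :
    y j * orderedMonomial y α ∈
      Submodule.span K (orderedMonomial y '' {β | ∑ i, β i ≤ m + 1}) := by
  induction m using Nat.strong_induction_on generalizing j α with
  | _ m ihm =>
    induction j using WellFoundedLT.induction generalizing α with
    | _ j ihj =>
      have hdeg : ∀ (γ : Fin n → ℕ) (l : Fin n),
          ∑ i, (γ + Pi.single l 1 : Fin n → ℕ) i = ∑ i, γ i + 1 := fun γ l => by
        simp only [Pi.add_apply, Finset.sum_add_distrib]
        simp
      by_cases hj : ∀ l < j, α l = 0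
      · rw [← orderedMonomial_add_single y α j hj]
        exact Submodule.subset_span ⟨_, by
          rw [Set.mem_ofPred_eq, hdeg]; omega, rfl⟩
      · obtain ⟨i, β, hij, hβ, rfl⟩ : ∃ (i : Fin n) (β : Fin n → ℕ), i < j ∧ (∀ l < i, β l = 0) ∧
            α = β + Pi.single i 1 := by
          induction α using exponent_induction with
          | zero => exact absurd (fun _ _ => rfl) hj
          | step β i hβ _ =>
            refine ⟨i, β, ?_, hβ, rfl⟩
            by_contra hij
            refine hj fun l hl => ?_
            have hli : l < i := lt_of_lt_of_le hl (not_lt.1 hij)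
            simp [hβ l hli, Pi.single_eq_of_ne hli.ne]
        rw [hdeg] at hα
        obtain ⟨m, rfl⟩ : ∃ m', m = m' + 1 := ⟨m - 1, by omega⟩
        rw [orderedMonomial_add_single y β i hβ, ← mul_assoc, hrel i j hij, add_mul, neg_mul,
          mul_assoc]
        refine add_mem (neg_mem ?_) ?_
        · have h1 := ihm m (Nat.lt_succ_self m) j β (by omega)
          refine Submodule.span_induction (p := fun x _ => y i * x ∈ Submodule.span K
            (orderedMonomial y '' {β | ∑ i, β i ≤ m + 1 + 1})) ?_ ?_ ?_ ?_ h1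
          · rintro _ ⟨γ, hγ, rfl⟩
            exact ihj i hij γ hγ
          · rw [mul_zero]; exact zero_mem _
          · intro a b _ _ ha hb
            rw [mul_add]; exact add_mem ha hb
          · intro r a _ ha
            rw [mul_smul_comm]; exact Submodule.smul_mem _ _ ha
        · rw [← Algebra.smul_def]
          refine Submodule.smul_mem _ _ (Submodule.subset_span ⟨β, ?_, rfl⟩)
          rw [Set.mem_ofPred_eq]; omega

theorem span_orderedMonomial_eq_top (y : Fin n → A) (c : Fin n → Fin n → K)
    (hrel : ∀ i j, i < j → y j * y i = -(y i * y j) + algebraMap K A (c i j))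
    (hgen : Algebra.adjoin K (Set.range y) = ⊤) :
    Submodule.span K (Set.range (orderedMonomial y)) = ⊤ := by
  rw [eq_top_iff]
  have hy : ∀ j, ∀ x ∈ Submodule.span K (Set.range (orderedMonomial y)),
      y j * x ∈ Submodule.span K (Set.range (orderedMonomial y)) := by
    intro j x hx
    induction hx using Submodule.span_induction with
    | mem x hx =>
      obtain ⟨α, rfl⟩ := hx
      exact Submodule.span_mono (Set.image_subset_range _ _)
        (mul_orderedMonomial_mem y c hrel _ j α le_rfl)
    | zero => rw [mul_zero]; exact zero_mem _
    | add a b _ _ ha hb => rw [mul_add]; exact add_mem ha hb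
    | smul r a _ ha => rw [mul_smul_comm]; exact Submodule.smul_mem _ _ ha
  have hall : ∀ a : A, ∀ x ∈ Submodule.span K (Set.range (orderedMonomial y)),
      a * x ∈ Submodule.span K (Set.range (orderedMonomial y)) := by
    intro a
    have ha : a ∈ Algebra.adjoin K (Set.range y) := by rw [hgen]; trivial
    induction ha using Algebra.adjoin_induction with
    | mem a ha =>
      obtain ⟨j, rfl⟩ := ha
      exact hy j
    | algebraMap r =>
      intro x hx
      rw [← Algebra.smul_def]; exact Submodule.smul_mem _ _ hx
    | add a b _ _ ha hb => intro x hx; rw [add_mul]; exact add_mem (ha x hx) (hb x hx)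
    | mul a b _ _ ha hb => intro x hx; rw [mul_assoc]; exact ha _ (hb x hx)
  intro a _
  have := hall a _ (Submodule.subset_span ⟨0, orderedMonomial_zero y⟩)
  rwa [mul_one] at this

/-- If an algebra generated by elements with `y_j y_i = - y_i y_j + c_ij` acts on the Fock space,
then its ordered monomials form a basis. -/
theorem exists_monomialBasis (y : Fin n → A) (c : Fin n → Fin n → K)
    (hrel : ∀ i j, i < j → y j * y i = -(y i * y j) + algebraMap K A (c i j))
    (hgen : Algebra.adjoin K (Set.range y) = ⊤)
    (F : A →ₐ[K] Module.End K ((Fin n → ℕ) →₀ K)) (hF : ∀ j, F (y j) = Fock.op c j) :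
    ∃ b : Module.Basis (Fin n → ℕ) K A, ∀ α, b α = orderedMonomial y α := by
  have hmon : ∀ α, F (orderedMonomial y α) = orderedMonomial (Fock.op c) α := fun α => by
    simp only [orderedMonomial, map_list_prod, List.map_map, Function.comp_def, map_pow, hF]
  have hli : LinearIndependent K (orderedMonomial y) := by
    let ev : A →ₗ[K] ((Fin n → ℕ) →₀ K) :=
      (LinearMap.applyₗ (Finsupp.single 0 1)).comp F.toLinearMap
    refine LinearIndependent.of_comp ev ?_
    have : ev ∘ orderedMonomial y = Finsupp.basisSingleOne (R := K) := by
      funext α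
      change F (orderedMonomial y α) (Finsupp.single 0 1) = _
      rw [hmon, Fock.orderedMonomial_op, Finsupp.coe_basisSingleOne]
    rw [this]
    exact Module.Basis.linearIndependent _
  exact ⟨Module.Basis.mk hli (span_orderedMonomial_eq_top y c hrel hgen).ge,
    fun α => Module.Basis.mk_apply _ _ α⟩

end MonomialBasis

section EvenSquares

variable {n : ℕ} {K A : Type*} [CommRing K] [Ring A] [Algebra K A]

theorem sq_mul_orderedMonomial (y : Fin n → A) (hsq : ∀ i a, y i ^ 2 * a = a * y i ^ 2)
    (i : Fin n) (α : Fin n → ℕ) :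
    y i ^ 2 * orderedMonomial y α = orderedMonomial y (α + 2 • Pi.single i 1) := by
  induction α using exponent_induction with
  | zero =>
    have h1 := orderedMonomial_add_single y 0 i (fun _ _ => rfl)
    have h2 := orderedMonomial_add_single y (0 + Pi.single i 1) i
      (fun l hl => by simp [Pi.single_eq_of_ne hl.ne])
    rw [two_smul, ← add_assoc, h2, h1, pow_two, mul_assoc]
  | step β l hβ ih =>
    by_cases hil : i ≤ l
    · have h0 : ∀ m < i, (β + Pi.single l 1 : Fin n → ℕ) m = 0 := fun m hm => by
        have hml := lt_of_lt_of_le hm hil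
        simp [hβ m hml, Pi.single_eq_of_ne hml.ne]
      have h1 := orderedMonomial_add_single y _ i h0
      have h2 := orderedMonomial_add_single y (β + Pi.single l 1 + Pi.single i 1) i
        (fun m hm => by rw [Pi.add_apply, h0 m hm, Pi.single_eq_of_ne hm.ne, add_zero])
      rw [two_smul, ← add_assoc, h2, h1, pow_two, mul_assoc]
    · rw [orderedMonomial_add_single y β l hβ, ← mul_assoc, hsq, mul_assoc, ih,
        add_right_comm, orderedMonomial_add_single]
      intro m hm
      have hmi : m < i := hm.trans (not_le.1 hil)
      simp [hβ m hm, Pi.single_eq_of_ne hmi.ne]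

/-- Exponents written as `2 β + ε` with `ε ∈ {0, 1}^n`. -/
noncomputable def exponentEquiv (n : ℕ) : (Σ _ : Fin n → Fin 2, Fin n →₀ ℕ) ≃ (Fin n → ℕ) where
  toFun p := fun i => 2 * p.2 i + p.1 i
  invFun α := ⟨fun i => ⟨α i % 2, Nat.mod_lt _ two_pos⟩,
    Finsupp.equivFunOnFinite.symm fun i => α i / 2⟩
  left_inv := by
    rintro ⟨ε, β⟩
    have h1 : (fun i => (⟨(2 * β i + ε i) % 2, Nat.mod_lt _ two_pos⟩ : Fin 2)) = ε := by
      funext i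
      apply Fin.ext
      have := (ε i).2
      simp only
      omega
    have h2 : (Finsupp.equivFunOnFinite.symm fun i => (2 * β i + (ε i : ℕ)) / 2) = β := by
      ext i
      have := (ε i).2
      simp only [Finsupp.equivFunOnFinite_symm_apply_apply]
      omega
    simp only [h1, h2]
  right_inv α := by
    funext i
    simp only [Finsupp.equivFunOnFinite_symm_apply_apply]
    omega

/-- If the ordered monomials in `y` form a basis over `K` and the squares of the `y i` are central,
then the square-free ordered monomials are a basis over `K[X₀, …, X_{n-1}]`, where `X i` acts as
`y i ^ 2 - s i` with `s i ∈ K`. -/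
theorem exists_squarefreeBasis (y : Fin n → A) (hsq : ∀ i a, y i ^ 2 * a = a * y i ^ 2)
    (b : Module.Basis (Fin n → ℕ) K A) (hb : ∀ α, b α = orderedMonomial y α)
    [Algebra (MvPolynomial (Fin n) K) A] [IsScalarTower K (MvPolynomial (Fin n) K) A]
    (s : Fin n → K) (hX : ∀ i, algebraMap (MvPolynomial (Fin n) K) A (MvPolynomial.X i) =
      y i ^ 2 - algebraMap K A (s i)) :
    ∃ b' : Module.Basis (Fin n → Fin 2) (MvPolynomial (Fin n) K) A,
      ∀ ε, b' ε = orderedMonomial y fun i => (ε i : ℕ) := by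
  let v : (Fin n → Fin 2) → A := fun ε => orderedMonomial y fun i => (ε i : ℕ)
  let Φ : ((Fin n → Fin 2) →₀ MvPolynomial (Fin n) K) →ₗ[MvPolynomial (Fin n) K] A :=
    Finsupp.linearCombination _ v
  -- The translation `X i ↦ X i + s i` turns monomials into products of the elements `y i ^ 2`.
  let f : MvPolynomial (Fin n) K →ₐ[K] MvPolynomial (Fin n) K :=
    MvPolynomial.aeval fun i => MvPolynomial.X i + MvPolynomial.C (s i)
  let g : MvPolynomial (Fin n) K →ₐ[K] MvPolynomial (Fin n) K :=
    MvPolynomial.aeval fun i => MvPolynomial.X i - MvPolynomial.C (s i)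
  let ψ : MvPolynomial (Fin n) K ≃ₐ[K] MvPolynomial (Fin n) K :=
    AlgEquiv.ofAlgHom f g (by ext i : 1; simp [f, g, MvPolynomial.algebraMap_eq])
      (by ext i : 1; simp [f, g, MvPolynomial.algebraMap_eq])
  have hψX : ∀ i, algebraMap (MvPolynomial (Fin n) K) A (ψ (MvPolynomial.X i)) = y i ^ 2 := by
    intro i
    change algebraMap _ A (f (MvPolynomial.X i)) = _
    rw [MvPolynomial.aeval_X, map_add, hX, ← MvPolynomial.algebraMap_eq,
      ← IsScalarTower.algebraMap_apply, sub_add_cancel]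
  have hmon : ∀ (β : Fin n →₀ ℕ) (α : Fin n → ℕ),
      ψ (MvPolynomial.monomial β 1) • orderedMonomial y α =
        orderedMonomial y (fun i => 2 * β i + α i) := by
    intro β
    induction β using Finsupp.induction_linear with
    | zero => intro α; simp
    | add β γ hβ hγ =>
      intro α
      rw [← one_mul (1 : K), ← MvPolynomial.monomial_mul, map_mul, mul_smul, hγ, hβ]
      congr 1
      funext i
      simp only [Finsupp.add_apply]
      ring
    | single i m =>
      induction m with
      | zero => intro α; simp
      | succ m ih =>
        intro α
        rw [Finsupp.single_add, ← one_mul (1 : K), ← MvPolynomial.monomial_mul, map_mul, mul_smul,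
          ← MvPolynomial.X, Algebra.smul_def (ψ (MvPolynomial.X i)), hψX,
          sq_mul_orderedMonomial y hsq, ih]
        congr 1
        funext l
        by_cases h : l = i
        · subst h; simp; ring
        · simp [Finsupp.single_eq_of_ne h, Pi.single_eq_of_ne h]
  let B₁ : Module.Basis (Σ _ : Fin n → Fin 2, Fin n →₀ ℕ) K
      ((Fin n → Fin 2) →₀ MvPolynomial (Fin n) K) :=
    Finsupp.basis fun _ => (MvPolynomial.basisMonomials (Fin n) K).map ψ.toLinearEquiv
  have hΦ : ∀ x, Φ x = (B₁.equiv b (exponentEquiv n)) x := by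
    intro x
    have : Φ.restrictScalars K = (B₁.equiv b (exponentEquiv n)).toLinearMap := by
      refine B₁.ext fun p => ?_
      rw [LinearEquiv.coe_coe, Module.Basis.equiv_apply, hb, Finsupp.coe_basis]
      change Φ (Finsupp.single p.1 (ψ (MvPolynomial.basisMonomials (Fin n) K p.2))) = _
      rw [Finsupp.linearCombination_single, MvPolynomial.coe_basisMonomials, hmon]
      rfl
    exact LinearMap.congr_fun this x
  have hbij : Function.Bijective Φ := by
    have : (Φ : _ → A) = B₁.equiv b (exponentEquiv n) := funext hΦ
    rw [this]
    exact LinearEquiv.bijective _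
  refine ⟨Module.Basis.ofRepr (LinearEquiv.ofBijective Φ hbij).symm, fun ε => ?_⟩
  change Φ (Finsupp.single ε 1) = _
  rw [Finsupp.linearCombination_single, one_smul]

end EvenSquares

/-! ### Free algebras over polynomial rings modulo some of the variables -/

section Variables

variable {n : ℕ} {F A ι : Type*} [CommRing F] [Ring A] [Algebra (MvPolynomial (Fin n) F) A]

/-- The ideal generated by the variables `X l` with `l ∈ s`. -/
noncomputable abbrev varIdeal (F : Type*) [CommRing F] (s : Set (Fin n)) :
    Ideal (MvPolynomial (Fin n) F) :=
  Ideal.span (MvPolynomial.X '' s)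

theorem mem_varIdeal_of_X_mul_mem {s : Set (Fin n)} {i : Fin n} (hi : i ∉ s)
    {f : MvPolynomial (Fin n) F} (h : MvPolynomial.X i * f ∈ varIdeal F s) : f ∈ varIdeal F s := by
  rw [MvPolynomial.mem_ideal_span_X_image] at h ⊢
  intro m hm
  obtain ⟨l, hl, hml⟩ := h (m + Finsupp.single i 1) (by
    rw [MvPolynomial.mem_support_iff, add_comm, MvPolynomial.coeff_X_mul]
    exact MvPolynomial.mem_support_iff.1 hm)
  have hli : l ≠ i := fun e => hi (e ▸ hl)
  refine ⟨l, hl, ?_⟩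
  rwa [Finsupp.add_apply, Finsupp.single_eq_of_ne hli, add_zero] at hml

/-- In a free module, `J M` consists of the elements whose coordinates lie in `J`. -/
theorem Module.Basis.mem_smul_top_iff {R M : Type*} [CommRing R] [AddCommGroup M] [Module R M]
    (b : Module.Basis ι R M) (J : Ideal R) (x : M) :
    x ∈ J • (⊤ : Submodule R M) ↔ ∀ i, b.repr x i ∈ J := by
  constructor
  · intro hx i
    refine Submodule.smul_induction_on hx (fun r hr m _ => ?_) fun a c ha hc => ?_
    · rw [map_smul, Finsupp.smul_apply, smul_eq_mul]
      exact J.mul_mem_right _ hr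
    · rw [map_add, Finsupp.add_apply]
      exact J.add_mem ha hc
  · intro h
    rw [← b.linearCombination_repr x, Finsupp.linearCombination_apply]
    exact Submodule.sum_mem _ fun i _ => Submodule.smul_mem_smul (h i) Submodule.mem_top

/-- In a free module over a polynomial ring, every variable is a non-zero-divisor modulo other
variables. -/
theorem mem_smul_top_of_X_smul_mem (b : Module.Basis ι (MvPolynomial (Fin n) F) A)
    {s : Set (Fin n)} {i : Fin n} (hi : i ∉ s) {x : A}
    (h : (MvPolynomial.X i : MvPolynomial (Fin n) F) • x ∈
      varIdeal F s • (⊤ : Submodule (MvPolynomial (Fin n) F) A)) :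
    x ∈ varIdeal F s • (⊤ : Submodule (MvPolynomial (Fin n) F) A) := by
  rw [b.mem_smul_top_iff] at h ⊢
  intro e
  have := h e
  rw [map_smul, Finsupp.smul_apply, smul_eq_mul] at this
  exact mem_varIdeal_of_X_mul_mem hi this

theorem mul_mem_smul_top {R : Type*} [CommRing R] [Algebra R A] (J : Ideal R) {x : A}
    (hx : x ∈ J • (⊤ : Submodule R A)) (a : A) : x * a ∈ J • (⊤ : Submodule R A) := by
  refine Submodule.smul_induction_on hx (fun r hr m _ => ?_) fun c d hc hd => ?_
  · rw [smul_mul_assoc]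
    exact Submodule.smul_mem_smul hr Submodule.mem_top
  · rw [add_mul]
    exact add_mem hc hd

theorem mul_mem_smul_top' {R : Type*} [CommRing R] [Algebra R A] (J : Ideal R) {x : A}
    (hx : x ∈ J • (⊤ : Submodule R A)) (a : A) : a * x ∈ J • (⊤ : Submodule R A) := by
  refine Submodule.smul_induction_on hx (fun r hr m _ => ?_) fun c d hc hd => ?_
  · rw [mul_smul_comm]
    exact Submodule.smul_mem_smul hr Submodule.mem_top
  · rw [mul_add]
    exact add_mem hc hd

end Variables

/-! ### Central elements and homomorphisms from commutative polynomial rings -/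

theorem commute_of_adjoin_eq_top {K A : Type*} [CommRing K] [Ring A] [Algebra K A] {s : Set A}
    (hs : Algebra.adjoin K s = ⊤) {z : A} (hz : ∀ x ∈ s, z * x = x * z) (a : A) :
    z * a = a * z := by
  have ha : a ∈ Algebra.adjoin K s := by rw [hs]; trivial
  induction ha using Algebra.adjoin_induction with
  | mem a ha => exact hz a ha
  | algebraMap r => exact (Algebra.commutes r z).symm
  | add a b _ _ ha hb => rw [mul_add, add_mul, ha, hb]
  | mul a b _ _ ha hb => rw [← mul_assoc, ha, mul_assoc, hb, mul_assoc]

/-- The square of an element of a set of generators is central if the generators anticommute up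
to scalars. -/
theorem sq_central_of_skew_rel {n : ℕ} {K A : Type*} [CommRing K] [Ring A] [Algebra K A]
    {y : Fin n → A} (c : Fin n → Fin n → K)
    (hrel : ∀ i j, i < j → y j * y i = -(y i * y j) + algebraMap K A (c i j))
    (hgen : Algebra.adjoin K (Set.range y) = ⊤) (i : Fin n) (a : A) :
    y i ^ 2 * a = a * y i ^ 2 := by
  have key : ∀ (u v : A) (r : K), u * v = -(v * u) + algebraMap K A r →
      v ^ 2 * u = u * v ^ 2 := by
    intro u v r h
    have hr := Algebra.commutes r v
    rw [pow_two, ← mul_assoc u, h, add_mul, neg_mul, mul_assoc v u v, h, mul_add, mul_neg, hr,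
      mul_assoc]
    abel
  refine commute_of_adjoin_eq_top hgen ?_ a
  rintro _ ⟨j, rfl⟩
  rcases lt_trichotomy i j with h | rfl | h
  · exact key _ _ _ (hrel i j h)
  · rw [← pow_succ, ← pow_succ']
  · refine key _ _ (c j i) ?_
    rw [hrel j i h]
    abel

section CentralAeval

variable {R D σ : Type*} [CommRing R] [Ring D] [Algebra R D]

/-- The homomorphism from a polynomial ring to a noncommutative algebra that sends the variables
to given central elements. -/
noncomputable def centralAeval (g : σ → D) (hg : ∀ i d, d * g i = g i * d) :
    MvPolynomial σ R →ₐ[R] D :=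
  (Subalgebra.center R D).val.comp
    (MvPolynomial.aeval fun i => ⟨g i, Subalgebra.mem_center_iff.2 (hg i)⟩)

theorem centralAeval_X (g : σ → D) (hg : ∀ i d, d * g i = g i * d) (i : σ) :
    centralAeval (R := R) g hg (MvPolynomial.X i) = g i := by
  simp [centralAeval]

theorem centralAeval_commute (g : σ → D) (hg : ∀ i d, d * g i = g i * d)
    (q : MvPolynomial σ R) (d : D) : centralAeval (R := R) g hg q * d =
      d * centralAeval (R := R) g hg q :=
  (Subalgebra.mem_center_iff.1 (Subtype.prop _) d).symm

end CentralAeval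

/-! ### The skew polynomial ring -/

namespace SkewPoly

variable (k : Type u) [Field k] (n : ℕ)

theorem adjoin_range_x : Algebra.adjoin k (Set.range (x k n)) = ⊤ := by
  have h1 : Set.range (x k n) = mk k n '' Set.range (FreeAlgebra.ι k) := by
    rw [← Set.range_comp]; rfl
  rw [h1, ← AlgHom.map_adjoin, FreeAlgebra.adjoin_range_ι, Algebra.map_top]
  rw [AlgHom.range_eq_top]
  exact RingQuot.mkAlgHom_surjective k (Rel k n)

theorem rel (i j : Fin n) (h : i < j) : x k n j * x k n i =
    -(x k n i * x k n j) + algebraMap k _ ((0 : Fin n → Fin n → k) i j) := by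
  rw [x_anticomm k n j i h.ne']
  simp

theorem sq_central (i : Fin n) (a : SkewPoly k n) : x k n i ^ 2 * a = a * x k n i ^ 2 :=
  sq_central_of_skew_rel 0 (rel k n) (adjoin_range_x k n) i a

variable {k n} in
theorem exists_lift {D : Type*} [Ring D] [Algebra k D] (X : Fin n → D)
    (hX : ∀ i j, i ≠ j → X i * X j = -(X j * X i)) :
    ∃ φ : SkewPoly k n →ₐ[k] D, ∀ i, φ (x k n i) = X i := by
  refine ⟨RingQuot.liftAlgHom k ⟨FreeAlgebra.lift k X, ?_⟩, fun i => ?_⟩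
  · rintro _ _ ⟨i, j, h⟩
    simpa only [map_mul, map_neg, FreeAlgebra.lift_ι_apply] using hX i j h
  · exact (RingQuot.liftAlgHom_mkAlgHom_apply k _ _ _).trans (FreeAlgebra.lift_ι_apply X i)

theorem permute_x (σ : Equiv.Perm (Fin n)) (i : Fin n) :
    permute k n σ (x k n i) = x k n (σ i) :=
  (RingQuot.liftAlgHom_mkAlgHom_apply k _ _ _).trans (FreeAlgebra.lift_ι_apply _ i)

/-- The action on the Fock space. -/
theorem exists_fock : ∃ F : SkewPoly k n →ₐ[k] Module.End k ((Fin n → ℕ) →₀ k),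
    ∀ i, F (x k n i) = Fock.create i :=
  exists_lift (D := Module.End k ((Fin n → ℕ) →₀ k)) _ fun _ _ h =>
    eq_neg_of_add_eq_zero_left (Fock.create_anticomm h)

theorem exists_basis : ∃ b : Module.Basis (Fin n → ℕ) k (SkewPoly k n),
    ∀ α, b α = orderedMonomial (x k n) α := by
  obtain ⟨F, hF⟩ := exists_fock k n
  exact exists_monomialBasis _ 0 (rel k n) (adjoin_range_x k n) F fun j => by
    rw [hF, Fock.op_zero]

/-- The basis of ordered monomials. -/
noncomputable def basis : Module.Basis (Fin n → ℕ) k (SkewPoly k n) :=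
  (exists_basis k n).choose

theorem basis_apply (α : Fin n → ℕ) : basis k n α = orderedMonomial (x k n) α :=
  (exists_basis k n).choose_spec α

/-- Left multiplication by `x_j` in the basis of ordered monomials is the creation operator. -/
theorem x_mul_basis (j : Fin n) (α : Fin n → ℕ) :
    x k n j * basis k n α = Fock.sign k j α • basis k n (α + Pi.single j 1) := by
  obtain ⟨F, hF⟩ := exists_fock k n
  let ev : SkewPoly k n →ₗ[k] ((Fin n → ℕ) →₀ k) :=
    (LinearMap.applyₗ (Finsupp.single 0 1)).comp F.toLinearMap
  have hev : ∀ α, ev (basis k n α) = Finsupp.single α 1 := by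
    intro α
    have h1 : F (basis k n α) = orderedMonomial (Fock.op 0) α := by
      simp only [basis_apply, orderedMonomial, map_list_prod, List.map_map, Function.comp_def,
        map_pow, hF, Fock.op_zero]
    change F (basis k n α) (Finsupp.single 0 1) = _
    rw [h1, Fock.orderedMonomial_op]
  have hinj : Function.Injective ev := by
    have : ev = ((basis k n).repr : SkewPoly k n →ₗ[k] _) := by
      refine (basis k n).ext fun α => ?_
      rw [hev]
      simp
    rw [this]
    exact (basis k n).repr.injective
  refine hinj ?_
  have h1 : ev (x k n j * basis k n α) = F (x k n j) (ev (basis k n α)) := by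
    change F (x k n j * basis k n α) _ = F (x k n j) (F (basis k n α) _)
    rw [map_mul]
    rfl
  rw [h1, hF, hev, Fock.create_single, map_smul, hev]

end SkewPoly

/-! ### The algebra `B` -/

namespace CoverAlgebra

variable (k : Type u) [Field k] (n : ℕ)

instance isScalarTower : IsScalarTower k (MvPolynomial (Fin n) k) (CoverAlgebra k n) :=
  inferInstanceAs (IsScalarTower k (MvPolynomial (Fin n) k) (RingQuot (Rel k n)))

theorem rel (i j : Fin n) (h : i < j) : y k n j * y k n i =
    -(y k n i * y k n j) + algebraMap (MvPolynomial (Fin n) k) _ (2 * a k n (i + j + 1)) := by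
  have h' : mk k n _ = mk k n _ :=
    RingQuot.mkAlgHom_rel (MvPolynomial (Fin n) k) (Rel.skew (k := k) i j h)
  simpa only [y, map_mul, map_neg, map_add, AlgHom.commutes] using h'

theorem adjoin_range_y : Algebra.adjoin (MvPolynomial (Fin n) k) (Set.range (y k n)) = ⊤ := by
  have h1 : Set.range (y k n) =
      mk k n '' Set.range (FreeAlgebra.ι (MvPolynomial (Fin n) k)) := by
    rw [← Set.range_comp]; rfl
  rw [h1, ← AlgHom.map_adjoin, FreeAlgebra.adjoin_range_ι, Algebra.map_top]
  rw [AlgHom.range_eq_top]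
  exact RingQuot.mkAlgHom_surjective _ (Rel k n)

variable {k n} in
theorem exists_lift_base {D : Type*} [Ring D] [Algebra (MvPolynomial (Fin n) k) D] (Y : Fin n → D)
    (hY : ∀ i j, i < j → Y j * Y i =
      -(Y i * Y j) + algebraMap (MvPolynomial (Fin n) k) D (2 * a k n (i + j + 1))) :
    ∃ φ : CoverAlgebra k n →ₐ[MvPolynomial (Fin n) k] D, ∀ i, φ (y k n i) = Y i := by
  refine ⟨RingQuot.liftAlgHom _ ⟨FreeAlgebra.lift _ Y, ?_⟩, fun i => ?_⟩
  · rintro _ _ ⟨i, j, h⟩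
    simpa only [map_mul, map_neg, map_add, AlgHom.commutes, FreeAlgebra.lift_ι_apply]
      using hY i j h
  · exact (RingQuot.liftAlgHom_mkAlgHom_apply _ _ _ _).trans (FreeAlgebra.lift_ι_apply Y i)

variable {k n} in
/-- Homomorphisms of `k`-algebras out of `B`: a homomorphism `f` from `k[p₁, …, pₙ]` with central
values, together with elements that satisfy the relations of the `y i`. -/
theorem exists_lift {D : Type*} [Ring D] [Algebra k D] (f : MvPolynomial (Fin n) k →ₐ[k] D)
    (hf : ∀ q d, f q * d = d * f q) (Y : Fin n → D)
    (hY : ∀ i j : Fin n, i < j → Y j * Y i = -(Y i * Y j) + f (2 * a k n (i + j + 1))) :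
    ∃ φ : CoverAlgebra k n →ₐ[k] D,
      (∀ q, φ (algebraMap (MvPolynomial (Fin n) k) _ q) = f q) ∧ ∀ i, φ (y k n i) = Y i := by
  let _ : Algebra (MvPolynomial (Fin n) k) D := f.toRingHom.toAlgebra' hf
  obtain ⟨φ, hφ⟩ := exists_lift_base (k := k) Y hY
  refine ⟨{ φ.toRingHom with commutes' := fun c => ?_ }, fun q => φ.commutes q, hφ⟩
  rw [IsScalarTower.algebraMap_apply k (MvPolynomial (Fin n) k) (CoverAlgebra k n)]
  exact (φ.commutes _).trans (f.commutes c)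

theorem adjoin_generators :
    Algebra.adjoin k (Set.range (Sum.elim (p k n) (y k n))) = ⊤ := by
  rw [eq_top_iff]
  intro b _
  have hb : b ∈ Algebra.adjoin (MvPolynomial (Fin n) k) (Set.range (y k n)) := by
    rw [adjoin_range_y]; trivial
  induction hb using Algebra.adjoin_induction with
  | mem b hb =>
    obtain ⟨j, rfl⟩ := hb
    exact Algebra.subset_adjoin ⟨Sum.inr j, rfl⟩
  | algebraMap q =>
    induction q using MvPolynomial.induction_on with
    | C c =>
      rw [← MvPolynomial.algebraMap_eq, ← IsScalarTower.algebraMap_apply]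
      exact Subalgebra.algebraMap_mem _ c
    | add q r hq hr =>
      rw [map_add]
      exact add_mem (hq trivial) (hr trivial)
    | mul_X q i hq =>
      rw [map_mul]
      exact mul_mem (hq trivial) (Algebra.subset_adjoin ⟨Sum.inl i, rfl⟩)
  | add b c _ _ hb hc => exact add_mem (hb trivial) (hc trivial)
  | mul b c _ _ hb hc => exact mul_mem (hb trivial) (hc trivial)

theorem algHom_ext {D : Type*} [Ring D] [Algebra k D] {f g : CoverAlgebra k n →ₐ[k] D}
    (hp : ∀ i, f (p k n i) = g (p k n i)) (hy : ∀ i, f (y k n i) = g (y k n i)) : f = g := by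
  refine AlgHom.ext_of_adjoin_eq_top (adjoin_generators k n) ?_
  rintro _ ⟨i | i, rfl⟩
  · exact hp i
  · exact hy i

theorem exists_basis : ∃ b : Module.Basis (Fin n → ℕ) (MvPolynomial (Fin n) k) (CoverAlgebra k n),
    ∀ α, b α = orderedMonomial (y k n) α := by
  obtain ⟨F, hF⟩ := exists_lift_base (k := k) (n := n)
    (Fock.op fun i j : Fin n => 2 * a k n (i + j + 1)) fun i j h => Fock.op_rel _ h
  exact exists_monomialBasis _ _ (rel k n) (adjoin_range_y k n) F hF

/-- The basis of ordered monomials in the `y i`, over `k[p₁, …, pₙ]`. -/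
noncomputable def basis :
    Module.Basis (Fin n → ℕ) (MvPolynomial (Fin n) k) (CoverAlgebra k n) :=
  (exists_basis k n).choose

theorem basis_apply (α : Fin n → ℕ) : basis k n α = orderedMonomial (y k n) α :=
  (exists_basis k n).choose_spec α

theorem sq_central (i : Fin n) (b : CoverAlgebra k n) : y k n i ^ 2 * b = b * y k n i ^ 2 :=
  sq_central_of_skew_rel _ (rel k n) (adjoin_range_y k n) i b

theorem r_central (i : Fin n) (b : CoverAlgebra k n) : r k n i * b = b * r k n i := by
  rw [r, sub_mul, mul_sub, sq_central, Algebra.commutes]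

end CoverAlgebra

/-! ### Gradings by words and coactions -/

section WordGrading

variable {k : Type u} [Field k] {A : Type v} [Ring A] [Algebra k A] {ι : Type} (gen : ι → A)
  (w : ι → ℕ)

theorem word_mem_wordGrading (l : List ι) :
    (l.map gen).prod ∈ wordGrading k gen w (l.map w).sum :=
  Submodule.subset_span ⟨l, rfl, rfl⟩

theorem gen_mem_wordGrading (i : ι) : gen i ∈ wordGrading k gen w (w i) := by
  simpa using word_mem_wordGrading (k := k) gen w [i]

theorem one_mem_wordGrading : (1 : A) ∈ wordGrading k gen w 0 := by
  simpa using word_mem_wordGrading (k := k) gen w []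

theorem mul_mem_wordGrading {d e : ℕ} {a b : A} (ha : a ∈ wordGrading k gen w d)
    (hb : b ∈ wordGrading k gen w e) : a * b ∈ wordGrading k gen w (d + e) := by
  induction ha using Submodule.span_induction with
  | mem a ha =>
    obtain ⟨l, rfl, rfl⟩ := ha
    induction hb using Submodule.span_induction with
    | mem b hb =>
      obtain ⟨l', rfl, rfl⟩ := hb
      simpa using word_mem_wordGrading (k := k) gen w (l ++ l')
    | zero => rw [mul_zero]; exact zero_mem _
    | add b c _ _ hb hc => rw [mul_add]; exact add_mem hb hc
    | smul r b _ hb => rw [mul_smul_comm]; exact Submodule.smul_mem _ _ hb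
  | zero => rw [zero_mul]; exact zero_mem _
  | add b c _ _ hb hc => rw [add_mul]; exact add_mem hb hc
  | smul r b _ hb => rw [smul_mul_assoc]; exact Submodule.smul_mem _ _ hb

theorem gradedMonoid_wordGrading : SetLike.GradedMonoid (wordGrading k gen w) where
  one_mem := one_mem_wordGrading gen w
  mul_mem _ _ _ _ := mul_mem_wordGrading gen w

theorem pow_mem_wordGrading {d : ℕ} {a : A} (ha : a ∈ wordGrading k gen w d) (m : ℕ) :
    a ^ m ∈ wordGrading k gen w (m * d) := by
  have := gradedMonoid_wordGrading (k := k) gen w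
  simpa using SetLike.pow_mem_graded m ha

/-- The words in a set of generators span the algebra, already as an additive group once scalar
multiples of words are included. -/
theorem wordGrading_induction (hgen : Algebra.adjoin k (Set.range gen) = ⊤) (P : AddSubgroup A)
    (hP : ∀ d, ∀ a ∈ wordGrading k gen w d, a ∈ P) (a : A) : a ∈ P := by
  have ha : a ∈ Subalgebra.toSubmodule (Algebra.adjoin k (Set.range gen)) := by
    rw [hgen]; trivial
  rw [Algebra.adjoin_eq_span] at ha
  -- `P` need not be stable under scalars, so all multiples are treated at once.
  suffices h : ∀ r : k, r • a ∈ P by simpa using h 1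
  induction ha using Submodule.span_induction with
  | mem a ha =>
    obtain ⟨l, hl, rfl⟩ := Submonoid.exists_list_of_mem_closure ha
    obtain ⟨l, rfl⟩ : ∃ l' : List ι, l'.map gen = l := by
      clear ha
      induction l with
      | nil => exact ⟨[], rfl⟩
      | cons b l ih =>
        obtain ⟨i, rfl⟩ := hl b List.mem_cons_self
        obtain ⟨l', rfl⟩ := ih fun c hc => hl c (List.mem_cons_of_mem _ hc)
        exact ⟨i :: l', rfl⟩
    exact fun r => hP _ _ (Submodule.smul_mem _ r (word_mem_wordGrading gen w l))
  | zero => exact fun r => by rw [smul_zero]; exact zero_mem _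
  | add a b _ _ ha hb => exact fun r => by rw [smul_add]; exact add_mem (ha r) (hb r)
  | smul s a _ ha => exact fun r => by rw [smul_smul]; exact ha _

/-- A grading of `A` by words is the same as a coaction `A → A[T]` with `g ↦ g T^(w g)` on the
generators: then `a` is homogeneous of degree `d` if and only if it is mapped to `a T^d`. -/
theorem coaction_of_mem {ψ : A →ₐ[k] Polynomial A}
    (hψ : ∀ i, ψ (gen i) = Polynomial.monomial (w i) (gen i)) {d : ℕ} {a : A}
    (ha : a ∈ wordGrading k gen w d) : ψ a = Polynomial.monomial d a := by
  induction ha using Submodule.span_induction with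
  | mem a ha =>
    obtain ⟨l, rfl, rfl⟩ := ha
    induction l with
    | nil => simp
    | cons i l ih =>
      simp only [List.map_cons, List.prod_cons, List.sum_cons, map_mul, ih, hψ,
        Polynomial.monomial_mul_monomial]
  | zero => simp
  | add a b _ _ ha hb => rw [map_add, ha, hb, map_add]
  | smul r a _ ha => rw [map_smul, ha, Polynomial.smul_monomial]

theorem coeff_coaction_mem {ψ : A →ₐ[k] Polynomial A}
    (hψ : ∀ i, ψ (gen i) = Polynomial.monomial (w i) (gen i))
    (hgen : Algebra.adjoin k (Set.range gen) = ⊤) (a : A) (d : ℕ) :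
    (ψ a).coeff d ∈ wordGrading k gen w d := by
  let P : AddSubgroup A :=
    { carrier := {a | ∀ d, (ψ a).coeff d ∈ wordGrading k gen w d}
      zero_mem' := fun d => by simp
      add_mem' := fun {a b} ha hb d => by
        rw [map_add, Polynomial.coeff_add]; exact add_mem (ha d) (hb d)
      neg_mem' := fun {a} ha d => by
        rw [map_neg, Polynomial.coeff_neg]; exact neg_mem (ha d) }
  refine wordGrading_induction gen w hgen P (fun e a ha d => ?_) a d
  rw [coaction_of_mem gen w hψ ha, Polynomial.coeff_monomial]
  split_ifs with h
  · rwa [← h]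
  · exact zero_mem _

theorem mem_wordGrading_of_coaction {ψ : A →ₐ[k] Polynomial A}
    (hψ : ∀ i, ψ (gen i) = Polynomial.monomial (w i) (gen i))
    (hgen : Algebra.adjoin k (Set.range gen) = ⊤) {a : A} {d : ℕ}
    (ha : ψ a = Polynomial.monomial d a) : a ∈ wordGrading k gen w d := by
  have := coeff_coaction_mem gen w hψ hgen a d
  rwa [ha, Polynomial.coeff_monomial_same] at this

theorem isInternal_wordGrading {ψ : A →ₐ[k] Polynomial A}
    (hψ : ∀ i, ψ (gen i) = Polynomial.monomial (w i) (gen i))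
    (hgen : Algebra.adjoin k (Set.range gen) = ⊤) :
    DirectSum.IsInternal (wordGrading k gen w) := by
  refine isInternal_of_projections _
    (fun d => (Polynomial.lcoeff A d).toAddMonoidHom.comp ψ.toLinearMap.toAddMonoidHom) ?_ ?_
    (wordGrading_induction gen w hgen)
  · intro d a ha
    change (ψ a).coeff d = a
    rw [coaction_of_mem gen w hψ ha, Polynomial.coeff_monomial_same]
  · intro d e hde a ha
    change (ψ a).coeff d = 0
    rw [coaction_of_mem gen w hψ ha, Polynomial.coeff_monomial_of_ne _ hde]

theorem wordGrading_zero (hw : ∀ i, 0 < w i) : wordGrading k gen w 0 = (1 : Submodule k A) := by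
  rw [Submodule.one_eq_span, wordGrading]
  congr 1
  ext a
  constructor
  · rintro ⟨l, hl, rfl⟩
    cases l with
    | nil => rfl
    | cons i l =>
      have := hw i
      simp only [List.map_cons, List.sum_cons] at hl
      omega
  · rintro rfl
    exact ⟨[], rfl, rfl⟩

theorem nonempty_gradedAlgebra {𝒜 : ℕ → Submodule k A} (h₁ : SetLike.GradedMonoid 𝒜)
    (h₂ : DirectSum.IsInternal 𝒜) : Nonempty (GradedAlgebra 𝒜) :=
  ⟨{ h₁ with toDecomposition := h₂.chooseDecomposition }⟩

theorem isConnectedGraded_wordGrading [Nontrivial A] (hw : ∀ i, 0 < w i) {ψ : A →ₐ[k] Polynomial A}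
    (hψ : ∀ i, ψ (gen i) = Polynomial.monomial (w i) (gen i))
    (hgen : Algebra.adjoin k (Set.range gen) = ⊤) : IsConnectedGraded k (wordGrading k gen w) where
  nontrivial := inferInstance
  graded := nonempty_gradedAlgebra (gradedMonoid_wordGrading gen w)
    (isInternal_wordGrading gen w hψ hgen)
  zero_eq := wordGrading_zero gen w hw

end WordGrading

/-! ### Power sums in terms of elementary symmetric polynomials -/

section PowerSums

variable (k : Type u) [Field k] (n : ℕ)

/-- The homomorphism `X i ↦ σ_{i+1}` onto the symmetric polynomials. -/
noncomputable def esymmHom : MvPolynomial (Fin n) k →ₐ[k] MvPolynomial (Fin n) k :=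
  MvPolynomial.aeval fun i : Fin n => MvPolynomial.esymm (Fin n) k (i + 1)

theorem esymmHom_eq (q : MvPolynomial (Fin n) k) :
    esymmHom k n q = (MvPolynomial.esymmAlgEquiv (Fin n) k (Fintype.card_fin n) q).1 := by
  change _ = (MvPolynomial.esymmAlgHom (Fin n) k n q).1
  rw [MvPolynomial.esymmAlgHom_apply, esymmHom]

theorem esymmHom_injective : Function.Injective (esymmHom k n) := fun q r h =>
  (MvPolynomial.esymmAlgEquiv (Fin n) k (Fintype.card_fin n)).injective
    (Subtype.ext (by rwa [esymmHom_eq, esymmHom_eq] at h))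

theorem esymmHom_a (m : ℕ) : esymmHom k n (CoverAlgebra.a k n m) =
    MvPolynomial.psum (Fin n) k m := by
  rw [esymmHom_eq, CoverAlgebra.a, AlgEquiv.apply_symm_apply]

/-- The coaction on `k[p₁, …, pₙ]` that encodes the grading with `deg p_i = 2 i`. -/
noncomputable def baseCoaction :
    MvPolynomial (Fin n) k →ₐ[k] Polynomial (MvPolynomial (Fin n) k) :=
  MvPolynomial.aeval fun i : Fin n => Polynomial.monomial (2 * ((i : ℕ) + 1)) (MvPolynomial.X i)

/-- The polynomial `a_{2m}` is homogeneous of degree `2m`, because the power sum `∑ z_i^m` is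
homogeneous of degree `m` in the `z_i` and `X i ↦ σ_{i+1}` is injective. -/
theorem baseCoaction_a (m : ℕ) : baseCoaction k n (CoverAlgebra.a k n m) =
    Polynomial.monomial (2 * m) (CoverAlgebra.a k n m) := by
  let Φ : MvPolynomial (Fin n) k →ₐ[k] Polynomial (MvPolynomial (Fin n) k) :=
    MvPolynomial.aeval fun i : Fin n => Polynomial.monomial 2 (MvPolynomial.X i)
  have hprod : ∀ t : Finset (Fin n), (∏ i ∈ t, Polynomial.monomial 2
      (MvPolynomial.X i : MvPolynomial (Fin n) k)) =
        Polynomial.monomial (2 * t.card) (∏ i ∈ t, MvPolynomial.X i) := by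
    intro t
    induction t using Finset.induction_on with
    | empty => simp
    | insert i t hi ih =>
      rw [Finset.prod_insert hi, Finset.prod_insert hi, ih, Polynomial.monomial_mul_monomial,
        Finset.card_insert_of_notMem hi]
      congr 1
      congr 1
      ring
  have hesymm : ∀ m, Φ (MvPolynomial.esymm (Fin n) k m) =
      Polynomial.monomial (2 * m) (MvPolynomial.esymm (Fin n) k m) := by
    intro m
    rw [MvPolynomial.esymm, map_sum, map_sum]
    refine Finset.sum_congr rfl fun t ht => ?_
    rw [map_prod, ← (Finset.mem_powersetCard.1 ht).2, ← hprod]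
    exact Finset.prod_congr rfl fun i _ => MvPolynomial.aeval_X _ _
  have hpsum : Φ (MvPolynomial.psum (Fin n) k m) =
      Polynomial.monomial (2 * m) (MvPolynomial.psum (Fin n) k m) := by
    rw [MvPolynomial.psum, map_sum, map_sum]
    refine Finset.sum_congr rfl fun i _ => ?_
    rw [map_pow, MvPolynomial.aeval_X, Polynomial.monomial_pow]
  have hcomp : Φ.comp (esymmHom k n) =
      (Polynomial.mapAlgHom (esymmHom k n)).comp (baseCoaction k n) := by
    refine MvPolynomial.algHom_ext fun i => ?_
    rw [AlgHom.comp_apply, AlgHom.comp_apply, esymmHom, MvPolynomial.aeval_X, hesymm, baseCoaction,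
      MvPolynomial.aeval_X, Polynomial.coe_mapAlgHom, Polynomial.map_monomial]
    simp
  have h := AlgHom.congr_fun hcomp (CoverAlgebra.a k n m)
  rw [AlgHom.comp_apply, AlgHom.comp_apply, esymmHom_a, hpsum, ← esymmHom_a,
    Polynomial.coe_mapAlgHom] at h
  refine (Polynomial.map_injective
    (esymmHom k n : MvPolynomial (Fin n) k →+* MvPolynomial (Fin n) k)
    (esymmHom_injective k n) ?_).symm
  rw [Polynomial.map_monomial]
  exact h

end PowerSums

/-! ### The grading of `B` and the noetherian property -/

namespace CoverAlgebra

variable (k : Type u) [Field k] (n : ℕ)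

instance nontrivial : Nontrivial (CoverAlgebra k n) :=
  ⟨⟨_, _, (basis k n).ne_zero 0⟩⟩

/-- The weights `deg p_i = 2 i` and `deg y_i = 2 i - 1`. -/
abbrev weight (n : ℕ) : Fin n ⊕ Fin n → ℕ :=
  Sum.elim (fun i : Fin n => 2 * ((i : ℕ) + 1)) (fun i : Fin n => 2 * (i : ℕ) + 1)

/-- The coaction `B → B[T]` that encodes the grading of `B`, on the generators and on the
homogeneous elements of `k[p₁, …, pₙ]`. -/
theorem exists_coaction : ∃ ψ : CoverAlgebra k n →ₐ[k] Polynomial (CoverAlgebra k n),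
    (∀ q d, baseCoaction k n q = Polynomial.monomial d q →
      ψ (algebraMap _ _ q) = Polynomial.monomial d (algebraMap _ _ q)) ∧
    ∀ i, ψ (Sum.elim (p k n) (y k n) i) =
      Polynomial.monomial (weight n i) (Sum.elim (p k n) (y k n) i) := by
  let j : MvPolynomial (Fin n) k →ₐ[k] CoverAlgebra k n :=
    IsScalarTower.toAlgHom k (MvPolynomial (Fin n) k) (CoverAlgebra k n)
  let f : MvPolynomial (Fin n) k →ₐ[k] Polynomial (CoverAlgebra k n) :=
    (Polynomial.mapAlgHom j).comp (baseCoaction k n)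
  have hf : ∀ q d, baseCoaction k n q = Polynomial.monomial d q →
      f q = Polynomial.monomial d (algebraMap _ _ q) := by
    intro q d h
    change Polynomial.map _ (baseCoaction k n q) = _
    rw [h, Polynomial.map_monomial]
    rfl
  have hcomm : ∀ q d, f q * d = d * f q := by
    intro q d
    have : ∀ Q : Polynomial (MvPolynomial (Fin n) k),
        Polynomial.mapAlgHom j Q * d = d * Polynomial.mapAlgHom j Q := by
      intro Q
      ext m
      rw [Polynomial.coeff_mul, Polynomial.coeff_mul, ← Finset.Nat.sum_antidiagonal_swap]
      refine Finset.sum_congr rfl fun x _ => ?_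
      rw [Polynomial.coe_mapAlgHom, Polynomial.coeff_map, Polynomial.coeff_map]
      exact Algebra.commutes (Q.coeff x.2) (d.coeff x.1)
    exact this _
  have ha : ∀ m, f (2 * a k n m) = Polynomial.monomial (2 * m) (algebraMap _ _ (2 * a k n m)) := by
    intro m
    refine hf _ _ ?_
    rw [two_mul, map_add, baseCoaction_a, map_add]
  obtain ⟨ψ, hψ, hψy⟩ := exists_lift f hcomm
    (fun i => Polynomial.monomial (2 * (i : ℕ) + 1) (y k n i)) (by
      intro i l h
      rw [Polynomial.monomial_mul_monomial, Polynomial.monomial_mul_monomial, rel k n i l h, ha,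
        map_add, map_neg, show 2 * (l : ℕ) + 1 + (2 * i + 1) = 2 * (i + l + 1) by ring,
        show 2 * (i : ℕ) + 1 + (2 * l + 1) = 2 * (i + l + 1) by ring])
  refine ⟨ψ, fun q d h => (hψ q).trans (hf q d h), ?_⟩
  rintro (i | i)
  · exact (hψ _).trans (hf _ _ (MvPolynomial.aeval_X _ _))
  · exact hψy i

theorem isConnectedGraded : IsConnectedGraded k (grading k n) := by
  obtain ⟨ψ, -, hψ⟩ := exists_coaction k n
  refine isConnectedGraded_wordGrading _ _ ?_ hψ (adjoin_generators k n)
  rintro (i | i) <;> simp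

theorem a_mem_grading (m : ℕ) : algebraMap _ _ (a k n m) ∈ grading k n (2 * m) := by
  obtain ⟨ψ, hψ', hψ⟩ := exists_coaction k n
  exact mem_wordGrading_of_coaction _ _ hψ (adjoin_generators k n) (hψ' _ _ (baseCoaction_a k n m))

theorem p_mem_grading (i : Fin n) : p k n i ∈ grading k n (2 * ((i : ℕ) + 1)) :=
  gen_mem_wordGrading (Sum.elim (p k n) (y k n)) (weight n) (Sum.inl i)

theorem y_mem_grading (i : Fin n) : y k n i ∈ grading k n (2 * (i : ℕ) + 1) :=
  gen_mem_wordGrading (Sum.elim (p k n) (y k n)) (weight n) (Sum.inr i)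

theorem r_mem_grading (i : Fin n) : r k n i ∈ grading k n (4 * i + 2) := by
  refine sub_mem ?_ ?_
  · have := pow_mem_wordGrading _ _ (y_mem_grading k n i) 2
    rwa [show 2 * (2 * (i : ℕ) + 1) = 4 * i + 2 by ring] at this
  · have := a_mem_grading k n (2 * i + 1)
    rwa [show 2 * (2 * (i : ℕ) + 1) = 4 * i + 2 by ring] at this

/-- The anti-automorphism that fixes the generators: the relations are symmetric. -/
theorem exists_opEquiv : ∃ e : CoverAlgebra k n ≃ₐ[k] (CoverAlgebra k n)ᵐᵒᵖ,
    (∀ i, e (p k n i) = MulOpposite.op (p k n i)) ∧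
    ∀ i, e (y k n i) = MulOpposite.op (y k n i) := by
  let f : MvPolynomial (Fin n) k →ₐ[k] (CoverAlgebra k n)ᵐᵒᵖ :=
    IsScalarTower.toAlgHom k (MvPolynomial (Fin n) k) (CoverAlgebra k n)ᵐᵒᵖ
  obtain ⟨θ, hθ, hθy⟩ := exists_lift f (fun q d => Algebra.commutes q d)
    (fun i => MulOpposite.op (y k n i)) (by
      intro i j h
      have h1 := rel k n i j h
      change MulOpposite.op _ * MulOpposite.op _ = -(MulOpposite.op _ * MulOpposite.op _) +
        MulOpposite.op (algebraMap _ _ _)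
      rw [← MulOpposite.op_mul, ← MulOpposite.op_mul, ← MulOpposite.op_neg, ← MulOpposite.op_add,
        h1]
      congr 1
      abel)
  have hθp : ∀ i, θ (p k n i) = MulOpposite.op (p k n i) := fun i => hθ _
  let θ' : (CoverAlgebra k n)ᵐᵒᵖ →ₐ[k] CoverAlgebra k n := AlgHom.opComm θ
  have hθ' : ∀ b, θ' b = (θ b.unop).unop := fun b => rfl
  have hid : θ'.comp θ = AlgHom.id k _ := by
    refine algHom_ext k n (fun i => ?_) fun i => ?_
    · rw [AlgHom.comp_apply, hθp, hθ', MulOpposite.unop_op, hθp]; rfl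
    · rw [AlgHom.comp_apply, hθy, hθ', MulOpposite.unop_op, hθy]; rfl
  have hleft : Function.LeftInverse θ' θ := fun b => AlgHom.congr_fun hid b
  have hbij : Function.Bijective θ := by
    refine ⟨hleft.injective, fun b => ?_⟩
    refine ⟨(θ b.unop).unop, ?_⟩
    exact MulOpposite.unop_injective (hleft b.unop)
  exact ⟨AlgEquiv.ofBijective θ hbij, hθp, hθy⟩

theorem opEquiv_grading {e : CoverAlgebra k n ≃ₐ[k] (CoverAlgebra k n)ᵐᵒᵖ}
    (hp : ∀ i, e (p k n i) = MulOpposite.op (p k n i))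
    (hy : ∀ i, e (y k n i) = MulOpposite.op (y k n i)) (d : ℕ) :
    (grading k n d).map e.toLinearMap = opGrading (grading k n) d := by
  have hgen : ∀ i, e (Sum.elim (p k n) (y k n) i) =
      MulOpposite.op (Sum.elim (p k n) (y k n) i) := by
    rintro (i | i)
    · exact hp i
    · exact hy i
  have hword : ∀ l : List (Fin n ⊕ Fin n), e (l.map (Sum.elim (p k n) (y k n))).prod =
      MulOpposite.op (l.reverse.map (Sum.elim (p k n) (y k n))).prod := by
    intro l
    induction l with
    | nil => simp
    | cons i l ih => simp [ih, hgen]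
  rw [opGrading, grading, wordGrading, Submodule.map_span, Submodule.map_span]
  congr 1
  ext b
  constructor
  · rintro ⟨_, ⟨l, hl, rfl⟩, rfl⟩
    exact ⟨_, ⟨l.reverse, by simpa using hl, rfl⟩, (hword l).symm⟩
  · rintro ⟨_, ⟨l, hl, rfl⟩, rfl⟩
    exact ⟨_, ⟨l.reverse, by simpa using hl, rfl⟩, (hword l.reverse).trans (by
      rw [List.reverse_reverse]; rfl)⟩

/-- `B` as an algebra over `k[p₁, …, pₙ][X₁, …, Xₙ]`, where `X i` acts as the central element
`r i`. -/
noncomputable instance algebraCentral :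
    Algebra (MvPolynomial (Fin n) (MvPolynomial (Fin n) k)) (CoverAlgebra k n) :=
  (centralAeval (R := MvPolynomial (Fin n) k) (r k n)
    fun i d => (r_central k n i d).symm).toRingHom.toAlgebra' (centralAeval_commute _ _)

theorem algebraMap_X (i : Fin n) : algebraMap (MvPolynomial (Fin n) (MvPolynomial (Fin n) k))
    (CoverAlgebra k n) (MvPolynomial.X i) = r k n i :=
  centralAeval_X _ _ i

instance isScalarTowerCentral : IsScalarTower (MvPolynomial (Fin n) k)
    (MvPolynomial (Fin n) (MvPolynomial (Fin n) k)) (CoverAlgebra k n) :=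
  IsScalarTower.of_algebraMap_eq fun q =>
    ((centralAeval (R := MvPolynomial (Fin n) k) (r k n)
      fun i d => (r_central k n i d).symm).commutes q).symm

/-- `B` is free over the central subalgebra `k[p₁, …, pₙ][r₁, …, rₙ]`, which is a polynomial ring,
on the square-free ordered monomials in the `y_i`. -/
theorem exists_centralBasis : ∃ b : Module.Basis (Fin n → Fin 2)
    (MvPolynomial (Fin n) (MvPolynomial (Fin n) k)) (CoverAlgebra k n),
      ∀ ε, b ε = orderedMonomial (y k n) fun i => (ε i : ℕ) :=
  exists_squarefreeBasis (y k n) (sq_central k n) (basis k n) (basis_apply k n)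
    (fun i => a k n (2 * i + 1)) (algebraMap_X k n)

/-- `B` is a finite module over a central polynomial ring. -/
theorem isTwoSidedNoetherian : IsTwoSidedNoetherian (CoverAlgebra k n) := by
  obtain ⟨b, -⟩ := exists_centralBasis k n
  have : Module.Finite (MvPolynomial (Fin n) (MvPolynomial (Fin n) k)) (CoverAlgebra k n) :=
    Module.Finite.of_basis b
  have h : IsNoetherianRing (CoverAlgebra k n) :=
    IsNoetherianRing.of_finite (MvPolynomial (Fin n) (MvPolynomial (Fin n) k)) _
  obtain ⟨e, -⟩ := exists_opEquiv k n
  exact ⟨h, isNoetherianRing_of_ringEquiv _ e.toRingEquiv⟩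

end CoverAlgebra

/-! ### The iterated Ore extension -/

theorem orderedMonomial_add_mul {n : ℕ} {A : Type*} [Monoid A] (y : Fin n → A) (α : Fin n → ℕ)
    (j : Fin n) (hα : ∀ l, j ≤ l → α l = 0) (m : ℕ) :
    orderedMonomial y (α + m • Pi.single j 1) = orderedMonomial y α * y j ^ m := by
  induction α using exponent_induction with
  | zero =>
    rw [orderedMonomial_zero, one_mul, zero_add]
    induction m with
    | zero => rw [zero_smul, orderedMonomial_zero, pow_zero]
    | succ m ih =>
      rw [succ_nsmul, orderedMonomial_add_single, ih, pow_succ']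
      intro l hl
      simp [Pi.single_eq_of_ne hl.ne]
  | step β i hβ ih =>
    have hij : i < j := by
      by_contra h
      have := hα i (not_lt.1 h)
      simp at this
    have hβj : ∀ l, j ≤ l → β l = 0 := fun l hl => by
      have := hα l hl
      rw [Pi.add_apply] at this
      omega
    rw [add_right_comm, orderedMonomial_add_single, ih hβj, orderedMonomial_add_single _ _ _ hβ,
      mul_assoc]
    intro l hl
    simp [hβ l hl, Pi.single_eq_of_ne (hl.trans hij).ne]

namespace CoverAlgebra

variable (k : Type u) [Field k] (n : ℕ)

theorem algebraMap_injective :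
    Function.Injective (algebraMap (MvPolynomial (Fin n) k) (CoverAlgebra k n)) := by
  intro q q' h
  have key : ∀ q : MvPolynomial (Fin n) k,
      (basis k n).repr (algebraMap (MvPolynomial (Fin n) k) (CoverAlgebra k n) q) 0 = q := by
    intro q
    have h1 : basis k n 0 = 1 := by rw [basis_apply, orderedMonomial_zero]
    rw [Algebra.algebraMap_eq_smul_one, ← h1, map_smul, Module.Basis.repr_self,
      Finsupp.smul_apply, Finsupp.single_eq_same, smul_eq_mul, mul_one]
  rw [← key q, ← key q', h]

/-- The parity automorphism `y_i ↦ - y_i`. -/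
theorem exists_parity : ∃ e : CoverAlgebra k n ≃ₐ[MvPolynomial (Fin n) k] CoverAlgebra k n,
    ∀ i, e (y k n i) = -y k n i := by
  obtain ⟨φ, hφ⟩ := exists_lift_base (k := k) (fun i => -y k n i) fun i j h => by
    rw [neg_mul_neg, neg_mul_neg, rel k n i j h]
  have hφφ : φ.comp φ = AlgHom.id _ _ := by
    refine AlgHom.ext_of_adjoin_eq_top (adjoin_range_y k n) ?_
    rintro _ ⟨i, rfl⟩
    rw [AlgHom.comp_apply, hφ, map_neg, hφ, neg_neg, AlgHom.id_apply]
  exact ⟨AlgEquiv.ofAlgHom φ φ hφφ hφφ, hφ⟩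

theorem stage_top : stage k n n = ⊤ := by
  rw [← adjoin_range_y, stage]
  congr 1
  rw [← Set.image_univ]
  congr 1
  ext i
  simp

theorem y_mem_stage {i : Fin n} {j : ℕ} (h : (i : ℕ) < j) : y k n i ∈ stage k n j :=
  Algebra.subset_adjoin ⟨i, h, rfl⟩

theorem stage_mono {i j : ℕ} (h : i ≤ j) : stage k n i ≤ stage k n j :=
  Algebra.adjoin_mono (Set.image_mono fun _ hl => lt_of_lt_of_le hl h)

section Step

variable {k n} {ϖ : CoverAlgebra k n ≃ₐ[MvPolynomial (Fin n) k] CoverAlgebra k n}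
  (hϖ : ∀ i, ϖ (y k n i) = -y k n i) (j : Fin n)
include hϖ

theorem parity_mem_stage (j : ℕ) {a : CoverAlgebra k n} (ha : a ∈ stage k n j) :
    ϖ a ∈ stage k n j := by
  induction ha using Algebra.adjoin_induction with
  | mem a ha =>
    obtain ⟨i, hi, rfl⟩ := ha
    rw [hϖ]
    exact neg_mem (y_mem_stage k n hi)
  | algebraMap r => rw [AlgEquiv.commutes]; exact Subalgebra.algebraMap_mem _ r
  | add a b _ _ ha hb => rw [map_add]; exact add_mem ha hb
  | mul a b _ _ ha hb => rw [map_mul]; exact mul_mem ha hb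

/-- The skew derivation `a ↦ y_j a - ϖ(a) y_j`, where `ϖ` is the parity automorphism, preserves
the subalgebra generated by `p₁, …, pₙ` and the earlier `y_i`, because it maps these `y_i` into
`k[p₁, …, pₙ]`. -/
theorem skewDerivation_mem_stage {a : CoverAlgebra k n} (ha : a ∈ stage k n j) :
    y k n j * a - ϖ a * y k n j ∈ stage k n j := by
  induction ha using Algebra.adjoin_induction with
  | mem a ha =>
    obtain ⟨i, hi, rfl⟩ := ha
    rw [hϖ, rel k n i j hi, neg_mul, sub_neg_eq_add, neg_add_cancel_comm]
    exact Subalgebra.algebraMap_mem _ _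
  | algebraMap r =>
    rw [AlgEquiv.commutes, ← Algebra.commutes, sub_self]
    exact zero_mem _
  | add a b _ _ ha hb =>
    have h : y k n j * (a + b) - ϖ (a + b) * y k n j =
        (y k n j * a - ϖ a * y k n j) + (y k n j * b - ϖ b * y k n j) := by
      rw [map_add, mul_add, add_mul]; abel
    rw [h]
    exact add_mem ha hb
  | mul a b ha' hb' ha hb =>
    have h : y k n j * (a * b) - ϖ (a * b) * y k n j =
        (y k n j * a - ϖ a * y k n j) * b + ϖ a * (y k n j * b - ϖ b * y k n j) := by
      rw [map_mul]; noncomm_ring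
    rw [h]
    exact add_mem (mul_mem ha hb') (mul_mem (parity_mem_stage hϖ _ ha') hb)

omit hϖ in
theorem exists_sum_of_mem_stage {t : CoverAlgebra k n} (ht : t ∈ stage k n (j + 1)) :
    ∃ c : ℕ →₀ stage k n j, t = c.sum fun m a => (a : CoverAlgebra k n) * y k n j ^ m := by
  obtain ⟨ϖ, hϖ⟩ := exists_parity k n
  let P : AddSubmonoid (CoverAlgebra k n) :=
    { carrier := {t | ∃ c : ℕ →₀ stage k n j,
        t = c.sum fun m a => (a : CoverAlgebra k n) * y k n j ^ m}
      zero_mem' := ⟨0, by simp⟩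
      add_mem' := by
        rintro _ _ ⟨c, rfl⟩ ⟨d, rfl⟩
        refine ⟨c + d, (Finsupp.sum_add_index' (by simp) fun m a b => ?_).symm⟩
        rw [Subalgebra.coe_add, add_mul] }
  have hP : ∀ (a : CoverAlgebra k n) (_ : a ∈ stage k n j) (m : ℕ), a * y k n j ^ m ∈ P :=
    fun a ha m => ⟨Finsupp.single m ⟨a, ha⟩, by simp⟩
  have hall : ∀ b ∈ stage k n (j + 1), ∀ x ∈ P, b * x ∈ P := by
    intro b hb
    induction hb using Algebra.adjoin_induction with
    | mem b hb =>
      obtain ⟨i, hi, rfl⟩ := hb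
      rintro _ ⟨c, rfl⟩
      rw [Finsupp.sum, Finset.mul_sum]
      refine sum_mem fun m _ => ?_
      rcases Nat.lt_succ_iff_lt_or_eq.1 hi with hi | hi
      · rw [← mul_assoc]
        exact hP _ (mul_mem (y_mem_stage k n hi) (c m).2) m
      · have hij : i = j := Fin.ext hi
        subst hij
        have h : y k n i * ((c m : CoverAlgebra k n) * y k n i ^ m) =
            ϖ (c m) * y k n i ^ (m + 1) +
              (y k n i * (c m) - ϖ (c m) * y k n i) * y k n i ^ m := by
          rw [pow_succ']; noncomm_ring
        rw [h]
        exact add_mem (hP _ (parity_mem_stage hϖ _ (c m).2) _)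
          (hP _ (skewDerivation_mem_stage hϖ i (c m).2) _)
    | algebraMap r =>
      rintro _ ⟨c, rfl⟩
      rw [Finsupp.sum, Finset.mul_sum]
      refine sum_mem fun m _ => ?_
      rw [← mul_assoc]
      exact hP _ (mul_mem (Subalgebra.algebraMap_mem _ r) (c m).2) m
    | add a b _ _ ha hb => intro x hx; rw [add_mul]; exact add_mem (ha x hx) (hb x hx)
    | mul a b _ _ ha hb => intro x hx; rw [mul_assoc]; exact ha _ (hb x hx)
  have := hall t ht 1 (by simpa using hP 1 (one_mem _) 0)
  rwa [mul_one] at this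

end Step

theorem mem_span_of_mem_stage (j : ℕ) (hj : j ≤ n) {a : CoverAlgebra k n}
    (ha : a ∈ stage k n j) : a ∈ Submodule.span (MvPolynomial (Fin n) k)
      (basis k n '' {α | ∀ l : Fin n, j ≤ l → α l = 0}) := by
  induction j generalizing a with
  | zero =>
    have h0 : stage k n 0 = ⊥ := by
      simp [stage]
    rw [h0, Algebra.mem_bot] at ha
    obtain ⟨r, rfl⟩ := ha
    have h1 : basis k n 0 = 1 := by rw [basis_apply, orderedMonomial_zero]
    rw [Algebra.algebraMap_eq_smul_one, ← h1]
    exact Submodule.smul_mem _ _ (Submodule.subset_span ⟨0, fun _ _ => rfl, rfl⟩)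
  | succ j ih =>
    obtain ⟨c, rfl⟩ := exists_sum_of_mem_stage (⟨j, hj⟩ : Fin n) ha
    refine Submodule.sum_mem _ fun m _ => ?_
    have hc := ih (Nat.le_of_succ_le hj) (c m).2
    beta_reduce
    generalize (c m : CoverAlgebra k n) = x at hc ⊢
    induction hc using Submodule.span_induction with
    | mem x hx =>
      obtain ⟨α, hα, rfl⟩ := hx
      refine Submodule.subset_span ⟨α + m • Pi.single ⟨j, hj⟩ 1, fun l hl => ?_, ?_⟩
      · have hlj : l ≠ ⟨j, hj⟩ := fun h => by
          rw [h] at hl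
          simp at hl
        rw [Pi.add_apply, hα l (Nat.le_of_succ_le hl), Pi.smul_apply, Pi.single_eq_of_ne hlj]
        simp
      · rw [basis_apply, basis_apply, orderedMonomial_add_mul]
        exact fun l hl => hα l hl
    | zero => rw [zero_mul]; exact zero_mem _
    | add x z _ _ hx hz => rw [add_mul]; exact add_mem hx hz
    | smul r x _ hx => rw [smul_mul_assoc]; exact Submodule.smul_mem _ _ hx

/-- For `a` in the span of the ordered monomials in the `y_i` with `i < j`, the coordinates of
`a * y_j ^ m` are those of `a`, with the exponent `m` of `y_j` added. -/
theorem repr_mul_pow_of_mem_span (j : Fin n) {a : CoverAlgebra k n}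
    (ha : a ∈ Submodule.span (MvPolynomial (Fin n) k)
      (basis k n '' {α | ∀ l : Fin n, (j : ℕ) ≤ l → α l = 0})) (m m' : ℕ)
    (α : Fin n → ℕ) (hα : ∀ l, j ≤ l → α l = 0) :
    (basis k n).repr (a * y k n j ^ m) (α + m' • Pi.single j 1) =
      if m = m' then (basis k n).repr a α else 0 := by
  induction ha using Submodule.span_induction with
  | mem a ha =>
    obtain ⟨γ, hγ, rfl⟩ := ha
    rw [basis_apply, ← orderedMonomial_add_mul _ _ _ hγ, ← basis_apply, ← basis_apply,
      Module.Basis.repr_self, Module.Basis.repr_self]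
    by_cases hm : m = m'
    · subst hm
      rw [if_pos rfl]
      by_cases h : γ = α
      · rw [h, Finsupp.single_eq_same, Finsupp.single_eq_same]
      · rw [Finsupp.single_eq_of_ne (Ne.symm h), Finsupp.single_eq_of_ne]
        exact fun h' => h (add_right_cancel h').symm
    · rw [if_neg hm, Finsupp.single_eq_of_ne]
      intro h
      have := congrFun h j
      simp [hα j le_rfl, hγ j le_rfl] at this
      exact hm this.symm
  | zero => simp
  | add a b _ _ ha hb =>
    rw [add_mul, map_add (basis k n).repr, Finsupp.add_apply, ha, hb, map_add (basis k n).repr,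
      Finsupp.add_apply]
    split_ifs <;> simp
  | smul r a _ ha =>
    rw [smul_mul_assoc, map_smul, Finsupp.smul_apply, ha, map_smul, Finsupp.smul_apply]
    split_ifs <;> simp

theorem existsUnique_sum_of_mem_stage (j : Fin n) {t : CoverAlgebra k n}
    (ht : t ∈ stage k n (j + 1)) :
    ∃! c : ℕ →₀ stage k n j, t = c.sum fun m a => (a : CoverAlgebra k n) * y k n j ^ m := by
  obtain ⟨c, hc⟩ := exists_sum_of_mem_stage j ht
  have key : ∀ d : ℕ →₀ stage k n j,
      (t = d.sum fun m a => (a : CoverAlgebra k n) * y k n j ^ m) →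
      ∀ m' (α : Fin n → ℕ), (∀ l, j ≤ l → α l = 0) →
        (basis k n).repr (d m' : CoverAlgebra k n) α =
          (basis k n).repr t (α + m' • Pi.single j 1) := by
    rintro d rfl m' α hα
    rw [Finsupp.sum, map_sum, Finsupp.finsetSum_apply]
    have h : ∀ m, (basis k n).repr ((d m : CoverAlgebra k n) * y k n j ^ m)
        (α + m' • Pi.single j 1) =
        if m = m' then (basis k n).repr (d m : CoverAlgebra k n) α else 0 := fun m =>
      repr_mul_pow_of_mem_span k n j (mem_span_of_mem_stage k n j j.2.le (d m).2) m m' α hα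
    simp_rw [h]
    rw [Finset.sum_ite_eq']
    split_ifs with hm
    · rfl
    · rw [Finsupp.notMem_support_iff.1 hm, ZeroMemClass.coe_zero, map_zero, Finsupp.zero_apply]
  refine ⟨c, hc, fun d hd => ?_⟩
  ext m
  refine (basis k n).repr.injective (Finsupp.ext fun α => ?_)
  by_cases hα : ∀ l, j ≤ l → α l = 0
  · rw [key c hc m α hα, key d hd m α hα]
  · have hz : ∀ a ∈ stage k n j, (basis k n).repr a α = 0 := by
      intro a ha
      have h := mem_span_of_mem_stage k n j j.2.le ha
      rw [(basis k n).mem_span_image] at h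
      by_contra h0
      exact hα fun l hl => h (Finsupp.mem_support_iff.2 h0) l hl
    rw [hz _ (c m).2, hz _ (d m).2]

/-- The twist `τ` is the restriction of the parity automorphism, and
`δ(a) = y_j a - τ(a) y_j`. -/
theorem exists_isOreExtension (j : Fin n) :
    ∃ (τ : stage k n j ≃ₐ[MvPolynomial (Fin n) k] stage k n j)
    (δ : stage k n j →ₗ[MvPolynomial (Fin n) k] stage k n j),
    IsOreExtension (stage k n j) (stage k n (j + 1)) (y k n j) τ δ ∧
    δ 1 = 0 ∧
    ∀ (i : Fin n) (s : stage k n j), i < j → (s : CoverAlgebra k n) = y k n i →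
      τ s = -s ∧
      δ s = algebraMap (MvPolynomial (Fin n) k) (stage k n j) (2 * a k n (i + j + 1)) := by
  obtain ⟨ϖ, hϖ⟩ := exists_parity k n
  have hϖϖ : ∀ b, ϖ (ϖ b) = b := by
    have h : (ϖ.toAlgHom.comp ϖ.toAlgHom) = AlgHom.id _ _ := by
      refine AlgHom.ext_of_adjoin_eq_top (adjoin_range_y k n) ?_
      rintro _ ⟨i, rfl⟩
      change ϖ (ϖ (y k n i)) = y k n i
      rw [hϖ, map_neg, hϖ, neg_neg]
    exact fun b => DFunLike.congr_fun h b
  let φ : stage k n j →ₐ[MvPolynomial (Fin n) k] stage k n j :=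
    (ϖ.toAlgHom.comp (stage k n j).val).codRestrict _ fun a => parity_mem_stage hϖ j a.2
  have hφφ : φ.comp φ = AlgHom.id _ _ := AlgHom.ext fun a => Subtype.ext (hϖϖ a)
  let τ : stage k n j ≃ₐ[MvPolynomial (Fin n) k] stage k n j := AlgEquiv.ofAlgHom φ φ hφφ hφφ
  have hτ : ∀ a, (τ a : CoverAlgebra k n) = ϖ a := fun _ => rfl
  let δ : stage k n j →ₗ[MvPolynomial (Fin n) k] stage k n j :=
    { toFun := fun a => ⟨y k n j * a - ϖ a * y k n j, skewDerivation_mem_stage hϖ j a.2⟩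
      map_add' := fun a b => Subtype.ext (by
        simp only [Subalgebra.coe_add, map_add, mul_add, add_mul]; abel)
      map_smul' := fun r a => Subtype.ext (by
        simp only [Subalgebra.coe_smul, map_smul, mul_smul_comm, smul_mul_assoc, smul_sub,
          RingHom.id_apply]) }
  have hδ : ∀ a, (δ a : CoverAlgebra k n) = y k n j * a - ϖ a * y k n j := fun _ => rfl
  refine ⟨τ, δ, ⟨stage_mono k n (Nat.le_succ _), y_mem_stage k n (Nat.lt_succ_self _), ?_, ?_,
    fun t ht => existsUnique_sum_of_mem_stage k n j ht⟩, ?_, ?_⟩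
  · intro a b
    refine Subtype.ext ?_
    simp only [Subalgebra.coe_add, Subalgebra.coe_mul, hδ, hτ, map_mul]
    noncomm_ring
  · intro a
    rw [hδ, hτ, add_sub_cancel]
  · refine Subtype.ext ?_
    rw [hδ, OneMemClass.coe_one, map_one, mul_one, one_mul, sub_self, ZeroMemClass.coe_zero]
  · intro i s hi hs
    refine ⟨Subtype.ext ?_, Subtype.ext ?_⟩
    · rw [hτ, hs, hϖ, NegMemClass.coe_neg, hs]
    · rw [hδ, hs, hϖ, rel k n i j hi, neg_mul, sub_neg_eq_add, neg_add_cancel_comm]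
      rfl

theorem isIteratedOreExtension : IsIteratedOreExtension k n :=
  ⟨algebraMap_injective k n, stage_top k n, exists_isOreExtension k n⟩

/-- Each Ore extension raises the global dimension by at most one, starting with `n` for
`k[p₁, …, pₙ]`. -/
theorem hasInjectiveDimensionLT_stage (j : ℕ) (hj : j ≤ n) (M : ModuleCat.{u} (stage k n j)) :
    HasInjectiveDimensionLT M (n + j + 1) := by
  induction j with
  | zero =>
    have h0 : stage k n 0 = ⊥ := by simp [stage]
    let e : MvPolynomial (Fin n) k ≃+* stage k n 0 :=
      ((Subalgebra.equivOfEq _ _ h0).trans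
        (Algebra.botEquivOfInjective (algebraMap_injective k n))).symm.toRingEquiv
    exact hasInjectiveDimensionLT_of_ringEquiv e n (hasInjectiveDimensionLT_mvPolynomial n) M
  | succ j ih =>
    obtain ⟨τ, δ, h, -⟩ := exists_isOreExtension k n ⟨j, hj⟩
    exact hasInjectiveDimensionLT_of_isOreExtension h (n + j + 1)
      (ih (Nat.le_of_succ_le hj)) M

/-- The global dimension of `B` is at most `2n`. -/
theorem hasInjectiveDimensionLT (M : ModuleCat.{u} (CoverAlgebra k n)) :
    HasInjectiveDimensionLT M (2 * n + 1) := by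
  let e : stage k n n ≃+* CoverAlgebra k n :=
    ((Subalgebra.equivOfEq _ _ (stage_top k n)).trans Subalgebra.topEquiv).toRingEquiv
  rw [two_mul]
  exact hasInjectiveDimensionLT_of_ringEquiv e (n + n)
    (hasInjectiveDimensionLT_stage k n n le_rfl) M

theorem hasInjectiveDimensionLT_mulOpposite (M : ModuleCat.{u} (CoverAlgebra k n)ᵐᵒᵖ) :
    HasInjectiveDimensionLT M (2 * n + 1) := by
  obtain ⟨e, -⟩ := exists_opEquiv k n
  exact hasInjectiveDimensionLT_of_ringEquiv e.toRingEquiv (2 * n)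
    (hasInjectiveDimensionLT k n) M

end CoverAlgebra

/-! ### Gelfand-Kirillov dimension -/

section GKDimension

variable {k : Type u} [Field k] {A : Type v} [Ring A] [Algebra k A]

/-- An algebra filtered by finite-dimensional subspaces of polynomial growth has finite
Gelfand-Kirillov dimension. -/
theorem gkDimension_lt_top_of_filtration (U : ℕ → Submodule k A) (hmono : Monotone U)
    (hone : (1 : Submodule k A) ≤ U 0) (hmul : ∀ M N, U M * U N ≤ U (M + N))
    (htop : ∀ a, ∃ N, a ∈ U N) [∀ N, Module.Finite k (U N)] (c : ℕ)
    (hc : ∀ N, Module.finrank k (U N) ≤ (N + 1) ^ c) : gkDimension k A < ⊤ := by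
  refine lt_of_le_of_lt (b := ((2 * c : ℝ) : EReal)) ?_ (EReal.coe_lt_top _)
  refine iSup₂_le fun V hV => ?_
  obtain ⟨D, hD⟩ : ∃ D, V ≤ U D := by
    obtain ⟨s, rfl⟩ := hV
    choose N hN using htop
    exact ⟨s.sup N, Submodule.span_le.2 fun x hx => hmono (Finset.le_sup hx) (hN x)⟩
  have hpow : ∀ m, (1 ⊔ V) ^ m ≤ U (D * m) := by
    intro m
    induction m with
    | zero => simpa using hone
    | succ m ih =>
      rw [pow_succ, Nat.mul_succ]
      refine (mul_le_mul' ih ?_).trans (hmul _ _)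
      exact sup_le (hone.trans (hmono (Nat.zero_le _))) hD
  refine Filter.limsup_le_of_le (by isBoundedDefault) ?_
  filter_upwards [Filter.eventually_ge_atTop (D + 2)] with m hm
  rw [EReal.coe_le_coe_iff]
  have hlog : 0 < Real.log m := Real.log_pos (by exact_mod_cast (by omega : 1 < m))
  rw [div_le_iff₀ hlog]
  have hle : Module.finrank k ↥((1 ⊔ V) ^ m) ≤ m ^ (2 * c) := by
    refine ((Submodule.finrank_mono (hpow m)).trans (hc _)).trans ?_
    rw [pow_mul]
    refine Nat.pow_le_pow_left ?_ c
    -- `D m + 1 ≤ m ^ 2` once `m > D + 1`.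
    nlinarith
  rcases Nat.eq_zero_or_pos (Module.finrank k ↥((1 ⊔ V) ^ m)) with h0 | h0
  · rw [h0, Nat.cast_zero, Real.log_zero]
    positivity
  · calc Real.log (Module.finrank k ↥((1 ⊔ V) ^ m)) ≤ Real.log ((m : ℝ) ^ (2 * c)) :=
        Real.log_le_log (by exact_mod_cast h0) (by exact_mod_cast hle)
      _ = 2 * c * Real.log m := by rw [Real.log_pow]; push_cast; ring

/-- A graded algebra with a homogeneous basis that is indexed by exponents bounded by the degree
has finite Gelfand-Kirillov dimension.  The grading is given by a coaction `ψ`. -/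
theorem gkDimension_lt_top_of_basis {ι σ : Type*} [Fintype σ] (b : Module.Basis ι k A)
    (f : ι → σ → ℕ) (hf : Function.Injective f) (ω : ι → ℕ) (hω : ∀ i s, f i s ≤ ω i)
    (ψ : A →ₐ[k] Polynomial A) (hψ : ∀ i, ψ (b i) = Polynomial.monomial (ω i) (b i)) :
    gkDimension k A < ⊤ := by
  classical
  let U : ℕ → Submodule k A := fun N =>
    ((Polynomial.degreeLE A N).restrictScalars k).comap ψ.toLinearMap
  have hU : ∀ N a, a ∈ U N ↔ (ψ a).degree ≤ N := fun N a => Polynomial.mem_degreeLE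
  have hcoeff : ∀ a d i, b.repr ((ψ a).coeff d) i = if ω i = d then b.repr a i else 0 := by
    intro a d i
    induction b.mem_span a using Submodule.span_induction with
    | zero => simp
    | mem a ha =>
      obtain ⟨l, rfl⟩ := ha
      rw [hψ, Polynomial.coeff_monomial]
      by_cases hli : l = i
      · subst hli
        split_ifs <;> simp
      · split_ifs <;> simp [hli]
    | add a a' _ _ ha ha' =>
      rw [map_add ψ, Polynomial.coeff_add, map_add b.repr, Finsupp.add_apply, ha, ha',
        map_add b.repr, Finsupp.add_apply]
      split_ifs <;> simp
    | smul r a _ ha =>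
      rw [map_smul ψ, Polynomial.coeff_smul, map_smul b.repr, Finsupp.smul_apply, ha,
        map_smul b.repr, Finsupp.smul_apply]
      split_ifs <;> simp
  have hinj : ∀ N, Set.MapsTo f {i | ω i ≤ N} (Set.Iic fun _ => N) :=
    fun N i hi s => (hω i s).trans hi
  have hfin : ∀ N, {i | ω i ≤ N}.Finite := fun N =>
    Set.Finite.of_finite_image ((Set.finite_Iic _).subset (hinj N).image_subset) hf.injOn
  have hspan : ∀ N, U N ≤ Submodule.span k ((hfin N).toFinset.image b : Set A) := by
    intro N a ha
    rw [Finset.coe_image, Set.Finite.coe_toFinset, b.mem_span_image]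
    intro i hi
    by_contra hN
    refine Finsupp.mem_support_iff.1 hi ?_
    have h := hcoeff a (ω i) i
    rwa [if_pos rfl, Polynomial.coeff_eq_zero_of_degree_lt, map_zero, Finsupp.zero_apply,
      eq_comm] at h
    exact lt_of_le_of_lt ((hU N a).1 ha) (by exact_mod_cast not_le.1 hN)
  have hfinite : ∀ N, Module.Finite k (U N) := fun N =>
    Submodule.finiteDimensional_of_le (hspan N)
  refine gkDimension_lt_top_of_filtration U (fun M N h a ha => ?_) ?_ (fun M N => ?_)
    (fun a => ⟨(ψ a).natDegree, (hU _ _).2 Polynomial.degree_le_natDegree⟩) (Fintype.card σ)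
    fun N => ?_
  · exact (hU _ _).2 (((hU _ _).1 ha).trans (by exact_mod_cast h))
  · rw [Submodule.one_le, hU, map_one]
    exact Polynomial.degree_one_le
  · refine Submodule.mul_le.2 fun a ha a' ha' => (hU _ _).2 ?_
    rw [map_mul]
    refine (Polynomial.degree_mul_le _ _).trans ?_
    push_cast
    exact add_le_add ((hU _ _).1 ha) ((hU _ _).1 ha')
  · calc Module.finrank k (U N)
        ≤ Module.finrank k (Submodule.span k ((hfin N).toFinset.image b : Set A)) :=
          Submodule.finrank_mono (hspan N)
      _ ≤ ((hfin N).toFinset.image b).card := finrank_span_finset_le_card _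
      _ ≤ (hfin N).toFinset.card := Finset.card_image_le
      _ ≤ (Fintype.piFinset fun _ : σ => Finset.range (N + 1)).card := by
          refine Finset.card_le_card_of_injOn f (fun i hi => ?_) hf.injOn
          have hi' : ω i ≤ N := by simpa using hi
          simp only [Finset.mem_coe, Fintype.mem_piFinset, Finset.mem_range]
          exact fun s => Nat.lt_succ_of_le ((hω i s).trans hi')
      _ = (N + 1) ^ Fintype.card σ := by simp [Fintype.card_piFinset]

end GKDimension

namespace CoverAlgebra

/-- The basis of `B` consists of the products `p^β y^α`. -/
theorem gkDimension_lt_top (k : Type u) [Field k] (n : ℕ) :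
    gkDimension k (CoverAlgebra k n) < ⊤ := by
  obtain ⟨ψ, hψ, hψg⟩ := exists_coaction k n
  let b := (MvPolynomial.basisMonomials (Fin n) k).smulTower (basis k n)
  refine gkDimension_lt_top_of_basis b (σ := Fin n ⊕ Fin n)
    (fun x => Sum.elim (fun i => x.1 i) x.2) ?_
    (fun x => ∑ i : Fin n, 2 * ((i : ℕ) + 1) * x.1 i +
      ∑ i : Fin n, (2 * (i : ℕ) + 1) * x.2 i) ?_ ψ ?_
  · rintro ⟨β, α⟩ ⟨β', α'⟩ h
    have h1 : ∀ i, β i = β' i := fun i => congrFun h (Sum.inl i)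
    have h2 : ∀ i, α i = α' i := fun i => congrFun h (Sum.inr i)
    exact Prod.ext (Finsupp.ext h1) (funext h2)
  · rintro ⟨β, α⟩ (i | i)
    · have := Finset.single_le_sum (f := fun i : Fin n => 2 * ((i : ℕ) + 1) * β i)
        (fun _ _ => Nat.zero_le _) (Finset.mem_univ i)
      simp only [Sum.elim_inl] at this ⊢
      nlinarith [Nat.zero_le ((i : ℕ) * β i),
        Nat.zero_le (∑ i : Fin n, (2 * (i : ℕ) + 1) * α i)]
    · have := Finset.single_le_sum (f := fun i : Fin n => (2 * (i : ℕ) + 1) * α i)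
        (fun _ _ => Nat.zero_le _) (Finset.mem_univ i)
      simp only [Sum.elim_inr] at this ⊢
      nlinarith [Nat.zero_le ((i : ℕ) * α i),
        Nat.zero_le (∑ i : Fin n, 2 * ((i : ℕ) + 1) * β i)]
  · rintro ⟨β, α⟩
    have hgm := gradedMonoid_wordGrading (k := k) (Sum.elim (p k n) (y k n)) (weight n)
    have hα : orderedMonomial (y k n) α ∈ grading k n (∑ i : Fin n, (2 * (i : ℕ) + 1) * α i) := by
      have h := SetLike.list_prod_map_mem_graded (A := wordGrading k _ (weight n))
        (List.finRange n) (fun i => α i • (2 * (i : ℕ) + 1))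
        (fun i => y k n i ^ α i) fun i _ => SetLike.pow_mem_graded (α i) (y_mem_grading k n i)
      rw [← List.ofFn_eq_map (f := fun i => α i • (2 * (i : ℕ) + 1)), List.sum_ofFn] at h
      simp_rw [smul_eq_mul, mul_comm (α _)] at h
      exact h
    have hβ : ψ (algebraMap _ _ (MvPolynomial.monomial β (1 : k))) =
        Polynomial.monomial (∑ i : Fin n, 2 * ((i : ℕ) + 1) * β i)
          (algebraMap _ _ (MvPolynomial.monomial β (1 : k))) := by
      refine hψ _ _ ?_
      rw [baseCoaction, MvPolynomial.aeval_monomial, map_one, one_mul,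
        Finsupp.prod_fintype _ _ fun i => pow_zero _, MvPolynomial.monomial_eq, map_one, one_mul,
        Finsupp.prod_fintype _ _ fun i => pow_zero _]
      simp_rw [Polynomial.monomial_pow]
      generalize (Finset.univ : Finset (Fin n)) = t
      induction t using Finset.induction_on with
      | empty => simp
      | insert i t hi ih =>
        rw [Finset.prod_insert hi, Finset.prod_insert hi, Finset.sum_insert hi, ih,
          Polynomial.monomial_mul_monomial]
    rw [Module.Basis.smulTower_apply, MvPolynomial.coe_basisMonomials, basis_apply,
      Algebra.smul_def, map_mul, hβ, coaction_of_mem _ _ hψg hα,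
      Polynomial.monomial_mul_monomial]

end CoverAlgebra

/-! ### The skew polynomial ring modulo variables -/

namespace SkewPoly

variable (k : Type u) [Field k] (n : ℕ)

theorem algHom_ext {D : Type*} [Ring D] [Algebra k D] {f g : SkewPoly k n →ₐ[k] D}
    (h : ∀ i, f (x k n i) = g (x k n i)) : f = g := by
  refine AlgHom.ext_of_adjoin_eq_top (adjoin_range_x k n) ?_
  rintro _ ⟨i, rfl⟩
  exact h i

instance nontrivial : Nontrivial (SkewPoly k n) :=
  ⟨⟨_, _, (basis k n).ne_zero 0⟩⟩

/-- The elements `x_j` are normal; the automorphism changes the signs of the other variables. -/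
theorem exists_normalizing (j : Fin n) : ∃ θ : SkewPoly k n →ₐ[k] SkewPoly k n,
    (∀ f, θ (θ f) = f) ∧ ∀ f, x k n j * f = θ f * x k n j := by
  classical
  let s : Fin n → k := fun i => if i = j then 1 else -1
  have hs : ∀ i, s i * s i = 1 := fun i => by
    by_cases h : i = j <;> simp [s, h]
  obtain ⟨θ, hθ⟩ := exists_lift (k := k) (fun i => s i • x k n i) fun i l h => by
    rw [smul_mul_smul_comm, smul_mul_smul_comm, x_anticomm k n i l h, smul_neg, mul_comm]
  refine ⟨θ, fun f => ?_, fun f => ?_⟩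
  · refine AlgHom.congr_fun (algHom_ext k n fun i => ?_ : θ.comp θ = AlgHom.id k _) f
    rw [AlgHom.comp_apply, hθ, map_smul, hθ, smul_smul, hs, one_smul, AlgHom.id_apply]
  · have hf : f ∈ Algebra.adjoin k (Set.range (x k n)) := by rw [adjoin_range_x]; trivial
    induction hf using Algebra.adjoin_induction with
    | mem f hf =>
      obtain ⟨i, rfl⟩ := hf
      rw [hθ]
      by_cases h : i = j
      · subst h
        simp [s]
      · simp [s, h, x_anticomm k n j i (Ne.symm h)]
    | algebraMap r => rw [AlgHom.commutes, Algebra.commutes]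
    | add f g _ _ hf hg => rw [mul_add, hf, hg, map_add, add_mul]
    | mul f g _ _ hf hg => rw [← mul_assoc, hf, mul_assoc, hg, map_mul, mul_assoc]

theorem repr_x_mul (j : Fin n) (f : SkewPoly k n) (α : Fin n → ℕ) :
    (basis k n).repr (x k n j * f) (α + Pi.single j 1) =
      Fock.sign k j α * (basis k n).repr f α := by
  induction (basis k n).mem_span f using Submodule.span_induction with
  | zero => simp
  | mem f hf =>
    obtain ⟨β, rfl⟩ := hf
    rw [x_mul_basis, map_smul, Module.Basis.repr_self, Module.Basis.repr_self, Finsupp.smul_apply,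
      smul_eq_mul]
    by_cases h : β = α
    · rw [h, Finsupp.single_eq_same, Finsupp.single_eq_same]
    · rw [Finsupp.single_eq_of_ne (Ne.symm h), Finsupp.single_eq_of_ne, mul_zero, mul_zero]
      exact fun h' => h (add_right_cancel h').symm
  | add f g _ _ hf hg =>
    rw [mul_add, map_add (basis k n).repr, Finsupp.add_apply, hf, hg, map_add (basis k n).repr,
      Finsupp.add_apply, mul_add]
  | smul r f _ hf =>
    rw [mul_smul_comm, map_smul, Finsupp.smul_apply, hf, map_smul, Finsupp.smul_apply,
      smul_eq_mul, smul_eq_mul, mul_left_comm]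

theorem eq_zero_of_x_mul {j : Fin n} {f : SkewPoly k n} (h : x k n j * f = 0) : f = 0 := by
  refine (basis k n).repr.injective (Finsupp.ext fun α => ?_)
  have h1 := repr_x_mul k n j f α
  rw [h, map_zero, Finsupp.zero_apply] at h1
  have h2 := congrArg (Fock.sign k j α * ·) h1
  simp only [mul_zero, ← mul_assoc, Fock.sign_mul_self, one_mul] at h2
  rw [← h2, map_zero, Finsupp.zero_apply]

theorem eq_zero_of_mul_x {j : Fin n} {f : SkewPoly k n} (h : f * x k n j = 0) : f = 0 := by
  obtain ⟨θ, hθ, hx⟩ := exists_normalizing k n j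
  rw [← hθ f, eq_zero_of_x_mul k n (j := j) (f := θ f), map_zero]
  rw [hx, hθ, h]

theorem exists_truncate (j : ℕ) : ∃ χ : SkewPoly k n →ₐ[k] SkewPoly k n,
    ∀ i, χ (x k n i) = if (i : ℕ) < j then 0 else x k n i :=
  exists_lift _ fun i l h => by
    split_ifs <;> simp [x_anticomm k n i l h]

/-- The endomorphism that sends `x₀, …, x_{j-1}` to `0` and fixes the other variables. -/
noncomputable def truncate (j : ℕ) : SkewPoly k n →ₐ[k] SkewPoly k n :=
  (exists_truncate k n j).choose

theorem truncate_x (j : ℕ) (i : Fin n) :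
    truncate k n j (x k n i) = if (i : ℕ) < j then 0 else x k n i :=
  (exists_truncate k n j).choose_spec i

theorem truncate_truncate {i j : ℕ} (h : i ≤ j) (f : SkewPoly k n) :
    truncate k n j (truncate k n i f) = truncate k n j f := by
  refine AlgHom.congr_fun (algHom_ext k n fun l => ?_ :
    (truncate k n j).comp (truncate k n i) = truncate k n j) f
  rw [AlgHom.comp_apply, truncate_x, apply_ite (truncate k n j), map_zero, truncate_x]
  split_ifs <;> first | rfl | omega

theorem truncate_zero : truncate k n 0 = AlgHom.id k _ :=
  algHom_ext k n fun l => by rw [truncate_x, if_neg (Nat.not_lt_zero _), AlgHom.id_apply]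

theorem exists_truncate_sub (j : Fin n) (f : SkewPoly k n) :
    ∃ c, truncate k n j f - truncate k n (j + 1) f = c * x k n j := by
  have hf : f ∈ Algebra.adjoin k (Set.range (x k n)) := by rw [adjoin_range_x]; trivial
  obtain ⟨θ, hθ, hx⟩ := exists_normalizing k n j
  induction hf using Algebra.adjoin_induction with
  | mem f hf =>
    obtain ⟨i, rfl⟩ := hf
    rw [truncate_x, truncate_x]
    rcases lt_trichotomy (i : ℕ) j with h | h | h
    · exact ⟨0, by rw [if_pos h, if_pos (h.trans (Nat.lt_succ_self _)), sub_zero, zero_mul]⟩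
    · refine ⟨1, ?_⟩
      rw [if_neg h.not_lt, if_pos (by omega), Fin.ext h, sub_zero, one_mul]
    · exact ⟨0, by rw [if_neg h.not_gt, if_neg (by omega), sub_self, zero_mul]⟩
  | algebraMap r => exact ⟨0, by rw [AlgHom.commutes, AlgHom.commutes, sub_self, zero_mul]⟩
  | add f g _ _ hf hg =>
    obtain ⟨c, hc⟩ := hf
    obtain ⟨d, hd⟩ := hg
    exact ⟨c + d, by rw [map_add, map_add, add_sub_add_comm, hc, hd, add_mul]⟩
  | mul f g _ _ hf hg =>
    obtain ⟨c, hc⟩ := hf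
    obtain ⟨d, hd⟩ := hg
    refine ⟨c * θ (truncate k n j g) + truncate k n (j + 1) f * d, ?_⟩
    have h : truncate k n j (f * g) - truncate k n (j + 1) (f * g) =
        (truncate k n j f - truncate k n (j + 1) f) * truncate k n j g +
        truncate k n (j + 1) f * (truncate k n j g - truncate k n (j + 1) g) := by
      rw [map_mul, map_mul]; noncomm_ring
    rw [h, hc, hd, mul_assoc c, hx, add_mul, mul_assoc, mul_assoc]

/-- The kernel of the passage from `x_j, x_{j+1}, …` to `x_{j+1}, …` is generated by `x_j`, as a left
and, by the next lemma, as a right ideal. -/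
theorem truncate_succ_eq_zero_iff (j : Fin n) (f : SkewPoly k n) :
    truncate k n (j + 1) f = 0 ↔ ∃ c, truncate k n j f = c * x k n j := by
  constructor
  · intro h
    obtain ⟨c, hc⟩ := exists_truncate_sub k n j f
    exact ⟨c, by rw [← hc, h, sub_zero]⟩
  · rintro ⟨c, hc⟩
    rw [← truncate_truncate k n (Nat.le_succ (j : ℕ)) f, hc, map_mul, truncate_x,
      if_pos (Nat.lt_succ_self _), mul_zero]

theorem truncate_succ_eq_zero_iff' (j : Fin n) (f : SkewPoly k n) :
    truncate k n (j + 1) f = 0 ↔ ∃ c, truncate k n j f = x k n j * c := by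
  obtain ⟨θ, hθ, hx⟩ := exists_normalizing k n j
  rw [truncate_succ_eq_zero_iff]
  constructor
  · rintro ⟨c, hc⟩
    exact ⟨θ c, by rw [hc, hx, hθ]⟩
  · rintro ⟨c, hc⟩
    exact ⟨θ c, by rw [hc, hx]⟩

end SkewPoly

/-! ### The regular sequence `p₁, …, pₙ, y₁, …, yₙ` -/

theorem IsSkewRegularSequence.map {k : Type u} [Field k] {A A' : Type u} [Ring A] [Algebra k A]
    [Ring A'] [Algebra k A'] {z : ℕ → A} {I : ℕ → Submodule A A} {N : ℕ}
    (hz : IsSkewRegularSequence z I N) (e : A ≃ₐ[k] A') :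
    IsSkewRegularSequence (fun i => e (z i)) (fun i => Ideal.comap e.symm (I i)) N where
  bot := by
    rw [hz.bot]
    ext x
    simp [Ideal.mem_comap]
  mul_mem i hi x hx a := by
    rw [Ideal.mem_comap, map_mul]
    exact hz.mul_mem i hi _ hx _
  right_regular i hi a ha := by
    rw [Ideal.mem_comap, map_mul, AlgEquiv.symm_apply_apply] at ha
    exact hz.right_regular i hi _ ha
  left_regular i hi a ha := by
    rw [Ideal.mem_comap, map_mul, AlgEquiv.symm_apply_apply] at ha
    exact hz.left_regular i hi _ ha
  mem_succ_iff i hi x := by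
    simp_rw [Ideal.mem_comap, map_sub, map_mul, AlgEquiv.symm_apply_apply]
    rw [← e.symm.surjective.exists (p := fun a => e.symm x - a * z i ∈ I i)]
    exact hz.mem_succ_iff i hi _
  mem_succ_iff' i hi x := by
    simp_rw [Ideal.mem_comap, map_sub, map_mul, AlgEquiv.symm_apply_apply]
    rw [← e.symm.surjective.exists (p := fun a => e.symm x - z i * a ∈ I i)]
    exact hz.mem_succ_iff' i hi _
  comm i l h hl := by
    simp_rw [Ideal.mem_comap, map_sub, map_add, map_mul, AlgEquiv.symm_apply_apply]
    exact hz.comm i l h hl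

theorem IsConnectedGraded.map {k : Type u} [Field k] {A A' : Type u} [Ring A] [Algebra k A]
    [Ring A'] [Algebra k A'] {𝒜 : ℕ → Submodule k A} (h𝒜 : IsConnectedGraded k 𝒜)
    (e : A ≃ₐ[k] A') : IsConnectedGraded k fun d => (𝒜 d).map e.toLinearMap where
  nontrivial := by
    have := h𝒜.nontrivial
    exact e.symm.toEquiv.nontrivial
  graded := by
    obtain ⟨hg⟩ := h𝒜.graded
    refine nonempty_gradedAlgebra
      { one_mem := ⟨1, SetLike.GradedOne.one_mem, map_one e⟩, mul_mem := ?_ } ?_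
    · rintro i j _ _ ⟨a, ha, rfl⟩ ⟨b, hb, rfl⟩
      exact ⟨a * b, SetLike.GradedMul.mul_mem ha hb, map_mul e a b⟩
    · refine isInternal_of_projections _ (fun d => (e.toLinearMap.toAddMonoidHom.comp
        (GradedRing.proj 𝒜 d)).comp e.symm.toLinearMap.toAddMonoidHom) ?_ ?_ ?_
      · rintro d _ ⟨a, ha, rfl⟩
        change e (GradedRing.proj 𝒜 d (e.symm (e a))) = e a
        rw [e.symm_apply_apply, GradedRing.proj_apply, DirectSum.decompose_of_mem_same _ ha]
      · rintro d d' h _ ⟨a, ha, rfl⟩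
        change e (GradedRing.proj 𝒜 d (e.symm (e a))) = 0
        rw [e.symm_apply_apply, GradedRing.proj_apply, DirectSum.decompose_of_mem_ne _ ha h.symm,
          map_zero]
      · intro P hP x
        obtain ⟨a, rfl⟩ := e.surjective x
        classical
        rw [← DirectSum.sum_support_decompose 𝒜 a, map_sum]
        exact sum_mem fun d _ => hP d _ ⟨_, Subtype.prop _, rfl⟩
  zero_eq := by
    rw [h𝒜.zero_eq, Submodule.one_eq_span, Submodule.one_eq_span, Submodule.map_span,
      Set.image_singleton]
    congr 2
    exact map_one e

theorem augmentationIdeal_map {k : Type u} [Field k] {A A' : Type u} [Ring A] [Algebra k A]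
    [Ring A'] [Algebra k A'] (𝒜 : ℕ → Submodule k A) (e : A ≃ₐ[k] A') :
    augmentationIdeal (fun d => (𝒜 d).map e.toLinearMap) =
      Ideal.comap e.symm (augmentationIdeal 𝒜) := by
  refine le_antisymm (Submodule.span_le.2 ?_) ?_
  · rintro _ ⟨i, hi, a, ha, rfl⟩
    change e.symm (e a) ∈ augmentationIdeal 𝒜
    rw [e.symm_apply_apply]
    exact Submodule.subset_span ⟨i, hi, ha⟩
  · intro x hx
    obtain ⟨a, rfl⟩ := e.surjective x
    rw [Ideal.mem_comap, e.symm_apply_apply] at hx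
    induction hx using Submodule.span_induction with
    | mem a ha =>
      obtain ⟨i, hi, ha⟩ := ha
      exact Submodule.subset_span ⟨i, hi, a, ha, rfl⟩
    | zero => rw [map_zero]; exact zero_mem _
    | add a b _ _ ha hb => rw [map_add]; exact add_mem ha hb
    | smul r a _ ha => rw [smul_eq_mul, map_mul]; exact Submodule.smul_mem _ _ ha

namespace CoverAlgebra

variable (k : Type u) [Field k] (n : ℕ)

/-- The polynomials `a_{2m}` with `m ≠ 0` have no constant term, so the relations of `B` become
`y_j y_i = - y_i y_j` modulo the `p_i`. -/
theorem aeval_zero_a {m : ℕ} (hm : m ≠ 0) : MvPolynomial.aeval (0 : Fin n → k) (a k n m) = 0 := by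
  have h : (MvPolynomial.aeval (0 : Fin n → k)).comp (esymmHom k n) =
      MvPolynomial.aeval (0 : Fin n → k) := by
    refine MvPolynomial.algHom_ext fun i => ?_
    rw [AlgHom.comp_apply, esymmHom, MvPolynomial.aeval_X, MvPolynomial.aeval_X,
      MvPolynomial.esymm, map_sum]
    refine Finset.sum_eq_zero fun t ht => ?_
    have ht0 : t.Nonempty := Finset.card_pos.1 (by rw [(Finset.mem_powersetCard.1 ht).2]; omega)
    obtain ⟨l, hl⟩ := ht0
    rw [map_prod]
    exact Finset.prod_eq_zero hl (MvPolynomial.aeval_X _ _)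
  rw [← h, AlgHom.comp_apply, esymmHom_a, MvPolynomial.psum, map_sum]
  refine Finset.sum_eq_zero fun i _ => ?_
  rw [map_pow, MvPolynomial.aeval_X, Pi.zero_apply, zero_pow hm]

theorem exists_toSkewPoly : ∃ π : CoverAlgebra k n →ₐ[k] SkewPoly k n,
    (∀ q, π (algebraMap (MvPolynomial (Fin n) k) _ q) =
      algebraMap k _ (MvPolynomial.constantCoeff q)) ∧
    ∀ i, π (y k n i) = SkewPoly.x k n i := by
  obtain ⟨π, h1, h2⟩ := exists_lift (k := k)
    ((Algebra.ofId k (SkewPoly k n)).comp (MvPolynomial.aeval (0 : Fin n → k)))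
    (fun q d => Algebra.commutes (MvPolynomial.aeval (0 : Fin n → k) q) d) (SkewPoly.x k n)
    fun i j h => by
      rw [AlgHom.comp_apply, map_mul, aeval_zero_a k n (Nat.succ_ne_zero _), mul_zero, map_zero,
        add_zero, SkewPoly.x_anticomm k n j i h.ne']
  refine ⟨π, fun q => (h1 q).trans ?_, h2⟩
  rw [AlgHom.comp_apply]
  exact congrArg (algebraMap k (SkewPoly k n)) (by simp)

/-- The quotient map `p_i ↦ 0`, `y_i ↦ x_i` onto the skew polynomial ring. -/
noncomputable def toSkewPoly : CoverAlgebra k n →ₐ[k] SkewPoly k n :=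
  (exists_toSkewPoly k n).choose

theorem toSkewPoly_algebraMap (q : MvPolynomial (Fin n) k) : toSkewPoly k n (algebraMap _ _ q) =
    algebraMap k _ (MvPolynomial.constantCoeff q) :=
  (exists_toSkewPoly k n).choose_spec.1 q

theorem toSkewPoly_y (i : Fin n) : toSkewPoly k n (y k n i) = SkewPoly.x k n i :=
  (exists_toSkewPoly k n).choose_spec.2 i

theorem toSkewPoly_p (i : Fin n) : toSkewPoly k n (p k n i) = 0 := by
  rw [p, toSkewPoly_algebraMap, MvPolynomial.constantCoeff_X, map_zero]

theorem toSkewPoly_surjective : Function.Surjective (toSkewPoly k n) := by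
  rw [← AlgHom.range_eq_top, eq_top_iff, ← SkewPoly.adjoin_range_x]
  refine Algebra.adjoin_le ?_
  rintro _ ⟨i, rfl⟩
  exact ⟨y k n i, toSkewPoly_y k n i⟩

/-- Passage to the skew polynomial ring takes the constant terms of the coordinates. -/
theorem repr_toSkewPoly (b : CoverAlgebra k n) (α : Fin n → ℕ) :
    (SkewPoly.basis k n).repr (toSkewPoly k n b) α =
      MvPolynomial.constantCoeff ((basis k n).repr b α) := by
  induction (basis k n).mem_span b using Submodule.span_induction with
  | zero => simp
  | mem b hb =>
    obtain ⟨β, rfl⟩ := hb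
    have h : toSkewPoly k n (basis k n β) = SkewPoly.basis k n β := by
      rw [basis_apply, SkewPoly.basis_apply, orderedMonomial, orderedMonomial, map_list_prod,
        List.map_map]
      congr 2
      ext i
      rw [Function.comp_apply, map_pow, toSkewPoly_y]
    rw [h, Module.Basis.repr_self, Module.Basis.repr_self]
    by_cases hβ : β = α
    · rw [hβ, Finsupp.single_eq_same, Finsupp.single_eq_same, map_one]
    · rw [Finsupp.single_eq_of_ne (Ne.symm hβ), Finsupp.single_eq_of_ne (Ne.symm hβ), map_zero]
  | add b c _ _ hb hc =>
    rw [map_add (toSkewPoly k n), map_add (SkewPoly.basis k n).repr, Finsupp.add_apply, hb, hc,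
      map_add (basis k n).repr, Finsupp.add_apply, map_add]
  | smul q b _ hb =>
    rw [Algebra.smul_def, map_mul, toSkewPoly_algebraMap, ← Algebra.smul_def,
      map_smul (SkewPoly.basis k n).repr, Finsupp.smul_apply, hb, ← Algebra.smul_def, map_smul,
      Finsupp.smul_apply, smul_eq_mul, smul_eq_mul, map_mul]

/-- The two-sided ideal generated by `p₁, …, p_i`, as a left ideal. -/
def pIdeal (i : ℕ) : Ideal (CoverAlgebra k n) where
  carrier := (varIdeal k {l : Fin n | (l : ℕ) < i} •
    (⊤ : Submodule (MvPolynomial (Fin n) k) (CoverAlgebra k n)) : Submodule _ _)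
  zero_mem' := Submodule.zero_mem _
  add_mem' := fun ha hb => Submodule.add_mem _ ha hb
  smul_mem' := fun c _ hx => mul_mem_smul_top' _ hx c

theorem mem_pIdeal {i : ℕ} {b : CoverAlgebra k n} : b ∈ pIdeal k n i ↔
    b ∈ varIdeal k {l : Fin n | (l : ℕ) < i} •
      (⊤ : Submodule (MvPolynomial (Fin n) k) (CoverAlgebra k n)) := Iff.rfl

/-- The two-sided ideal generated by `p₁, …, pₙ` and `y₁, …, y_j`, as the kernel of the quotient map
to the skew polynomial ring without its first `j` variables. -/
noncomputable def yIdeal (j : ℕ) : Ideal (CoverAlgebra k n) :=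
  RingHom.ker ((SkewPoly.truncate k n j).comp (toSkewPoly k n))

theorem mem_yIdeal {j : ℕ} {b : CoverAlgebra k n} : b ∈ yIdeal k n j ↔
    SkewPoly.truncate k n j (toSkewPoly k n b) = 0 := Iff.rfl

theorem pIdeal_eq_yIdeal : pIdeal k n n = yIdeal k n 0 := by
  ext b
  rw [mem_pIdeal, mem_yIdeal, SkewPoly.truncate_zero, AlgHom.id_apply,
    (basis k n).mem_smul_top_iff, ← (SkewPoly.basis k n).forall_coord_eq_zero_iff]
  refine forall_congr' fun α => ?_
  rw [Module.Basis.coord_apply, repr_toSkewPoly, varIdeal, MvPolynomial.mem_ideal_span_X_image,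
    MvPolynomial.constantCoeff_eq]
  constructor
  · intro h
    by_contra h0
    obtain ⟨l, -, hl⟩ := h 0 (MvPolynomial.mem_support_iff.2 h0)
    exact hl rfl
  · intro h m hm
    by_contra! hl
    have hm0 : m = 0 := Finsupp.ext fun l => hl l l.2
    rw [hm0] at hm
    exact MvPolynomial.mem_support_iff.1 hm h

/-- The sequence `p₁, …, pₙ, y₁, …, yₙ`, continued by zeros. -/
noncomputable def regularSequence (i : ℕ) : CoverAlgebra k n :=
  if h : i < n then p k n ⟨i, h⟩ else if h : i - n < n then y k n ⟨i - n, h⟩ else 0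

/-- The ideal generated by the first `i` elements of `p₁, …, pₙ, y₁, …, yₙ`. -/
noncomputable def regularIdeal (i : ℕ) : Ideal (CoverAlgebra k n) :=
  if i ≤ n then pIdeal k n i else yIdeal k n (i - n)

theorem regularSequence_p (i : Fin n) : regularSequence k n i = p k n i :=
  dif_pos i.2

theorem regularSequence_y (i : Fin n) : regularSequence k n (n + i) = y k n i := by
  rw [regularSequence, dif_neg (by omega), dif_pos (by omega)]
  congr 1
  exact Fin.ext (Nat.add_sub_cancel_left _ _)

theorem regularIdeal_of_le {i : ℕ} (h : i ≤ n) : regularIdeal k n i = pIdeal k n i := if_pos h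

theorem regularIdeal_add (j : ℕ) : regularIdeal k n (n + j) = yIdeal k n j := by
  cases j with
  | zero => rw [add_zero, regularIdeal_of_le k n le_rfl, pIdeal_eq_yIdeal]
  | succ j => rw [regularIdeal, if_neg (by omega), Nat.add_sub_cancel_left]

theorem p_central (i : Fin n) (b : CoverAlgebra k n) : p k n i * b = b * p k n i :=
  Algebra.commutes _ b

theorem mem_pIdeal_of_p_mul_mem {i : Fin n} {b : CoverAlgebra k n}
    (h : p k n i * b ∈ pIdeal k n i) : b ∈ pIdeal k n i := by
  rw [mem_pIdeal, p, ← Algebra.smul_def] at h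
  exact mem_smul_top_of_X_smul_mem (basis k n) (by simp) h

theorem mem_pIdeal_succ_iff (i : Fin n) (b : CoverAlgebra k n) :
    b ∈ pIdeal k n (i + 1) ↔ ∃ c, b - p k n i * c ∈ pIdeal k n i := by
  have hs : {l : Fin n | (l : ℕ) < i + 1} = {l : Fin n | (l : ℕ) < i} ∪ {i} := by
    ext l
    rw [Set.mem_union, Set.mem_singleton_iff, Set.mem_ofPred_eq, Set.mem_ofPred_eq,
      Nat.lt_succ_iff_lt_or_eq, Fin.ext_iff]
  rw [mem_pIdeal, hs, varIdeal, Set.image_union, Set.image_singleton, Ideal.span_union,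
    Submodule.sup_smul, Submodule.mem_sup]
  simp_rw [Submodule.ideal_span_singleton_smul, Submodule.mem_smul_pointwise_iff_exists]
  constructor
  · rintro ⟨c, hc, _, ⟨d, -, rfl⟩, rfl⟩
    refine ⟨d, ?_⟩
    rw [p, ← Algebra.smul_def, add_sub_cancel_right]
    exact hc
  · rintro ⟨d, hd⟩
    refine ⟨_, hd, _, ⟨d, trivial, rfl⟩, ?_⟩
    rw [p, ← Algebra.smul_def, sub_add_cancel]

theorem mem_yIdeal_succ_iff (j : Fin n) (b : CoverAlgebra k n) :
    b ∈ yIdeal k n (j + 1) ↔ ∃ c, b - c * y k n j ∈ yIdeal k n j := by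
  simp_rw [mem_yIdeal, map_sub, map_mul, toSkewPoly_y, SkewPoly.truncate_x, if_neg (lt_irrefl _),
    sub_eq_zero, SkewPoly.truncate_succ_eq_zero_iff]
  constructor
  · rintro ⟨c, hc⟩
    obtain ⟨d, rfl⟩ := toSkewPoly_surjective k n c
    refine ⟨d, ?_⟩
    have h := congrArg (SkewPoly.truncate k n j) hc
    rwa [SkewPoly.truncate_truncate k n le_rfl, map_mul, SkewPoly.truncate_x,
      if_neg (lt_irrefl _)] at h
  · rintro ⟨c, hc⟩
    exact ⟨_, hc⟩

theorem mem_yIdeal_succ_iff' (j : Fin n) (b : CoverAlgebra k n) :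
    b ∈ yIdeal k n (j + 1) ↔ ∃ c, b - y k n j * c ∈ yIdeal k n j := by
  simp_rw [mem_yIdeal, map_sub, map_mul, toSkewPoly_y, SkewPoly.truncate_x, if_neg (lt_irrefl _),
    sub_eq_zero, SkewPoly.truncate_succ_eq_zero_iff']
  constructor
  · rintro ⟨c, hc⟩
    obtain ⟨d, rfl⟩ := toSkewPoly_surjective k n c
    refine ⟨d, ?_⟩
    have h := congrArg (SkewPoly.truncate k n j) hc
    rwa [SkewPoly.truncate_truncate k n le_rfl, map_mul, SkewPoly.truncate_x,
      if_neg (lt_irrefl _)] at h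
  · rintro ⟨c, hc⟩
    exact ⟨_, hc⟩

theorem exists_index {i : ℕ} (h : i < 2 * n) :
    (∃ j : Fin n, i = j) ∨ ∃ j : Fin n, i = n + j := by
  rcases lt_or_ge i n with hi | hi
  · exact Or.inl ⟨⟨i, hi⟩, rfl⟩
  · exact Or.inr ⟨⟨i - n, by omega⟩, (Nat.add_sub_cancel' hi).symm⟩

/-- The `p_i` are central and regular because `B` is free over `k[p₁, …, pₙ]`; modulo them, `B` is the
skew polynomial ring, in which the variables form a regular sequence of elements that anticommute. -/
theorem isSkewRegularSequence :
    IsSkewRegularSequence (regularSequence k n) (regularIdeal k n) (2 * n) where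
  bot := by
    rw [regularIdeal_of_le k n (Nat.zero_le _), eq_bot_iff]
    intro b hb
    rw [mem_pIdeal, varIdeal] at hb
    simpa using hb
  mul_mem i hi x hx c := by
    rcases le_total i n with h | h
    · rw [regularIdeal_of_le k n h] at hx ⊢
      exact mul_mem_smul_top _ hx c
    · obtain ⟨j, rfl⟩ := Nat.exists_eq_add_of_le h
      rw [regularIdeal_add, mem_yIdeal] at hx ⊢
      rw [map_mul, map_mul, hx, zero_mul]
  right_regular i hi c hc := by
    rcases exists_index n hi with ⟨j, rfl⟩ | ⟨j, rfl⟩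
    · rw [regularIdeal_of_le k n j.2.le] at hc ⊢
      rw [regularSequence_p, ← p_central] at hc
      exact mem_pIdeal_of_p_mul_mem k n hc
    · rw [regularIdeal_add, mem_yIdeal] at hc ⊢
      rw [regularSequence_y, map_mul, map_mul, toSkewPoly_y, SkewPoly.truncate_x,
        if_neg (lt_irrefl _)] at hc
      exact SkewPoly.eq_zero_of_mul_x k n hc
  left_regular i hi c hc := by
    rcases exists_index n hi with ⟨j, rfl⟩ | ⟨j, rfl⟩
    · rw [regularIdeal_of_le k n j.2.le] at hc ⊢
      rw [regularSequence_p] at hc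
      exact mem_pIdeal_of_p_mul_mem k n hc
    · rw [regularIdeal_add, mem_yIdeal] at hc ⊢
      rw [regularSequence_y, map_mul, map_mul, toSkewPoly_y, SkewPoly.truncate_x,
        if_neg (lt_irrefl _)] at hc
      exact SkewPoly.eq_zero_of_x_mul k n hc
  mem_succ_iff i hi b := by
    rcases exists_index n hi with ⟨j, rfl⟩ | ⟨j, rfl⟩
    · rw [regularIdeal_of_le k n j.2.le, regularIdeal_of_le k n j.2, regularSequence_p]
      simp_rw [← p_central]
      exact mem_pIdeal_succ_iff k n j b
    · rw [add_assoc, regularIdeal_add, regularIdeal_add, regularSequence_y]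
      exact mem_yIdeal_succ_iff k n j b
  mem_succ_iff' i hi b := by
    rcases exists_index n hi with ⟨j, rfl⟩ | ⟨j, rfl⟩
    · rw [regularIdeal_of_le k n j.2.le, regularIdeal_of_le k n j.2, regularSequence_p]
      exact mem_pIdeal_succ_iff k n j b
    · rw [add_assoc, regularIdeal_add, regularIdeal_add, regularSequence_y]
      exact mem_yIdeal_succ_iff' k n j b
  comm i l h hl := by
    rcases exists_index n (h.trans hl) with ⟨j, rfl⟩ | ⟨j, rfl⟩
    · left
      rw [regularSequence_p, p_central, sub_self]
      exact zero_mem _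
    · right
      obtain ⟨m, rfl⟩ : ∃ m : Fin n, l = n + m := by
        rcases exists_index n hl with ⟨m, rfl⟩ | h
        · omega
        · exact h
      have hjm : j ≠ m := fun e => by rw [e] at h; exact lt_irrefl _ h
      rw [regularIdeal_add, mem_yIdeal, regularSequence_y, regularSequence_y, map_add, map_mul,
        map_mul, toSkewPoly_y, toSkewPoly_y, SkewPoly.x_anticomm k n j m hjm, neg_add_cancel,
        map_zero]

theorem regularIdeal_two_mul :
    regularIdeal k n (2 * n) = augmentationIdeal (grading k n) := by
  rw [two_mul, regularIdeal_add]
  have hgen : ∀ i, SkewPoly.truncate k n n (toSkewPoly k n (Sum.elim (p k n) (y k n) i)) = 0 := by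
    rintro (i | i)
    · rw [Sum.elim_inl, toSkewPoly_p, map_zero]
    · rw [Sum.elim_inr, toSkewPoly_y, SkewPoly.truncate_x, if_pos i.2]
  have hle : augmentationIdeal (grading k n) ≤ yIdeal k n n := by
    refine Submodule.span_le.2 ?_
    rintro b ⟨d, hd, hb⟩
    induction hb using Submodule.span_induction with
    | mem b hb =>
      obtain ⟨l, rfl, rfl⟩ := hb
      cases l with
      | nil => simp at hd
      | cons i l =>
        rw [SetLike.mem_coe, mem_yIdeal, List.map_cons, List.prod_cons, map_mul, map_mul, hgen,
          zero_mul]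
    | zero => exact zero_mem _
    | add b c _ _ hb hc => exact add_mem hb hc
    | smul r b _ hb =>
      rw [SetLike.mem_coe, mem_yIdeal] at hb ⊢
      rw [map_smul, map_smul, hb, smul_zero]
  refine le_antisymm (fun b hb => ?_) hle
  -- Conversely, `b` is congruent to a scalar `c` modulo the augmentation ideal, and `c` is the image
  -- of `b` in `k`.
  let P : AddSubgroup (CoverAlgebra k n) :=
    { carrier := {b | ∃ c : k, b - algebraMap k _ c ∈ augmentationIdeal (grading k n)}
      zero_mem' := ⟨0, by simp⟩
      add_mem' := by
        rintro b b' ⟨c, hc⟩ ⟨c', hc'⟩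
        refine ⟨c + c', ?_⟩
        rw [map_add, add_sub_add_comm]
        exact add_mem hc hc'
      neg_mem' := by
        rintro b ⟨c, hc⟩
        refine ⟨-c, ?_⟩
        rw [map_neg, neg_sub_neg, ← neg_sub]
        exact neg_mem hc }
  obtain ⟨c, hc⟩ : b ∈ P := by
    refine wordGrading_induction _ (weight n) (adjoin_generators k n) P (fun d b hb => ?_) b
    rcases Nat.eq_zero_or_pos d with rfl | hd
    · have hb' : b ∈ (1 : Submodule k (CoverAlgebra k n)) := by
        rw [← (isConnectedGraded k n).zero_eq]
        exact hb
      obtain ⟨c, rfl⟩ := Submodule.mem_one.1 hb'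
      exact ⟨c, by rw [sub_self]; exact zero_mem _⟩
    · exact ⟨0, by rw [map_zero, sub_zero]; exact Submodule.subset_span ⟨d, hd, hb⟩⟩
  have h := hle hc
  rw [mem_yIdeal] at h hb
  rw [map_sub, map_sub, hb, AlgHom.commutes, AlgHom.commutes, zero_sub, neg_eq_zero,
    FaithfulSMul.algebraMap_eq_zero_iff] at h
  rwa [h, map_zero, sub_zero] at hc

/-- The degrees of `p₁, …, pₙ, y₁, …, yₙ`. -/
def regularWeight (i : ℕ) : ℕ := if i < n then 2 * (i + 1) else 2 * (i - n) + 1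

theorem regularSequence_mem {i : ℕ} (hi : i < 2 * n) :
    regularSequence k n i ∈ grading k n (regularWeight n i) := by
  rcases exists_index n hi with ⟨j, rfl⟩ | ⟨j, rfl⟩
  · rw [regularSequence_p, regularWeight, if_pos j.2]
    exact p_mem_grading k n j
  · rw [regularSequence_y, regularWeight, if_neg (by omega), Nat.add_sub_cancel_left]
    exact y_mem_grading k n j

/-- The right-hand conditions follow from the left-hand ones, as `B` is isomorphic to its opposite
ring. -/
theorem isASRegular : IsASRegular k (grading k n) (2 * n) where
  connected := isConnectedGraded k n
  regular := by
    refine ⟨∑ j ∈ Finset.range (2 * n), (regularWeight n j : ℤ), ?_, ?_⟩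
    · exact (isSkewRegularSequence k n).isLeftASRegular _ (isConnectedGraded k n) _
        (fun j hj => regularSequence_mem k n hj) (regularIdeal_two_mul k n)
        (hasInjectiveDimensionLT k n)
    · obtain ⟨e, hp, hy⟩ := exists_opEquiv k n
      have he : opGrading (grading k n) = fun d => (grading k n d).map e.toLinearMap :=
        funext fun d => (opEquiv_grading k n hp hy d).symm
      rw [he]
      refine ((isSkewRegularSequence k n).map e).isLeftASRegular _ ((isConnectedGraded k n).map e)
        _ (fun j hj => ⟨_, regularSequence_mem k n hj, rfl⟩) ?_
        (hasInjectiveDimensionLT_mulOpposite k n)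
      rw [augmentationIdeal_map, regularIdeal_two_mul]
  gkDimension_lt := gkDimension_lt_top k n

end CoverAlgebra

/-! ### Quotients by two-sided ideals, and the central regular sequence `r₁, …, rₙ` -/

section QuotientBy

variable {k : Type u} [Field k] {A : Type v} [Ring A] [Algebra k A]

theorem quotientMap_surjective (s : Set A) : Function.Surjective (quotientMap k s) :=
  RingCon.mkₐ_surjective _

theorem quotientMap_eq_zero_iff (s : Set A) (a : A) :
    quotientMap k s a = 0 ↔ a ∈ TwoSidedIdeal.span s := by
  rw [TwoSidedIdeal.mem_iff, ← RingCon.eq]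
  rfl

theorem isRegular_quotientMap_of_central (s : Set A) {z : A} (hz : ∀ a, z * a = a * z)
    (h : ∀ a, z * a ∈ TwoSidedIdeal.span s → a ∈ TwoSidedIdeal.span s) :
    IsRegular (quotientMap k s z) := by
  have key : ∀ a b : A, quotientMap k s (z * a) = quotientMap k s (z * b) →
      quotientMap k s a = quotientMap k s b := by
    intro a b hab
    rw [← sub_eq_zero, ← map_sub, quotientMap_eq_zero_iff] at hab ⊢
    rw [← mul_sub] at hab
    exact h _ hab
  constructor
  · intro x y hxy
    obtain ⟨a, rfl⟩ := quotientMap_surjective (k := k) s x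
    obtain ⟨b, rfl⟩ := quotientMap_surjective (k := k) s y
    refine key a b ?_
    rw [map_mul, map_mul]
    exact hxy
  · intro x y hxy
    obtain ⟨a, rfl⟩ := quotientMap_surjective (k := k) s x
    obtain ⟨b, rfl⟩ := quotientMap_surjective (k := k) s y
    refine key a b ?_
    rw [hz, hz, map_mul, map_mul]
    exact hxy

theorem isNormalElement_quotientMap_of_central (s : Set A) {z : A} (hz : ∀ a, z * a = a * z) :
    IsNormalElement (quotientMap k s z) := by
  have key : ∀ x, quotientMap k s z * x = x * quotientMap k s z := by
    intro x
    obtain ⟨a, rfl⟩ := quotientMap_surjective (k := k) s x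
    rw [← map_mul, hz, map_mul]
  exact ⟨fun x => ⟨x, key x⟩, fun x => ⟨x, (key x).symm⟩⟩

theorem exists_quotientEquiv {A' : Type*} [Ring A'] [Algebra k A'] (s : Set A) (φ : A →ₐ[k] A')
    (hφ : Function.Surjective φ) (hker : ∀ a, φ a = 0 ↔ a ∈ TwoSidedIdeal.span s) :
    ∃ e : QuotientBy s ≃ₐ[k] A', ∀ a, e (quotientMap k s a) = φ a := by
  let f : QuotientBy s →ₐ[k] A' := RingCon.liftₐ _ φ fun a b hab => by
    rw [TwoSidedIdeal.rel_iff, ← hker, map_sub, sub_eq_zero] at hab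
    exact hab
  have hf : ∀ a, f (quotientMap k s a) = φ a := fun a => rfl
  refine ⟨AlgEquiv.ofBijective f ⟨?_, fun x => ?_⟩, hf⟩
  · rw [injective_iff_map_eq_zero]
    intro x hx
    obtain ⟨a, rfl⟩ := quotientMap_surjective (k := k) s x
    rwa [hf, hker, ← quotientMap_eq_zero_iff (k := k)] at hx
  · obtain ⟨a, rfl⟩ := hφ x
    exact ⟨_, hf a⟩

/-- In an algebra `A` over a polynomial ring, the two-sided ideal generated by the images of some of
the variables is `J A`, where `J` is the ideal generated by these variables. -/
theorem mem_span_algebraMap_X_iff {n : ℕ} {F : Type*} [CommRing F]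
    [Algebra (MvPolynomial (Fin n) F) A] (s : Set (Fin n)) (a : A) :
    a ∈ TwoSidedIdeal.span
      ((fun i => algebraMap (MvPolynomial (Fin n) F) A (MvPolynomial.X i)) '' s) ↔
    a ∈ varIdeal F s • (⊤ : Submodule (MvPolynomial (Fin n) F) A) := by
  constructor
  · intro ha
    let J : TwoSidedIdeal A := TwoSidedIdeal.mk'
      (varIdeal F s • (⊤ : Submodule (MvPolynomial (Fin n) F) A) : Submodule _ _)
      (zero_mem _) (fun h h' => add_mem h h') (fun h => neg_mem h)
      (fun h => mul_mem_smul_top' _ h _) (fun h => mul_mem_smul_top _ h _)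
    have hJ : ∀ a, a ∈ J ↔ a ∈ varIdeal F s • (⊤ : Submodule (MvPolynomial (Fin n) F) A) :=
      fun a => TwoSidedIdeal.mem_mk' _ _ _ _ _ _ a
    rw [← hJ]
    refine TwoSidedIdeal.span_le.2 ?_ ha
    rintro _ ⟨i, hi, rfl⟩
    rw [SetLike.mem_coe, hJ]
    beta_reduce
    rw [Algebra.algebraMap_eq_smul_one]
    exact Submodule.smul_mem_smul (Ideal.subset_span ⟨i, hi, rfl⟩) trivial
  · intro ha
    refine Submodule.smul_induction_on ha (fun q hq m _ => ?_) fun a b ha hb =>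
      TwoSidedIdeal.add_mem _ ha hb
    rw [varIdeal] at hq
    induction hq using Submodule.span_induction with
    | mem q hq =>
      obtain ⟨i, hi, rfl⟩ := hq
      rw [Algebra.smul_def]
      exact TwoSidedIdeal.mul_mem_right _ _ _ (TwoSidedIdeal.subset_span ⟨i, hi, rfl⟩)
    | zero => rw [zero_smul]; exact TwoSidedIdeal.zero_mem _
    | add q q' _ _ hq hq' => rw [add_smul]; exact TwoSidedIdeal.add_mem _ hq hq'
    | smul r q _ hq =>
      rw [smul_assoc, Algebra.smul_def]
      exact TwoSidedIdeal.mul_mem_left _ _ _ hq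

end QuotientBy

namespace CoverAlgebra

variable (k : Type u) [Field k] (n : ℕ)

theorem mem_span_r_iff (s : Set (Fin n)) (b : CoverAlgebra k n) :
    b ∈ TwoSidedIdeal.span (r k n '' s) ↔ b ∈ varIdeal (MvPolynomial (Fin n) k) s •
      (⊤ : Submodule (MvPolynomial (Fin n) (MvPolynomial (Fin n) k)) (CoverAlgebra k n)) := by
  rw [← mem_span_algebraMap_X_iff]
  simp_rw [algebraMap_X]

/-- The `r_i` act as variables on `B`, which is free over `k[p₁, …, pₙ][r₁, …, rₙ]`. -/
theorem isRegularSequence_r : IsRegularSequence k (r k n) := by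
  intro i
  obtain ⟨b, -⟩ := exists_centralBasis k n
  refine isRegular_quotientMap_of_central _ (r_central k n i) fun c hc => ?_
  rw [mem_span_r_iff] at hc ⊢
  rw [← algebraMap_X, ← Algebra.smul_def] at hc
  exact mem_smul_top_of_X_smul_mem b (by simp) hc

theorem isNormalSequence_r : IsNormalSequence k (r k n) :=
  fun i => isNormalElement_quotientMap_of_central _ (r_central k n i)

theorem r_mem_center (i : Fin n) : r k n i ∈ Subalgebra.center k (CoverAlgebra k n) :=
  Subalgebra.mem_center_iff.2 fun b => (r_central k n i b).symm

end CoverAlgebra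

/-! ### The skew polynomial ring over the polynomials in the squares of the variables -/

section PowerSums

variable (k : Type u) [Field k] (n : ℕ)

/-- Every variable is a root of `∏ (t - X j)`, whose coefficients are symmetric. -/
theorem exists_X_pow_eq_sum : ∃ c : Fin n → MvPolynomial (Fin n) k, ∀ l : Fin n,
    (MvPolynomial.X l : MvPolynomial (Fin n) k) ^ n =
      ∑ i, esymmHom k n (c i) * MvPolynomial.X l ^ (i : ℕ) := by
  refine ⟨fun i => (-1) ^ (n - 1 - (i : ℕ)) * MvPolynomial.X (Fin.rev i), fun l => ?_⟩
  have h := congrArg (Polynomial.eval (-(MvPolynomial.X l : MvPolynomial (Fin n) k)))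
    (MvPolynomial.prod_C_add_X_eq_sum_esymm k (Fin n))
  rw [Polynomial.eval_prod, Finset.prod_eq_zero (Finset.mem_univ l) (by simp),
    Polynomial.eval_finsetSum, Fintype.card_fin, Finset.sum_range_succ', eq_comm,
    add_eq_zero_iff_eq_neg] at h
  simp only [Polynomial.eval_mul, Polynomial.eval_C, Polynomial.eval_pow, Polynomial.eval_X,
    MvPolynomial.esymm_zero, one_mul, Nat.sub_zero] at h
  rw [neg_pow, Finset.sum_range] at h
  have h2 : (MvPolynomial.X l : MvPolynomial (Fin n) k) ^ n =
      -((-1) ^ n * -((-1) ^ n * MvPolynomial.X l ^ n)) := by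
    rw [mul_neg, neg_neg, ← mul_assoc, ← mul_pow, neg_one_mul, neg_neg, one_pow, one_mul]
  rw [h2, ← h, ← Equiv.sum_comp Fin.revPerm, Finset.mul_sum, ← Finset.sum_neg_distrib]
  refine Finset.sum_congr rfl fun j _ => ?_
  obtain ⟨m, hm⟩ : ∃ m, n = m + (j + 1) := ⟨n - (j + 1), by omega⟩
  have h3 : n - (m + 1) = j := by omega
  have h4 : n - 1 - (j : ℕ) = m := by omega
  have h5 : (-1 : MvPolynomial (Fin n) k) ^ n = (-1) ^ m * (-1) ^ ((j : ℕ) + 1) := by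
    rw [← pow_add, ← hm]
  have h6 : (-1 : MvPolynomial (Fin n) k) ^ (j : ℕ) * (-1) ^ (j : ℕ) = 1 := by
    rw [← mul_pow, neg_one_mul, neg_neg, one_pow]
  have h7 : ((Fin.rev j : Fin n) : ℕ) = m := by rw [Fin.val_rev]; omega
  beta_reduce
  rw [Fin.revPerm_apply, h4, map_mul, map_pow, map_neg, map_one, esymmHom, MvPolynomial.aeval_X,
    h7, h3, h5, neg_pow _ (j : ℕ), pow_succ]
  linear_combination (-1) ^ m * MvPolynomial.esymm (Fin n) k (m + 1) *
    (MvPolynomial.X l : MvPolynomial (Fin n) k) ^ (j : ℕ) * h6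

end PowerSums

namespace SkewPoly

variable (k : Type u) [Field k] (n : ℕ)

/-- The skew polynomial ring as an algebra over a polynomial ring, where `X i` acts as `x_i ^ 2`. -/
noncomputable instance algebraSquares : Algebra (MvPolynomial (Fin n) k) (SkewPoly k n) :=
  (centralAeval (R := k) (fun i => x k n i ^ 2)
    fun i d => (sq_central k n i d).symm).toRingHom.toAlgebra' (centralAeval_commute _ _)

theorem algebraMap_X (i : Fin n) :
    algebraMap (MvPolynomial (Fin n) k) (SkewPoly k n) (MvPolynomial.X i) = x k n i ^ 2 :=
  centralAeval_X _ _ i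

instance isScalarTower : IsScalarTower k (MvPolynomial (Fin n) k) (SkewPoly k n) :=
  IsScalarTower.of_algebraMap_eq fun q => ((centralAeval (R := k) (fun i => x k n i ^ 2)
    fun i d => (sq_central k n i d).symm).commutes q).symm

theorem exists_squarefreeBasis : ∃ b : Module.Basis (Fin n → Fin 2) (MvPolynomial (Fin n) k)
    (SkewPoly k n), ∀ ε, b ε = orderedMonomial (x k n) fun i => (ε i : ℕ) :=
  _root_.exists_squarefreeBasis (x k n) (sq_central k n) (basis k n) (basis_apply k n) 0
    fun i => by rw [algebraMap_X, Pi.zero_apply, map_zero, sub_zero]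

theorem algebraMap_esymm (m : ℕ) : algebraMap (MvPolynomial (Fin n) k) (SkewPoly k n)
    (MvPolynomial.esymm (Fin n) k m) = elemSquares k n m := by
  rw [MvPolynomial.esymm, map_sum, elemSquares]
  refine Finset.sum_congr rfl fun s _ => ?_
  conv_lhs => rw [← Finset.sort_toFinset s (· ≤ ·)]
  rw [List.prod_toFinset _ (Finset.sort_nodup s (· ≤ ·)), map_list_prod, List.map_map]
  congr 2
  exact funext fun i => algebraMap_X k n i

theorem algebraMap_psum (m : ℕ) : algebraMap (MvPolynomial (Fin n) k) (SkewPoly k n)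
    (MvPolynomial.psum (Fin n) k m) = powerSum k n (2 * m) := by
  rw [MvPolynomial.psum, map_sum, powerSum]
  refine Finset.sum_congr rfl fun i _ => ?_
  rw [map_pow, algebraMap_X, pow_mul]

theorem permute_algebraMap (σ : Equiv.Perm (Fin n)) (q : MvPolynomial (Fin n) k) :
    permute k n σ (algebraMap _ _ q) = algebraMap _ _ (MvPolynomial.rename σ q) := by
  have h : (permute k n σ).comp (IsScalarTower.toAlgHom k (MvPolynomial (Fin n) k) (SkewPoly k n)) =
      (IsScalarTower.toAlgHom k (MvPolynomial (Fin n) k) (SkewPoly k n)).comp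
        (MvPolynomial.rename σ) := by
    refine MvPolynomial.algHom_ext fun i => ?_
    simp only [AlgHom.comp_apply, IsScalarTower.coe_toAlgHom', MvPolynomial.rename_X]
    rw [algebraMap_X, algebraMap_X, map_pow, permute_x]
  exact AlgHom.congr_fun h q

theorem mem_invariants {f : SkewPoly k n} : f ∈ invariants k n ↔ ∀ σ, permute k n σ f = f := by
  rw [invariants, Algebra.mem_iInf]
  rfl

theorem powerSum_mem_invariants (m : ℕ) : powerSum k n m ∈ invariants k n := by
  rw [mem_invariants]
  intro σ
  rw [powerSum, map_sum, ← Equiv.sum_comp σ fun i => x k n i ^ m]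
  exact Finset.sum_congr rfl fun i _ => by rw [map_pow, permute_x]

theorem algebraMap_esymmHom_mem_invariants (q : MvPolynomial (Fin n) k) :
    algebraMap (MvPolynomial (Fin n) k) (SkewPoly k n) (esymmHom k n q) ∈ invariants k n := by
  rw [mem_invariants]
  intro σ
  rw [permute_algebraMap, esymmHom_eq]
  congr 1
  exact (MvPolynomial.esymmAlgEquiv (Fin n) k (Fintype.card_fin n) q).2 σ

/-- Odd powers of different variables anticommute. -/
theorem odd_pow_anticomm {i l : Fin n} (h : i ≠ l) {s t : ℕ} (hs : Odd s) (ht : Odd t) :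
    x k n i ^ s * x k n l ^ t = -(x k n l ^ t * x k n i ^ s) := by
  have h1 : SemiconjBy (x k n i) (x k n l) (-x k n l) := by
    rw [SemiconjBy, x_anticomm k n i l h, neg_mul]
  have h2 := h1.pow_right t
  rw [ht.neg_pow] at h2
  have h3 : SemiconjBy (x k n l ^ t) (x k n i) (-x k n i) := by
    rw [SemiconjBy, neg_mul, h2.eq, neg_mul, neg_neg]
  have h4 := h3.pow_right s
  rw [hs.neg_pow] at h4
  rw [h4.eq, neg_mul, neg_neg]

/-- The relations of the `y_i` in `B` hold for the odd power sums: the terms with different variables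
anticommute. -/
theorem powerSum_anticomm {s t : ℕ} (hs : Odd s) (ht : Odd t) :
    powerSum k n t * powerSum k n s = -(powerSum k n s * powerSum k n t) +
      2 * powerSum k n (s + t) := by
  rw [eq_neg_add_iff_add_eq, powerSum, powerSum, powerSum, Finset.sum_mul_sum,
    Finset.sum_mul_sum, Finset.sum_comm, ← Finset.sum_add_distrib, Finset.mul_sum]
  refine Finset.sum_congr rfl fun i _ => ?_
  rw [← Finset.sum_add_distrib, Finset.sum_eq_single i]
  · rw [← pow_add, ← pow_add, add_comm t s, two_mul]
  · intro l _ hl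
    rw [odd_pow_anticomm k n hl hs ht, neg_add_cancel]
  · exact fun h => absurd (Finset.mem_univ i) h

end SkewPoly

/-! ### The homomorphism from `B` to the invariants -/

namespace CoverAlgebra

variable (k : Type u) [Field k] (n : ℕ)

theorem exists_toInvariants : ∃ φ : CoverAlgebra k n →ₐ[k] SkewPoly k n,
    (∀ q, φ (algebraMap (MvPolynomial (Fin n) k) _ q) =
      algebraMap (MvPolynomial (Fin n) k) _ (esymmHom k n q)) ∧
    ∀ i : Fin n, φ (y k n i) = SkewPoly.powerSum k n (2 * i + 1) :=
  exists_lift (k := k)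
    ((IsScalarTower.toAlgHom k (MvPolynomial (Fin n) k) (SkewPoly k n)).comp (esymmHom k n))
    (fun q d => Algebra.commutes (esymmHom k n q) d)
    (fun i => SkewPoly.powerSum k n (2 * i + 1)) fun i j _ => by
      rw [SkewPoly.powerSum_anticomm k n (odd_two_mul_add_one _) (odd_two_mul_add_one _), map_mul,
        map_ofNat, AlgHom.comp_apply, esymmHom_a, IsScalarTower.coe_toAlgHom',
        SkewPoly.algebraMap_psum]
      congr 3
      ring

/-- The homomorphism `p_i ↦ ρ_i`, `y_i ↦ P_{2i-1}`. -/
noncomputable def toInvariants : CoverAlgebra k n →ₐ[k] SkewPoly k n :=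
  (exists_toInvariants k n).choose

theorem toInvariants_algebraMap (q : MvPolynomial (Fin n) k) :
    toInvariants k n (algebraMap (MvPolynomial (Fin n) k) _ q) =
      algebraMap (MvPolynomial (Fin n) k) _ (esymmHom k n q) :=
  (exists_toInvariants k n).choose_spec.1 q

theorem toInvariants_y (i : Fin n) :
    toInvariants k n (y k n i) = SkewPoly.powerSum k n (2 * i + 1) :=
  (exists_toInvariants k n).choose_spec.2 i

theorem toInvariants_p (i : Fin n) :
    toInvariants k n (p k n i) = SkewPoly.elemSquares k n (i + 1) := by
  rw [p, toInvariants_algebraMap, esymmHom, MvPolynomial.aeval_X, SkewPoly.algebraMap_esymm]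

theorem toInvariants_mem (b : CoverAlgebra k n) :
    toInvariants k n b ∈ SkewPoly.invariants k n := by
  have hb : b ∈ Algebra.adjoin (MvPolynomial (Fin n) k) (Set.range (y k n)) := by
    rw [adjoin_range_y]; trivial
  induction hb using Algebra.adjoin_induction with
  | mem b hb =>
    obtain ⟨i, rfl⟩ := hb
    rw [toInvariants_y]
    exact SkewPoly.powerSum_mem_invariants k n _
  | algebraMap q =>
    rw [toInvariants_algebraMap]
    exact SkewPoly.algebraMap_esymmHom_mem_invariants k n q
  | add a b _ _ ha hb => rw [map_add]; exact add_mem ha hb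
  | mul a b _ _ ha hb => rw [map_mul]; exact mul_mem ha hb

/-- The case `i = j` of the relations of the odd power sums, divided by `2`. -/
theorem toInvariants_r [NeZero (2 : k)] (i : Fin n) : toInvariants k n (r k n i) = 0 := by
  rw [r, map_sub, map_pow, toInvariants_y, toInvariants_algebraMap, esymmHom_a,
    SkewPoly.algebraMap_psum, sub_eq_zero]
  have h := SkewPoly.powerSum_anticomm k n (odd_two_mul_add_one (i : ℕ))
    (odd_two_mul_add_one (i : ℕ))
  rw [eq_neg_add_iff_add_eq, ← two_mul, ← sub_eq_zero, ← mul_sub] at h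
  have h2 : (2 : k) • (SkewPoly.powerSum k n (2 * i + 1) * SkewPoly.powerSum k n (2 * i + 1) -
      SkewPoly.powerSum k n (2 * i + 1 + (2 * i + 1))) = 0 := by
    rw [Algebra.smul_def, map_ofNat, h]
  rw [smul_eq_zero_iff_right (NeZero.ne (2 : k)), sub_eq_zero] at h2
  rw [pow_two, h2]
  congr 1
  ring

end CoverAlgebra

/-! ### Generators of the ring of invariants -/

namespace SkewPoly

variable (k : Type u) [Field k] (n : ℕ)

theorem exists_pow_x_mul_basis (i : Fin n) (m : ℕ) (α : Fin n → ℕ) : ∃ c : k, c ≠ 0 ∧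
    x k n i ^ m * basis k n α = c • basis k n (α + m • Pi.single i 1) := by
  induction m with
  | zero => exact ⟨1, one_ne_zero, by rw [pow_zero, one_mul, one_smul, zero_smul, add_zero]⟩
  | succ m ih =>
    obtain ⟨c, hc, h⟩ := ih
    refine ⟨c * Fock.sign k i (α + m • Pi.single i 1), mul_ne_zero hc ?_, ?_⟩
    · exact left_ne_zero_of_mul_eq_one (Fock.sign_mul_self _ _)
    · rw [pow_succ', mul_assoc, h, mul_smul_comm, x_mul_basis, smul_smul, add_assoc, succ_nsmul]

theorem permute_basis_of_fixed (σ : Equiv.Perm (Fin n)) (α : Fin n → ℕ)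
    (h : ∀ l, σ l ≠ l → α l = 0) : permute k n σ (basis k n α) = basis k n α := by
  rw [basis_apply, orderedMonomial, map_list_prod, List.map_map]
  congr 2
  ext l
  rw [Function.comp_apply, map_pow, permute_x]
  by_cases hl : σ l = l
  · rw [hl]
  · rw [h l hl, pow_zero, pow_zero]

theorem permute_permute (σ τ : Equiv.Perm (Fin n)) (f : SkewPoly k n) :
    permute k n σ (permute k n τ f) = permute k n (σ * τ) f := by
  refine AlgHom.congr_fun (algHom_ext k n fun i => ?_ :
    (permute k n σ).comp (permute k n τ) = permute k n (σ * τ)) f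
  rw [AlgHom.comp_apply, permute_x, permute_x, permute_x, Equiv.Perm.mul_apply]

/-- The sum over the orbit (with multiplicities), that is, the Reynolds operator without its
denominator. -/
noncomputable def orbitSum : SkewPoly k n →ₗ[k] SkewPoly k n :=
  ∑ σ : Equiv.Perm (Fin n), (permute k n σ).toLinearMap

theorem orbitSum_apply (f : SkewPoly k n) : orbitSum k n f = ∑ σ, permute k n σ f := by
  rw [orbitSum, LinearMap.sum_apply]
  rfl

theorem orbitSum_permute (σ : Equiv.Perm (Fin n)) (f : SkewPoly k n) :
    orbitSum k n (permute k n σ f) = orbitSum k n f := by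
  simp_rw [orbitSum_apply, permute_permute]
  exact Equiv.sum_comp (Equiv.mulRight σ) fun τ => permute k n τ f

theorem orbitSum_mul {f : SkewPoly k n} (hf : f ∈ invariants k n) (g : SkewPoly k n) :
    orbitSum k n (f * g) = f * orbitSum k n g := by
  rw [mem_invariants] at hf
  simp_rw [orbitSum_apply, map_mul, hf, Finset.mul_sum]

theorem orbitSum_of_mem {f : SkewPoly k n} (hf : f ∈ invariants k n) :
    orbitSum k n f = (Fintype.card (Equiv.Perm (Fin n)) : k) • f := by
  rw [mem_invariants] at hf
  simp_rw [orbitSum_apply, hf, Finset.sum_const, Finset.card_univ, Nat.cast_smul_eq_nsmul]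

/-- The orbit sums of monomials lie in every subalgebra that contains the power sums: the product
of `P_m` with the orbit sum of `x^β` is a positive multiple of the orbit sum of `x_j^m x^β`, where
`x_j` does not occur in `x^β`, up to orbit sums of monomials in the variables of `x^β`. -/
theorem orbitSum_basis_mem [CharZero k] (R : Subalgebra k (SkewPoly k n))
    (hR : ∀ m, powerSum k n m ∈ R) (α : Fin n → ℕ) : orbitSum k n (basis k n α) ∈ R := by
  classical
  obtain ⟨s, hs⟩ : ∃ s, (Finset.univ.filter fun l => α l ≠ 0).card = s := ⟨_, rfl⟩
  induction s generalizing α with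
  | zero =>
    have hα : α = 0 := by
      ext l
      by_contra h
      rw [Finset.card_eq_zero] at hs
      exact Finset.notMem_empty l (hs ▸ Finset.mem_filter.2 ⟨Finset.mem_univ l, h⟩)
    rw [hα, basis_apply, orderedMonomial_zero, orbitSum_of_mem k n (one_mem _)]
    exact Subalgebra.smul_mem _ (one_mem _) _
  | succ s ih =>
    obtain ⟨j, hj⟩ : (Finset.univ.filter fun l => α l ≠ 0).Nonempty :=
      Finset.card_pos.1 (by omega)
    have hj0 : α j ≠ 0 := (Finset.mem_filter.1 hj).2
    let β : Fin n → ℕ := Function.update α j 0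
    have hβj : β j = 0 := Function.update_self _ _ _
    have hβ : ∀ l, l ≠ j → β l = α l := fun l h => Function.update_of_ne h _ _
    have hαβ : α = β + α j • Pi.single j 1 := by
      ext l
      by_cases h : l = j
      · subst h; simp [hβj]
      · simp [hβ l h, h]
    have hsupp : (Finset.univ.filter fun l => β l ≠ 0) =
        (Finset.univ.filter fun l => α l ≠ 0).erase j := by
      ext l
      rw [Finset.mem_erase, Finset.mem_filter, Finset.mem_filter]
      by_cases h : l = j
      · simp [h, hβj]
      · simp [h, hβ l h]
    have hcard : (Finset.univ.filter fun l => β l ≠ 0).card = s := by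
      rw [hsupp, Finset.card_erase_of_mem hj, hs, Nat.add_sub_cancel]
    -- The summands for the variables that do not occur in `x^β` all have the same orbit sum.
    have hnew : ∀ i, β i = 0 → orbitSum k n (x k n i ^ α j * basis k n β) =
        orbitSum k n (x k n j ^ α j * basis k n β) := by
      intro i hi
      rw [← orbitSum_permute k n (Equiv.swap i j), map_mul, map_pow, permute_x,
        Equiv.swap_apply_left, permute_basis_of_fixed]
      intro l hl
      by_cases h1 : l = i
      · rw [h1, hi]
      · by_cases h2 : l = j
        · rw [h2, hβj]
        · exact absurd (Equiv.swap_apply_of_ne_of_ne h1 h2) hl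
    have hold : ∀ i, β i ≠ 0 → orbitSum k n (x k n i ^ α j * basis k n β) ∈ R := by
      intro i hi
      obtain ⟨c, -, hc⟩ := exists_pow_x_mul_basis k n i (α j) β
      rw [hc, map_smul]
      refine Subalgebra.smul_mem _ (ih _ ?_) _
      rw [← hcard]
      congr 1
      ext l
      by_cases h : l = i
      · simp [h, hi]
      · simp [h]
    have hprod : powerSum k n (α j) * orbitSum k n (basis k n β) ∈ R :=
      mul_mem (hR _) (ih β hcard)
    rw [← orbitSum_mul k n (powerSum_mem_invariants k n _), powerSum, Finset.sum_mul, map_sum,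
      ← Finset.sum_filter_add_sum_filter_not _ fun l => β l ≠ 0] at hprod
    have h1 := (add_mem_cancel_left (sum_mem fun i hi =>
      hold i (Finset.mem_filter.1 hi).2)).1 hprod
    rw [Finset.sum_congr rfl fun i hi => hnew i (not_not.1 (Finset.mem_filter.1 hi).2),
      Finset.sum_const, ← Nat.cast_smul_eq_nsmul k] at h1
    obtain ⟨c, hc, hc'⟩ := exists_pow_x_mul_basis k n j (α j) β
    rw [← hαβ] at hc'
    rw [hc', map_smul, smul_smul] at h1
    have hne : ((Finset.univ.filter fun l => ¬ β l ≠ 0).card : k) * c ≠ 0 := by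
      refine mul_ne_zero (Nat.cast_ne_zero.2 (Finset.card_pos.2 ⟨j, ?_⟩).ne') hc
      exact Finset.mem_filter.2 ⟨Finset.mem_univ j, not_not.2 hβj⟩
    have h2 := Subalgebra.smul_mem R h1 (((Finset.univ.filter fun l => ¬ β l ≠ 0).card : k) * c)⁻¹
    rwa [smul_smul, inv_mul_cancel₀ hne, one_smul] at h2

/-- The power sums generate the ring of invariants, because every invariant is a linear combination
of orbit sums of monomials. -/
theorem mem_of_powerSum_mem [CharZero k] (R : Subalgebra k (SkewPoly k n))
    (hR : ∀ m, powerSum k n m ∈ R) {f : SkewPoly k n} (hf : f ∈ invariants k n) : f ∈ R := by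
  have h : orbitSum k n f ∈ R := by
    have hle : Submodule.span k (Set.range (basis k n)) ≤
        (Subalgebra.toSubmodule R).comap (orbitSum k n) := Submodule.span_le.2 (by
      rintro _ ⟨α, rfl⟩
      exact orbitSum_basis_mem k n R hR α)
    exact hle ((basis k n).mem_span f)
  rw [orbitSum_of_mem k n hf] at h
  have hne : (Fintype.card (Equiv.Perm (Fin n)) : k) ≠ 0 :=
    Nat.cast_ne_zero.2 Fintype.card_ne_zero
  have h2 := Subalgebra.smul_mem R h (Fintype.card (Equiv.Perm (Fin n)) : k)⁻¹
  rwa [smul_smul, inv_mul_cancel₀ hne, one_smul] at h2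

/-- A recursion for the odd power sums, from an equation of degree `n` for the squares of the
variables. -/
theorem powerSum_odd_add (c : Fin n → MvPolynomial (Fin n) k)
    (hc : ∀ l : Fin n, (MvPolynomial.X l : MvPolynomial (Fin n) k) ^ n =
      ∑ i, esymmHom k n (c i) * MvPolynomial.X l ^ (i : ℕ)) (m : ℕ) :
    powerSum k n (2 * (m + n) + 1) =
      ∑ i : Fin n, algebraMap (MvPolynomial (Fin n) k) _ (esymmHom k n (c i)) *
        powerSum k n (2 * (m + i) + 1) := by
  simp_rw [powerSum, Finset.mul_sum]
  rw [Finset.sum_comm]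
  refine Finset.sum_congr rfl fun l _ => ?_
  have h : ∀ t, x k n l ^ (2 * t + 1) = algebraMap (MvPolynomial (Fin n) k) _
      (MvPolynomial.X l ^ t) * x k n l := fun t => by
    rw [map_pow, algebraMap_X, ← pow_mul, pow_succ]
  simp_rw [h, ← mul_assoc, ← map_mul]
  rw [← Finset.sum_mul, ← map_sum]
  congr 2
  rw [pow_add, hc, Finset.mul_sum]
  refine Finset.sum_congr rfl fun i _ => ?_
  rw [pow_add]
  ring

end SkewPoly

namespace CoverAlgebra

variable (k : Type u) [Field k] (n : ℕ)

theorem powerSum_mem_range (m : ℕ) : SkewPoly.powerSum k n m ∈ (toInvariants k n).range := by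
  rcases Nat.even_or_odd' m with ⟨m, rfl | rfl⟩
  · refine ⟨algebraMap _ _ (a k n m), (toInvariants_algebraMap k n _).trans ?_⟩
    rw [esymmHom_a, SkewPoly.algebraMap_psum]
  · obtain ⟨c, hc⟩ := exists_X_pow_eq_sum k n
    induction m using Nat.strong_induction_on with
    | _ m ih =>
      rcases lt_or_ge m n with hm | hm
      · exact ⟨y k n ⟨m, hm⟩, toInvariants_y k n _⟩
      · obtain ⟨m, rfl⟩ := Nat.exists_eq_add_of_le' hm
        rw [SkewPoly.powerSum_odd_add k n c hc]
        refine sum_mem fun i _ => mul_mem ⟨_, toInvariants_algebraMap k n _⟩ (ih _ ?_)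
        omega

theorem range_toInvariants [CharZero k] : (toInvariants k n).range = SkewPoly.invariants k n := by
  refine le_antisymm ?_ fun f hf =>
    SkewPoly.mem_of_powerSum_mem k n _ (powerSum_mem_range k n) hf
  rintro _ ⟨b, rfl⟩
  exact toInvariants_mem k n b

end CoverAlgebra

/-! ### The kernel of the homomorphism to the invariants -/

/-- A family of the size of a basis is linearly independent as soon as its span contains a nonzero
multiple of each basis element. -/
theorem linearIndependent_of_smul_mem_span {R M ι : Type*} [CommRing R] [IsDomain R]
    [AddCommGroup M] [Module R M] [Fintype ι] (b : Module.Basis ι R M) (v : ι → M) {d : R}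
    (hd : d ≠ 0) (h : ∀ i, d • b i ∈ Submodule.span R (Set.range v)) :
    LinearIndependent R v := by
  classical
  simp_rw [Submodule.mem_span_range_iff_exists_fun] at h
  choose c hc using h
  let C : Matrix ι ι R := Matrix.of c
  let A : Matrix ι ι R := Matrix.of fun i j => b.repr (v i) j
  have hrepr : ∀ (g : ι → R) j, b.repr (∑ i, g i • v i) j = ∑ i, g i * A i j := by
    intro g j
    rw [map_sum, Finsupp.finsetSum_apply]
    refine Finset.sum_congr rfl fun i _ => ?_
    rw [map_smul, Finsupp.smul_apply, smul_eq_mul]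
    rfl
  have hCA : C * A = d • (1 : Matrix ι ι R) := by
    ext i j
    rw [Matrix.mul_apply, Matrix.smul_apply, Matrix.one_apply, smul_eq_mul]
    change ∑ l, c i l * A l j = _
    rw [← hrepr, hc, map_smul, Finsupp.smul_apply, Module.Basis.repr_self, Finsupp.single_apply,
      smul_eq_mul]
  have hA : A.det ≠ 0 := by
    intro h0
    have h1 := congrArg Matrix.det hCA
    rw [Matrix.det_mul, h0, mul_zero, Matrix.det_smul, Matrix.det_one, mul_one] at h1
    exact pow_ne_zero _ hd h1.symm
  rw [Fintype.linearIndependent_iff]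
  intro g hg
  refine congrFun (Matrix.eq_zero_of_vecMul_eq_zero hA (v := g) ?_)
  ext j
  change ∑ i, g i * A i j = 0
  rw [← hrepr, hg, map_zero, Finsupp.zero_apply]

namespace CoverAlgebra

variable (k : Type u) [Field k] (n : ℕ)

/-- The products of distinct odd power sums `P_{2i-1}`, in increasing order of `i`. -/
noncomputable abbrev powerSumMonomial (ε : Fin n → Fin 2) : SkewPoly k n :=
  orderedMonomial (fun i : Fin n => SkewPoly.powerSum k n (2 * i + 1)) fun i => (ε i : ℕ)

theorem toInvariants_smul [NeZero (2 : k)] (q : MvPolynomial (Fin n) (MvPolynomial (Fin n) k))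
    (b : CoverAlgebra k n) : toInvariants k n (q • b) =
      esymmHom k n (MvPolynomial.constantCoeff q) • toInvariants k n b := by
  rw [Algebra.smul_def, Algebra.smul_def, map_mul]
  congr 1
  induction q using MvPolynomial.induction_on with
  | C c =>
    rw [MvPolynomial.constantCoeff_C, ← toInvariants_algebraMap,
      IsScalarTower.algebraMap_apply (MvPolynomial (Fin n) k)
        (MvPolynomial (Fin n) (MvPolynomial (Fin n) k)) (CoverAlgebra k n)]
    rfl
  | add q q' hq hq' => simp only [map_add, hq, hq']
  | mul_X q i hq =>
    rw [map_mul, map_mul, algebraMap_X, toInvariants_r, mul_zero, map_mul,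
      MvPolynomial.constantCoeff_X, mul_zero, map_zero, map_zero]

/-- In coordinates for the basis of square-free monomials over `k[p₁, …, pₙ][r₁, …, rₙ]`, the
homomorphism to the invariants sets the `r_i` to `0`. -/
theorem exists_toInvariants_eq_sum [NeZero (2 : k)]
    (B : Module.Basis (Fin n → Fin 2) (MvPolynomial (Fin n) (MvPolynomial (Fin n) k))
      (CoverAlgebra k n)) (hB : ∀ ε, B ε = orderedMonomial (y k n) fun i => (ε i : ℕ))
    (b : CoverAlgebra k n) : toInvariants k n b =
      ∑ ε, esymmHom k n (MvPolynomial.constantCoeff (B.repr b ε)) • powerSumMonomial k n ε := by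
  conv_lhs => rw [← B.sum_repr b]
  rw [map_sum]
  refine Finset.sum_congr rfl fun ε _ => ?_
  rw [toInvariants_smul, hB, powerSumMonomial, orderedMonomial, orderedMonomial, map_list_prod,
    List.map_map]
  congr 3
  ext i
  rw [Function.comp_apply, map_pow, toInvariants_y]

/-- The matrix that expresses the odd power sums through the variables is a Vandermonde matrix in
the squares of the variables, so its determinant multiplies every variable into the span of the
odd power sums. -/
theorem exists_smul_x_mem : ∃ d : MvPolynomial (Fin n) k, d ≠ 0 ∧
    ∀ l, d • SkewPoly.x k n l ∈ Submodule.span (MvPolynomial (Fin n) k)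
      (Set.range fun i : Fin n => SkewPoly.powerSum k n (2 * i + 1)) := by
  let V : Matrix (Fin n) (Fin n) (MvPolynomial (Fin n) k) :=
    (Matrix.vandermonde MvPolynomial.X).transpose
  refine ⟨V.det, ?_, fun l => ?_⟩
  · rw [Matrix.det_transpose]
    exact Matrix.det_vandermonde_ne_zero_iff.2 (MvPolynomial.X_injective)
  · have hP : ∀ i : Fin n, SkewPoly.powerSum k n (2 * i + 1) = ∑ j, V i j • SkewPoly.x k n j := by
      intro i
      refine Finset.sum_congr rfl fun j _ => ?_
      have hV : V i j = MvPolynomial.X j ^ (i : ℕ) := Matrix.vandermonde_apply _ j i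
      rw [hV, Algebra.smul_def, map_pow, SkewPoly.algebraMap_X, ← pow_mul, pow_succ]
    have h : V.det • SkewPoly.x k n l =
        ∑ i, V.adjugate l i • SkewPoly.powerSum k n (2 * (i : ℕ) + 1) := by
      simp_rw [hP, Finset.smul_sum, smul_smul]
      rw [Finset.sum_comm]
      simp_rw [← Finset.sum_smul, ← Matrix.mul_apply, Matrix.adjugate_mul, Matrix.smul_apply,
        Matrix.one_apply, smul_eq_mul, mul_ite, mul_one, mul_zero, ite_smul, zero_smul]
      rw [Finset.sum_ite_eq, if_pos (Finset.mem_univ l)]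
    rw [h]
    exact Submodule.sum_mem _ fun i _ =>
      Submodule.smul_mem _ _ (Submodule.subset_span ⟨i, rfl⟩)

/-- The span of the invariants over the polynomials in the `x_i ^ 2` is a ring that contains a
multiple of every variable, by a factor that is not a zero divisor; hence it has full rank. -/
theorem linearIndependent_powerSumMonomial [NeZero (2 : k)] :
    LinearIndependent (MvPolynomial (Fin n) k) (powerSumMonomial k n) := by
  obtain ⟨b, hb⟩ := SkewPoly.exists_squarefreeBasis k n
  obtain ⟨B, hB⟩ := exists_centralBasis k n
  obtain ⟨d, hd, hdx⟩ := exists_smul_x_mem k n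
  let M : Submodule (MvPolynomial (Fin n) k) (SkewPoly k n) :=
    Submodule.span _ (Set.range (toInvariants k n))
  have hM : M ≤ Submodule.span _ (Set.range (powerSumMonomial k n)) := by
    refine Submodule.span_le.2 ?_
    rintro _ ⟨c, rfl⟩
    rw [exists_toInvariants_eq_sum k n B hB]
    exact Submodule.sum_mem _ fun ε _ =>
      Submodule.smul_mem _ _ (Submodule.subset_span ⟨ε, rfl⟩)
  have hMmul : ∀ f ∈ M, ∀ g ∈ M, f * g ∈ M := by
    have h : M * M ≤ M := by
      rw [Submodule.span_mul_span]
      refine Submodule.span_mono ?_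
      rintro _ ⟨_, ⟨c, rfl⟩, _, ⟨c', rfl⟩, rfl⟩
      exact ⟨c * c', map_mul _ _ _⟩
    exact fun f hf g hg => h (Submodule.mul_mem_mul hf hg)
  have hM1 : (1 : SkewPoly k n) ∈ M := Submodule.subset_span ⟨1, map_one _⟩
  have hMx : ∀ (l : Fin n) (e : Fin 2), d • SkewPoly.x k n l ^ (e : ℕ) ∈ M := by
    intro l e
    fin_cases e
    · simpa using Submodule.smul_mem M d hM1
    · change d • SkewPoly.x k n l ^ 1 ∈ M
      rw [pow_one]
      refine Submodule.span_mono ?_ (hdx l)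
      rintro _ ⟨i, rfl⟩
      exact ⟨y k n i, toInvariants_y k n i⟩
  refine linearIndependent_of_smul_mem_span b _ (pow_ne_zero n hd) fun ε => hM ?_
  have hlist : ∀ L : List (Fin n),
      d ^ L.length • (L.map fun l => SkewPoly.x k n l ^ (ε l : ℕ)).prod ∈ M := by
    intro L
    induction L with
    | nil => simpa using hM1
    | cons l L ih =>
      rw [List.length_cons, pow_succ', List.map_cons, List.prod_cons, ← smul_mul_smul_comm]
      exact hMmul _ (hMx l _) _ ih
  have h := hlist (List.finRange n)
  rw [List.length_finRange] at h
  rw [hb]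
  exact h

theorem toInvariants_eq_zero_iff [NeZero (2 : k)] (b : CoverAlgebra k n) :
    toInvariants k n b = 0 ↔ b ∈ TwoSidedIdeal.span (Set.range (r k n)) := by
  obtain ⟨B, hB⟩ := exists_centralBasis k n
  rw [← Set.image_univ, mem_span_r_iff, B.mem_smul_top_iff, exists_toInvariants_eq_sum k n B hB]
  have hvar : ∀ q : MvPolynomial (Fin n) (MvPolynomial (Fin n) k),
      q ∈ varIdeal (MvPolynomial (Fin n) k) Set.univ ↔ MvPolynomial.constantCoeff q = 0 := by
    intro q
    rw [varIdeal, MvPolynomial.mem_ideal_span_X_image, MvPolynomial.constantCoeff_eq]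
    constructor
    · intro h
      by_contra h0
      obtain ⟨l, -, hl⟩ := h 0 (MvPolynomial.mem_support_iff.2 h0)
      exact hl rfl
    · intro h m hm
      by_contra! hl
      have hm0 : m = 0 := Finsupp.ext fun l => hl l (Set.mem_univ l)
      rw [hm0] at hm
      exact MvPolynomial.mem_support_iff.1 hm h
  simp_rw [hvar]
  constructor
  · intro h ε
    have h1 := Fintype.linearIndependent_iff.1 (linearIndependent_powerSumMonomial k n) _ h ε
    rwa [map_eq_zero_iff _ (esymmHom_injective k n)] at h1
  · intro h
    simp [h]

end CoverAlgebra

/-! ### The ring of invariants as a quotient -/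

namespace SkewPoly

variable (k : Type u) [Field k] (n : ℕ)

theorem exists_coaction : ∃ ψ : SkewPoly k n →ₐ[k] Polynomial (SkewPoly k n),
    ∀ i, ψ (x k n i) = Polynomial.monomial 1 (x k n i) :=
  exists_lift _ fun i l h => by
    rw [Polynomial.monomial_mul_monomial, Polynomial.monomial_mul_monomial, x_anticomm k n i l h,
      map_neg]

theorem pow_x_mem (i : Fin n) (m : ℕ) : x k n i ^ m ∈ wordGrading k (x k n) (fun _ => 1) m := by
  simpa using pow_mem_wordGrading (k := k) _ _ (gen_mem_wordGrading (x k n) (fun _ => 1) i) m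

theorem powerSum_mem_wordGrading (m : ℕ) :
    powerSum k n m ∈ wordGrading k (x k n) (fun _ => 1) m :=
  sum_mem fun i _ => pow_x_mem k n i m

theorem elemSquares_mem_wordGrading (m : ℕ) :
    elemSquares k n m ∈ wordGrading k (x k n) (fun _ => 1) (2 * m) := by
  have := gradedMonoid_wordGrading (k := k) (x k n) fun _ => 1
  refine sum_mem fun s hs => ?_
  have h := SetLike.list_prod_map_mem_graded (A := wordGrading k (x k n) fun _ => 1)
    (s.sort (· ≤ ·)) (fun _ => 2) (fun i => x k n i ^ 2) fun i _ => pow_x_mem k n i 2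
  rwa [List.map_const', List.sum_replicate, Finset.length_sort,
    (Finset.mem_powersetCard.1 hs).2, smul_eq_mul, mul_comm] at h

end SkewPoly

namespace CoverAlgebra

variable (k : Type u) [Field k] (n : ℕ)

theorem toInvariants_mem_wordGrading {d : ℕ} {b : CoverAlgebra k n} (hb : b ∈ grading k n d) :
    toInvariants k n b ∈ wordGrading k (SkewPoly.x k n) (fun _ => 1) d := by
  have := gradedMonoid_wordGrading (k := k) (SkewPoly.x k n) fun _ => 1
  induction hb using Submodule.span_induction with
  | mem b hb =>
    obtain ⟨l, rfl, rfl⟩ := hb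
    rw [map_list_prod, List.map_map]
    refine SetLike.list_prod_map_mem_graded _ _ _ fun i _ => ?_
    rcases i with i | i
    · rw [Function.comp_apply, Sum.elim_inl, Sum.elim_inl, toInvariants_p]
      exact SkewPoly.elemSquares_mem_wordGrading k n _
    · rw [Function.comp_apply, Sum.elim_inr, Sum.elim_inr, toInvariants_y]
      exact SkewPoly.powerSum_mem_wordGrading k n _
  | zero => rw [map_zero]; exact zero_mem _
  | add a b _ _ ha hb => rw [map_add]; exact add_mem ha hb
  | smul c b _ hb => rw [map_smul]; exact Submodule.smul_mem _ _ hb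

theorem exists_toInvariants_eq [CharZero k] {f : SkewPoly k n} (hf : f ∈ SkewPoly.invariants k n) :
    ∃ b, toInvariants k n b = f := by
  rwa [← range_toInvariants] at hf

/-- The homogeneous components of `φ(b)` are the images of the homogeneous components of `b`. -/
theorem exists_toInvariants_eq_coeff (ψ : SkewPoly k n →ₐ[k] Polynomial (SkewPoly k n))
    (hψ : ∀ i, ψ (SkewPoly.x k n i) = Polynomial.monomial 1 (SkewPoly.x k n i))
    (b : CoverAlgebra k n) (d : ℕ) :
    ∃ c ∈ grading k n d, toInvariants k n c = (ψ (toInvariants k n b)).coeff d := by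
  obtain ⟨ψB, -, hψB⟩ := exists_coaction k n
  have hcomp : ψ.comp (toInvariants k n) =
      (Polynomial.mapAlgHom (toInvariants k n)).comp ψB := by
    have hgen : ∀ i, ψ (toInvariants k n (Sum.elim (p k n) (y k n) i)) =
        Polynomial.mapAlgHom (toInvariants k n) (ψB (Sum.elim (p k n) (y k n) i)) := by
      intro i
      rw [hψB, Polynomial.coe_mapAlgHom, Polynomial.map_monomial]
      exact coaction_of_mem _ _ hψ (toInvariants_mem_wordGrading k n
        (gen_mem_wordGrading (Sum.elim (p k n) (y k n)) (weight n) i))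
    exact algHom_ext k n (fun i => hgen (Sum.inl i)) fun i => hgen (Sum.inr i)
  refine ⟨(ψB b).coeff d, coeff_coaction_mem _ _ hψB (adjoin_generators k n) b d, ?_⟩
  have h := congrArg (fun Q => Polynomial.coeff Q d) (AlgHom.congr_fun hcomp b)
  simp only [AlgHom.comp_apply, Polynomial.coe_mapAlgHom, Polynomial.coeff_map] at h
  exact h.symm

/-- The isomorphism of `B / (r₁, …, rₙ)` with the ring of invariants. -/
theorem exists_quotientEquiv_invariants [CharZero k] :
    ∃ e : QuotientBy (Set.range (r k n)) ≃ₐ[k] SkewPoly.invariants k n,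
      ∀ b, (e (quotientMap k (Set.range (r k n)) b) : SkewPoly k n) = toInvariants k n b := by
  let φ : CoverAlgebra k n →ₐ[k] SkewPoly.invariants k n :=
    (toInvariants k n).codRestrict (SkewPoly.invariants k n) (toInvariants_mem k n)
  have hsurj : Function.Surjective φ := by
    rintro ⟨f, hf⟩
    obtain ⟨b, rfl⟩ := exists_toInvariants_eq k n hf
    exact ⟨b, rfl⟩
  have hker : ∀ b, φ b = 0 ↔ b ∈ TwoSidedIdeal.span (Set.range (r k n)) := by
    intro b
    rw [← toInvariants_eq_zero_iff, ← Subtype.coe_inj]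
    rfl
  obtain ⟨e, he⟩ := exists_quotientEquiv (Set.range (r k n)) φ hsurj hker
  exact ⟨e, fun b => congrArg Subtype.val (he b)⟩

theorem map_grading_eq_invariantsGrading [CharZero k]
    {e : QuotientBy (Set.range (r k n)) ≃ₐ[k] SkewPoly.invariants k n}
    (he : ∀ b, (e (quotientMap k (Set.range (r k n)) b) : SkewPoly k n) = toInvariants k n b)
    (d : ℕ) : (grading k n d).map
      (e.toAlgHom.comp (quotientMap k (Set.range (r k n)))).toLinearMap =
        SkewPoly.invariantsGrading k n d := by
  ext f
  constructor
  · rintro ⟨b, hb, rfl⟩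
    change ((e (quotientMap k (Set.range (r k n)) b)) : SkewPoly k n) ∈
      wordGrading k (SkewPoly.x k n) (fun _ => 1) d
    rw [he]
    exact toInvariants_mem_wordGrading k n hb
  · intro hf
    obtain ⟨ψ, hψ⟩ := SkewPoly.exists_coaction k n
    obtain ⟨b, hb⟩ := exists_toInvariants_eq k n f.2
    obtain ⟨c, hc, hcb⟩ := exists_toInvariants_eq_coeff k n ψ hψ b d
    refine ⟨c, hc, Subtype.ext ((he c).trans ?_)⟩
    have hf' : (f : SkewPoly k n) ∈ wordGrading k (SkewPoly.x k n) (fun _ => 1) d := hf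
    rw [hcb, hb, coaction_of_mem _ _ hψ hf', Polynomial.coeff_monomial_same]

end CoverAlgebra

namespace SkewPoly

variable (k : Type u) [Field k] [CharZero k] (n : ℕ)

/-- The homogeneous components of an invariant are invariant, because they are images of elements
of `B`. -/
theorem isConnectedGraded_invariants : IsConnectedGraded k (invariantsGrading k n) where
  nontrivial := inferInstance
  graded := by
    obtain ⟨ψ, hψ⟩ := exists_coaction k n
    have hgm := gradedMonoid_wordGrading (k := k) (x k n) fun _ => 1
    have hψmem : ∀ d, ∀ f ∈ invariants k n, (ψ f).coeff d ∈ invariants k n := by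
      intro d f hf
      obtain ⟨b, rfl⟩ := CoverAlgebra.exists_toInvariants_eq k n hf
      obtain ⟨c, -, hc⟩ := CoverAlgebra.exists_toInvariants_eq_coeff k n ψ hψ b d
      exact hc ▸ CoverAlgebra.toInvariants_mem k n c
    refine nonempty_gradedAlgebra
      { one_mem := one_mem_wordGrading (k := k) (x k n) fun _ => 1
        mul_mem := fun i j f g hf hg => mul_mem_wordGrading (k := k) (x k n) _ hf hg }
      (isInternal_of_projections _ (fun d =>
        { toFun := fun f => ⟨(ψ f).coeff d, hψmem d f f.2⟩
          map_zero' := Subtype.ext (by simp)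
          map_add' := fun f g => Subtype.ext (by simp) }) ?_ ?_ ?_)
    · intro d f hf
      have hf' : (f : SkewPoly k n) ∈ wordGrading k (x k n) (fun _ => 1) d := hf
      refine Subtype.ext ?_
      change (ψ f).coeff d = f
      rw [coaction_of_mem _ _ hψ hf', Polynomial.coeff_monomial_same]
    · intro d d' h f hf
      have hf' : (f : SkewPoly k n) ∈ wordGrading k (x k n) (fun _ => 1) d' := hf
      refine Subtype.ext ?_
      change (ψ f).coeff d = 0
      rw [coaction_of_mem _ _ hψ hf', Polynomial.coeff_monomial_of_ne _ h]
    · intro P hP f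
      let φ := (CoverAlgebra.toInvariants k n).codRestrict (invariants k n)
        (CoverAlgebra.toInvariants_mem k n)
      obtain ⟨b, hb⟩ := CoverAlgebra.exists_toInvariants_eq k n f.2
      obtain rfl : φ b = f := Subtype.ext hb
      refine wordGrading_induction _ (CoverAlgebra.weight n) (CoverAlgebra.adjoin_generators k n)
        (P.comap φ.toLinearMap.toAddMonoidHom) (fun d c hc => hP d _ ?_) b
      exact CoverAlgebra.toInvariants_mem_wordGrading k n hc
  zero_eq := by
    ext f
    have h : f ∈ invariantsGrading k n 0 ↔
        (f : SkewPoly k n) ∈ (1 : Submodule k (SkewPoly k n)) := by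
      rw [← wordGrading_zero (k := k) (x k n) (fun _ => 1) fun _ => Nat.one_pos]
      rfl
    rw [h, Submodule.mem_one, Submodule.mem_one]
    exact exists_congr fun c => ⟨fun h => Subtype.ext h, fun h => congrArg Subtype.val h⟩

theorem isCCI_invariants : IsCCI k (invariantsGrading k n) := by
  obtain ⟨e, he⟩ := CoverAlgebra.exists_quotientEquiv_invariants k n
  refine ⟨isConnectedGraded_invariants k n, ?_, CoverAlgebra k n, inferInstance, inferInstance,
    CoverAlgebra.grading k n, 2 * n, n, CoverAlgebra.r k n, e,
    CoverAlgebra.isTwoSidedNoetherian k n, CoverAlgebra.isASRegular k n,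
    fun i => ⟨_, Nat.succ_pos _, CoverAlgebra.r_mem_grading k n i⟩,
    CoverAlgebra.isRegularSequence_r k n, CoverAlgebra.isNormalSequence_r k n,
    CoverAlgebra.map_grading_eq_invariantsGrading k n he⟩
  obtain ⟨h, hop⟩ := CoverAlgebra.isTwoSidedNoetherian k n
  let f : CoverAlgebra k n →+* invariants k n :=
    (e.toAlgHom.comp (quotientMap k (Set.range (CoverAlgebra.r k n)))).toRingHom
  have hf : Function.Surjective f :=
    e.surjective.comp (quotientMap_surjective (k := k) (Set.range (CoverAlgebra.r k n)))
  refine ⟨isNoetherianRing_of_surjective _ _ f hf,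
    isNoetherianRing_of_surjective _ _ (RingHom.op f) ?_⟩
  intro g
  obtain ⟨b, hb⟩ := hf g.unop
  exact ⟨MulOpposite.op b, MulOpposite.unop_injective hb⟩

end SkewPoly

theorem theorem3p12 {k : Type u} [Field k] [CharZero k] (n : ℕ) :
    -- `B` is the iterated Ore extension, connected graded, noetherian, AS regular of dim `2n`
    CoverAlgebra.IsIteratedOreExtension k n ∧
    IsTwoSidedNoetherian (CoverAlgebra k n) ∧
    IsASRegular k (CoverAlgebra.grading k n) (2 * n) ∧
    -- the `r_i` are homogeneous of degree `4i - 2` and form a central regular sequence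
    (∀ i : Fin n, CoverAlgebra.r k n i ∈ CoverAlgebra.grading k n (4 * i + 2)) ∧
    (∀ i : Fin n, CoverAlgebra.r k n i ∈ Subalgebra.center k (CoverAlgebra k n)) ∧
    IsRegularSequence k (CoverAlgebra.r k n) ∧
    -- the graded isomorphism of `B / (r₁, …, rₙ)` with the ring of invariants
    (∃ e : QuotientBy (Set.range (CoverAlgebra.r k n)) ≃ₐ[k] SkewPoly.invariants k n,
      (∀ i : Fin n,
        (e (quotientMap k (Set.range (CoverAlgebra.r k n)) (CoverAlgebra.p k n i)) :
          SkewPoly k n) = SkewPoly.elemSquares k n (i + 1)) ∧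
      (∀ i : Fin n,
        (e (quotientMap k (Set.range (CoverAlgebra.r k n)) (CoverAlgebra.y k n i)) :
          SkewPoly k n) = SkewPoly.powerSum k n (2 * i + 1)) ∧
      (∀ d : ℕ, (CoverAlgebra.grading k n d).map
        (e.toAlgHom.comp (quotientMap k (Set.range (CoverAlgebra.r k n)))).toLinearMap =
          SkewPoly.invariantsGrading k n d)) ∧
    -- the ring of invariants is a classical complete intersection
    IsCCI k (SkewPoly.invariantsGrading k n) := by
  obtain ⟨e, he⟩ := CoverAlgebra.exists_quotientEquiv_invariants k n
  exact ⟨CoverAlgebra.isIteratedOreExtension k n, CoverAlgebra.isTwoSidedNoetherian k n,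
    CoverAlgebra.isASRegular k n, CoverAlgebra.r_mem_grading k n, CoverAlgebra.r_mem_center k n,
    CoverAlgebra.isRegularSequence_r k n,
    ⟨e, fun i => (he _).trans (CoverAlgebra.toInvariants_p k n i),
      fun i => (he _).trans (CoverAlgebra.toInvariants_y k n i),
      CoverAlgebra.map_grading_eq_invariantsGrading k n he⟩,
    SkewPoly.isCCI_invariants k n⟩
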